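/- **Conventions.** For $w\in\{\mathbb 1,X,Z\}^N$ and $u\in\{0,1\}^N$ let $\sigma_w=\bigotimes_i\sigma_{w_i}$ and $\pi^w_u=\bigotimes_{i=1}^N\frac{\mathbb 1+(-1)^{u_i}\sigma_{w_i}}{2}$, with $\sigma_{\mathbb 1}=\mathbb 1$. A Hamiltonian problem $(H,\alpha,\beta)$ on $N$ qubits is a YES instance if the lowest eigenvalue of the Hermitian operator $H$ is $\le\alpha$ and a NO instance if it is $\ge\beta$. A *2-local X/Z Hamiltonian family with inverse-polynomial promise gap* is a sequence of sets $\mathcal H(n)$, $n\in\mathbb N$, whose elements are $n$-qubit problems $(H,\alpha(n),\beta(n))$, where $\alpha(n),\beta(n)$ are rational, depend only on $n$ and satisfy $\beta(n)-\alpha(n)\ge 1/\mathrm{poly}(n)$, and $H=\sum_j c_j\sigma_{w_j}$ has at most $\mathrm{poly}(n)$ terms, each with at most two non-identity tensor factors and with a rational weight $|c_j|\le\mathrm{poly}(n)$; the binary description of $(H,\alpha(n),\beta(n))$ (which contains $n$ in unary) has length at most $\mathrm{poly}(n)$. **Theorem.** Let $\mathcal H=\{\mathcal H(n)\}_{n\in\mathbb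 N}$ be a 2-local X/Z Hamiltonian family with inverse-polynomial promise gap (for example, a $\mathsf{QMA}$-complete one). Then there are polynomials $t$ and $s$, functions $\alpha',\beta':\mathbb N\to\mathbb Q$ and a negligible function $\nu$ with $\beta'(n)-\alpha'(n)\ge 1-\nu(n)$ for all $n$, and a polynomial-time computable (Karp) reduction that maps the description of each $(H,\alpha(n),\beta(n))\in\mathcal H(n)$ to $(y,\alpha'(n),\beta'(n))$, where $y$ describes a Hamiltonian $H'$ on $t(n)\cdot n$ qubits of the form $$H'=\mathbb 1-\mathop{\mathbb E}_{w\sim D}\ \sum_{a\in T(w)}\pi^w_a ,$$ such that: 1. if $(H,\alpha(n),\beta(n))$ is a YES instance, then so is $(H',\alpha'(n),\beta'(n))$, and if $(H,\alpha(n),\beta(n))$ is a NO instance, then so is $(H',\alpha'(n),\beta'(n))$; 2. membership of $a\in\{0,1\}^{t(n)\cdot n}$ in $T(w)\subseteq\{0,1\}^{t(n)\cdot n}$ is decided, given $n$ (in unary), $y$, $w$ and $a$, by one uniform algorithm in time polynomial in its input length (hence in $n$); 3. $D$ is a distribution over $\{\mathbb 1,X,Z\}^{t(n)\cdot n}$ that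 one uniform algorithm samples exactly, given $n$ (in unary), $y$ and $s(\lfloor\log_2 n\rfloor)$ uniformly random bits (with $\lfloor\log_2 0\rfloor:=0$), in time polynomial in its input length; that is, the sampling randomness ranges over a set of size $2^{\mathrm{poly}\log n}$. -/

import Mathlib

namespace XZSubsampling

/-! ### Qubits, Pauli strings, Hamiltonian problems -/

/-- Bit strings of length `N`; they also index the computational basis of `N` qubits. -/
abbrev BitString (N : ℕ) : Type := Fin N → Bool

/-- The alphabet `{𝟙, X, Z}`. -/
inductive PauliLetter : Type
  | I
  | X
  | Z
  deriving DecidableEq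

instance : Fintype PauliLetter :=
  ⟨{.I, .X, .Z}, fun p => by cases p <;> decide⟩

abbrev PauliString (N : ℕ) : Type := Fin N → PauliLetter

/-- The `2 × 2` matrices `𝟙`, `σ_X`, `σ_Z`. -/
def PauliLetter.mat : PauliLetter → Matrix Bool Bool ℂ
  | .I => 1
  | .X => Matrix.of fun x y => if x = y then 0 else 1
  | .Z => Matrix.diagonal fun x => if x then -1 else 1

/-- Operators on `N` qubits. -/
abbrev QubitOp (N : ℕ) : Type := Matrix (BitString N) (BitString N) ℂ

/-- The tensor product of `N` one-qubit operators. -/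
def tensor {N : ℕ} (A : Fin N → Matrix Bool Bool ℂ) : QubitOp N :=
  Matrix.of fun x y => ∏ i, A i (x i) (y i)

/-- `σ_w = ⨂ᵢ σ_{wᵢ}`. -/
def pauliOp {N : ℕ} (w : PauliString N) : QubitOp N :=
  tensor fun i => (w i).mat

/-- `π^w_u = ⨂ᵢ (𝟙 + (-1)^{uᵢ} σ_{wᵢ}) / 2`. -/
noncomputable def pauliProj {N : ℕ} (w : PauliString N) (u : BitString N) : QubitOp N :=
  tensor fun i => (1 / 2 : ℂ) • (1 + ((-1 : ℂ) ^ (u i).toNat) • (w i).mat)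

/-- A Hamiltonian problem `(H, α, β)` on `N` qubits. -/
structure HamiltonianProblem (N : ℕ) where
  op : QubitOp N
  isHermitian : op.IsHermitian
  α : ℝ
  β : ℝ

/-- The ground energy: the lowest eigenvalue. -/
noncomputable def HamiltonianProblem.groundEnergy {N : ℕ} (P : HamiltonianProblem N) : ℝ :=
  sInf (spectrum ℝ P.op)

def HamiltonianProblem.IsYes {N : ℕ} (P : HamiltonianProblem N) : Prop :=
  P.groundEnergy ≤ P.α

def HamiltonianProblem.IsNo {N : ℕ} (P : HamiltonianProblem N) : Prop :=
  P.β ≤ P.groundEnergy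

theorem PauliLetter.mat_isHermitian (p : PauliLetter) : p.mat.IsHermitian := by
  ext x y
  cases p <;> cases x <;> cases y <;> simp [PauliLetter.mat]

theorem tensor_isHermitian {N : ℕ} (A : Fin N → Matrix Bool Bool ℂ)
    (hA : ∀ i, (A i).IsHermitian) : (tensor A).IsHermitian := by
  ext x y
  simp only [tensor, Matrix.conjTranspose_apply, Matrix.of_apply, star_prod]
  exact Finset.prod_congr rfl fun i _ => (hA i).apply _ _

theorem pauliOp_isHermitian {N : ℕ} (w : PauliString N) : (pauliOp w).IsHermitian :=
  tensor_isHermitian _ fun i => (w i).mat_isHermitian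

theorem pauliProj_isHermitian {N : ℕ} (w : PauliString N) (u : BitString N) :
    (pauliProj w u).IsHermitian := by
  refine tensor_isHermitian _ fun i => ?_
  have h := (w i).mat_isHermitian
  rw [Matrix.IsHermitian] at h ⊢
  cases u i <;> simp [Matrix.conjTranspose_add, Matrix.conjTranspose_smul, h]

/-! ### X/Z Hamiltonians -/

/-- A weighted sum of Pauli strings over `{𝟙, X, Z}` on `n` qubits together with two thresholds,
given by finite (rational) data. -/
structure XZProblem (n : ℕ) where
  terms : List (ℚ × PauliString n)
  α : ℚ
  β : ℚ

theorem sum_isHermitian {n : ℕ} (l : List (ℚ × PauliString n)) :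
    ((l.map fun τ => ((τ.1 : ℂ) • pauliOp τ.2)).sum).IsHermitian := by
  induction l with
  | nil => simp
  | cons τ l ih =>
    rw [List.map_cons, List.sum_cons]
    refine Matrix.IsHermitian.add ?_ ih
    have h := pauliOp_isHermitian τ.2
    rw [Matrix.IsHermitian] at h ⊢
    simp [Matrix.conjTranspose_smul, h]

/-- The problem `(∑_τ c_τ σ_{w_τ}, α, β)`. -/
noncomputable def XZProblem.toProblem {n : ℕ} (P : XZProblem n) : HamiltonianProblem n where
  op := (P.terms.map fun τ => ((τ.1 : ℂ) • pauliOp τ.2)).sum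
  isHermitian := sum_isHermitian P.terms
  α := P.α
  β := P.β

/-! ### Hamiltonians given by a distribution over Pauli strings and accepting sets -/

/-- `𝟙 - 𝔼_{w ∼ D} ∑_{a ∈ T w} π^w_a`. -/
noncomputable def sampledOp {N : ℕ} (D : PMF (PauliString N))
    (T : PauliString N → Finset (BitString N)) : QubitOp N :=
  1 - ∑ w, (((D w).toReal : ℝ) : ℂ) • ∑ a ∈ T w, pauliProj w a

theorem sampledOp_isHermitian {N : ℕ} (D : PMF (PauliString N))
    (T : PauliString N → Finset (BitString N)) : (sampledOp D T).IsHermitian := by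
  simp only [Matrix.IsHermitian, sampledOp, Matrix.conjTranspose_sub, Matrix.conjTranspose_one,
    Matrix.conjTranspose_sum, Matrix.conjTranspose_smul]
  congr 1
  refine Finset.sum_congr rfl fun w _ => ?_
  congr 1
  · simp
  · exact Finset.sum_congr rfl fun a _ => pauliProj_isHermitian w a

noncomputable def sampledProblem {N : ℕ} (D : PMF (PauliString N))
    (T : PauliString N → Finset (BitString N)) (α β : ℝ) : HamiltonianProblem N where
  op := sampledOp D T
  isHermitian := sampledOp_isHermitian D T
  α := α
  β := β

/-- The distribution of `f r` for a uniformly random bit string `r` of length `s`. -/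
noncomputable def seededDistribution {N s : ℕ} (f : BitString s → PauliString N) :
    PMF (PauliString N) :=
  (PMF.uniformOfFintype (BitString s)).map f

/-! ### Binary encodings and polynomial time -/

/-- Objects are described by finite lists of binary words. -/
abbrev Description : Type := List (List Bool)

/-- A list of binary words as one string over the alphabet `{0, 1, #}`: each word is followed
by the end marker `# = none`. -/
def Description.toString (d : Description) : List (Option Bool) :=
  d.flatMap fun v => v.map some ++ [none]

def unaryWord (n : ℕ) : List Bool := List.replicate n true

/-- Sign, absolute value of the numerator, and denominator, the latter two in binary. -/
def ratWords (q : ℚ) : Description :=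
  [[decide (q.num < 0)], Computability.encodeNat q.num.natAbs, Computability.encodeNat q.den]

def bitWord {N : ℕ} (a : BitString N) : List Bool := List.ofFn a

def PauliLetter.bits : PauliLetter → List Bool
  | .I => [false, false]
  | .X => [true, false]
  | .Z => [false, true]

def pauliWord {N : ℕ} (w : PauliString N) : List Bool :=
  (List.ofFn w).flatMap PauliLetter.bits

/-- The binary description of an X/Z Hamiltonian problem: `n` in unary, the two thresholds,
and for each term its weight followed by its Pauli string. -/
def XZProblem.describe {n : ℕ} (P : XZProblem n) : Description :=
  unaryWord n :: (ratWords P.α ++ ratWords P.β ++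
    P.terms.flatMap fun τ => ratWords τ.1 ++ [pauliWord τ.2])

/-- `f` is computed by a (multi-stack) Turing machine in time polynomial in the length of the
encoded input. -/
def IsPolyTime {A B : Type} (inp : A → Description) (out : B → Description) (f : A → B) : Prop :=
  Nonempty (Turing.TM2ComputableInPolyTime
    (fun a => (inp a).toString) (fun b => (out b).toString) f)

/-! ### Families -/

/-- A 2-local X/Z Hamiltonian family: the number of terms, the weights and the length of the
binary description are polynomially bounded in `n`, and every term acts nontrivially on at most
two qubits. -/
def IsTwoLocalXZFamily (F : (n : ℕ) → Set (XZProblem n)) : Prop :=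
  ∃ m : Polynomial ℕ, ∀ n, ∀ P ∈ F n,
    P.terms.length ≤ m.eval n ∧
    P.describe.toString.length ≤ m.eval n ∧
    ∀ τ ∈ P.terms, |τ.1| ≤ ((m.eval n : ℕ) : ℚ) ∧
      (Finset.univ.filter fun i => τ.2 i ≠ PauliLetter.I).card ≤ 2

/-- All problems in `F n` have the same thresholds `α n` and `β n`, and `β n - α n` is at least
an inverse polynomial. -/
def HasInversePolyGap (F : (n : ℕ) → Set (XZProblem n)) : Prop :=
  ∃ α β : ℕ → ℚ, (∀ n, ∀ P ∈ F n, P.α = α n ∧ P.β = β n) ∧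
    ∃ p : Polynomial ℕ, ∀ n, 0 < p.eval n ∧ 1 / ((p.eval n : ℕ) : ℚ) ≤ β n - α n

/-- Negligible functions: `n ^ k * ν n → 0` for every `k`. -/
def Negligible (ν : ℕ → ℝ) : Prop :=
  Asymptotics.SuperpolynomialDecay Filter.atTop (fun n : ℕ => (n : ℝ)) ν

end XZSubsampling

namespace XZSubsampling

/-! The promise problem is first turned into the sign of a sum of Pauli strings. Let `M` bound the
number of terms and the weights, let `1 / p` bound the promise gap from below, and let `B = 2 ^ (2 *
c * lg n)`, so that `B ≥ (M + 3) * p`. The coefficients of `B * (2 * H - α - β)` are rounded to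
integers and truncated at `n ^ (8 * c)`, and every signed Pauli string is written down as often as
its integer says (thresholds count as identity strings). The sum `tableOp` of this table of
polynomial length has lowest eigenvalue at most `-1` on YES instances and at least `1` on NO
instances (`quadForm_problemTable_le`, `le_quadForm_problemTable`). Truncation only affects
thresholds, and it is harmless since the energies of `H` are bounded by `M ^ 2`.

The new Hamiltonian acts on `2 * lg n` blocks of `2 ^ τ` disjoint `n`-qubit registers. On each
register one table entry is measured, chosen by an index of `q` bits; an index beyond the table
contributes `0`. A block accepts if its scores sum to at most `0`, and the verdict is a majority of
the blocks. Independent indices would need polynomially many random bits. Inside a block the indices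
are therefore only pairwise independent: they are the sums of `ρ 0` and a subset of `ρ 1, ..., ρ τ`
(`seedIndex`). As `q`, `τ` and the number of blocks are `O(log n)`, the seeds of all blocks together
have `O(log ^ 3 n)` bits.

Pairwise independence bounds the second moment of the block sum `S` around its mean `M`, as
operators (`sum_quadForm_sampleSum_sub_le`). Let `Q` be the projection onto `S ≤ 0` and `M ≥ g`.
Expanding `0 ≤ (S - M + g Q) ^ 2`, where `S Q + Q S ≤ 0`, gives a Chebyshev inequality `g ^ 2 * ∑ Q
≤ V` (`sq_mul_sum_quadForm_le`). For NO instances this is an inequality on the whole space, proved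
at eigenvectors of `∑ Q`, so it covers witnesses that are entangled across registers and blocks. For
YES instances it is needed only at a product of ground states, which is an eigenvector of `M`.
Blocks have independent seeds and act on disjoint qubits; weighting each failing block by `y = 2 ^
lg n` and peeling off the blocks one by one bounds the probability that half of them fail by `(2 /
y) ^ (2 * lg n)`, which is negligible (`sum_quadForm_majority_le`). The map `measOp w` from
functions of the outcomes to operators is an algebra homomorphism, and this translates between the
decision procedure and the operators.

For the running times, programs over a few stacks, whose loops run as often as the input is long
(plus two), are compiled to Turing machines (`Prog.leadsTo`, `isPolyTime_of_prog`). On top of them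
the class `PolyTime` of functions between types encoded by binary trees is closed under composition,
case distinction and size-bounded iteration, so that the algorithms can be written as ordinary
functional definitions. The sampled Pauli string carries its own punctuation: letters at even
positions mark the ends of scores and blocks, letters at odd positions are measured or give the sign
of a score. -/

/-! ### A stack language with loops bounded by the input length -/

/-- The alphabet of all stacks. -/
abbrev Sym : Type := Option Bool

/-- The stacks that programs may use. -/
inductive Reg : Type
  | main
  | aux
  | tmp
  | cnt
  | port
  deriving DecidableEq

instance : Fintype Reg :=
  ⟨{.main, .aux, .tmp, .cnt, .port}, fun r => by cases r <;> decide⟩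

abbrev Store : Type := Reg → List Sym

/-- Stack programs. `pop r q` pops from `r` and continues with `q` applied to the popped symbol;
`rep p` repeats `p` as often as a fixed yardstick says. -/
inductive Prog : Type
  | skip
  | push (r : Reg) (s : Sym)
  | pop (r : Reg) (q : Option Sym → Prog)
  | seq (p q : Prog)
  | rep (p : Prog)

namespace Prog

/-- The effect of a program on the store when the yardstick is `L`. -/
def eval (L : ℕ) : Prog → Store → Store
  | skip, S => S
  | push r s, S => Function.update S r (s :: S r)
  | pop r q, S => (q (S r).head?).eval L (Function.update S r (S r).tail)
  | seq p q, S => q.eval L (p.eval L S)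
  | rep p, S => (p.eval L)^[L] S

/-- The nesting depth of loops. -/
def height : Prog → ℕ
  | skip => 0
  | push _ _ => 0
  | pop _ q => Finset.univ.sup fun s => (q s).height
  | seq p q => max p.height q.height
  | rep p => p.height + 1

/-- A bound on the running time in terms of the yardstick. -/
noncomputable def cost : Prog → Polynomial ℕ
  | skip => 1
  | push _ _ => 1
  | pop _ q => 1 + ∑ s, (q s).cost
  | seq p q => p.cost + q.cost
  | rep p => Polynomial.X * (1 + p.cost) + (1 + (Polynomial.X + 1))

/-- The labels of the Turing machine that runs the program. -/
@[reducible] def Lab : Prog → Type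
  | skip => Unit
  | push _ _ => Unit
  | pop _ q => Option (Σ s : Option Sym, (q s).Lab)
  | seq p q => p.Lab ⊕ q.Lab
  | rep p => Bool ⊕ p.Lab

instance fintypeLab : ∀ p : Prog, Fintype p.Lab
  | skip => inferInstanceAs (Fintype Unit)
  | push _ _ => inferInstanceAs (Fintype Unit)
  | pop _ q =>
    letI := fun s => fintypeLab (q s)
    inferInstanceAs (Fintype (Option (Σ s : Option Sym, (q s).Lab)))
  | seq p q =>
    letI := fintypeLab p
    letI := fintypeLab q
    inferInstanceAs (Fintype (p.Lab ⊕ q.Lab))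
  | rep p =>
    letI := fintypeLab p
    inferInstanceAs (Fintype (Bool ⊕ p.Lab))

def entry : ∀ p : Prog, p.Lab
  | skip => ()
  | push _ _ => ()
  | pop _ _ => none
  | seq p _ => Sum.inl p.entry
  | rep _ => Sum.inl false

end Prog

/-! ### Compilation of stack programs to Turing machines -/

/-- The stacks of the Turing machine: those of the program, two yardsticks for every nesting depth
of loops, and the input. -/
inductive Stack (D : ℕ) : Type
  | reg (r : Reg)
  | yard (i : Fin (D + 1)) (b : Bool)
  | inp
  deriving DecidableEq, Fintype

/-- The contents of all stacks. -/
def contents {D : ℕ} (S : Store) (Y : Fin (D + 1) → Bool → List Sym) (I : List Sym) :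
    Stack D → List Sym
  | .reg r => S r
  | .yard i b => Y i b
  | .inp => I

section
variable {D : ℕ} (S : Store) (Y : Fin (D + 1) → Bool → List Sym) (I : List Sym)

@[simp] theorem contents_reg (r : Reg) : contents S Y I (.reg r) = S r := rfl
@[simp] theorem contents_yard (i : Fin (D + 1)) (b : Bool) : contents S Y I (.yard i b) = Y i b := rfl
@[simp] theorem contents_inp : contents S Y I .inp = I := rfl

@[simp] theorem update_contents_reg (r : Reg) (x : List Sym) :
    Function.update (contents S Y I) (.reg r) x = contents (Function.update S r x) Y I := by
  funext k
  cases k with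
  | reg r' => by_cases h : r' = r <;> simp [h]
  | yard i b => simp
  | inp => simp

@[simp] theorem update_contents_yard (i : Fin (D + 1)) (b : Bool) (x : List Sym) :
    Function.update (contents S Y I) (.yard i b) x =
      contents S (Function.update Y i (Function.update (Y i) b x)) I := by
  funext k
  cases k with
  | reg r' => simp
  | yard j c =>
    by_cases h : j = i
    · subst h
      by_cases h' : c = b <;> simp [h']
    · simp [h]
  | inp => simp

@[simp] theorem update_contents_inp (x : List Sym) :
    Function.update (contents S Y I) .inp x = contents S Y x := by
  funext k
  cases k <;> simp

end

abbrev StackStmt (D : ℕ) (Λ : Type) : Type := Turing.TM2.Stmt (fun _ : Stack D => Sym) Λ (Option Sym)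

abbrev StackCfg (D : ℕ) (Λ : Type) : Type := Turing.TM2.Cfg (fun _ : Stack D => Sym) Λ (Option Sym)

/-- The statement at each label of a program that is embedded by `emb` into the labels of a machine
and continues at `ex`. -/
def Prog.stmt (D : ℕ) {Λ : Type} : (p : Prog) → (p.Lab → Λ) → Λ → p.Lab → StackStmt D Λ
  | .skip, _, ex, _ => .goto fun _ => ex
  | .push r s, _, ex, _ => .push (.reg r) (fun _ => s) (.goto fun _ => ex)
  | .pop r q, emb, _, none =>
    .pop (.reg r) (fun _ x => x) (.goto fun v => emb (some ⟨v, (q v).entry⟩))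
  | .pop _ q, emb, ex, some ⟨s, l⟩ => (q s).stmt D (fun l => emb (some ⟨s, l⟩)) ex l
  | .seq p q, emb, _, .inl l => p.stmt D (fun l => emb (.inl l)) (emb (.inr q.entry)) l
  | .seq _ q, emb, ex, .inr l => q.stmt D (fun l => emb (.inr l)) ex l
  | .rep p, emb, _, .inl false =>
    .pop (.yard (Fin.ofNat (D + 1) p.height) false) (fun _ x => x)
      (.branch (fun v => v.isSome)
        (.push (.yard (Fin.ofNat (D + 1) p.height) true) (fun _ => none)
          (.goto fun _ => emb (.inr p.entry)))
        (.goto fun _ => emb (.inl true)))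
  | .rep p, emb, ex, .inl true =>
    .pop (.yard (Fin.ofNat (D + 1) p.height) true) (fun _ x => x)
      (.branch (fun v => v.isSome)
        (.push (.yard (Fin.ofNat (D + 1) p.height) false) (fun _ => none)
          (.goto fun _ => emb (.inl true)))
        (.goto fun _ => ex))
  | .rep p, emb, _, .inr l => p.stmt D (fun l => emb (.inr l)) (emb (.inl false)) l

/-- `c` leads to `c'` in at most `t` steps. -/
def LeadsTo {C : Type} (f : C → Option C) (t : ℕ) (c c' : C) : Prop :=
  Nonempty (StateTransition.EvalsToInTime f c (some c') t)

namespace LeadsTo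
variable {C : Type} {f : C → Option C} {t t' : ℕ} {a b c : C}

theorem refl (a : C) : LeadsTo f 0 a a := ⟨.refl f a⟩

theorem trans (h : LeadsTo f t a b) (h' : LeadsTo f t' b c) : LeadsTo f (t + t') a c := by
  obtain ⟨h⟩ := h
  obtain ⟨h'⟩ := h'
  exact ⟨by rw [add_comm]; exact h.trans f t t' a b (some c) h'⟩

theorem mono (h : LeadsTo f t a b) (ht : t ≤ t') : LeadsTo f t' a b := by
  obtain ⟨h⟩ := h
  exact ⟨⟨h.toEvalsTo, h.steps_le_m.trans ht⟩⟩

theorem single (h : f a = some b) : LeadsTo f 1 a b := ⟨⟨⟨1, h⟩, le_rfl⟩⟩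

end LeadsTo

theorem LeadsTo.step {D : ℕ} {Λ : Type} {M : Λ → StackStmt D Λ} {l : Λ} {v : Option Sym}
    {S : Stack D → List Sym} {c : StackCfg D Λ} (h : Turing.TM2.stepAux (M l) v S = c) :
    LeadsTo (Turing.TM2.step M) 1 (⟨some l, v, S⟩ : StackCfg D Λ) c :=
  LeadsTo.single (by rw [Turing.TM2.step, h])

/-- Each loop owns the two yardsticks at the height of its body. A round moves one token from the
first to the second, and after the last round all tokens are moved back, so the loop can be entered
again. Only yardsticks below the height of the program are required to be full: while a body runs,
the yardsticks of the enclosing loops are partly used up. -/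
theorem Prog.leadsTo {D : ℕ} {Λ : Type} {M : Λ → StackStmt D Λ} {L : ℕ} :
    ∀ (p : Prog) (emb : p.Lab → Λ) (ex : Λ), (∀ l, M (emb l) = p.stmt D emb ex l) →
      p.height ≤ D + 1 →
      ∀ Y : Fin (D + 1) → Bool → List Sym,
      (∀ i : Fin (D + 1), i.val < p.height → Y i false = List.replicate L none ∧ Y i true = []) →
      ∀ (I : List Sym) (S : Store) (v : Option Sym), ∃ v' : Option Sym,
        LeadsTo (Turing.TM2.step M) (p.cost.eval L)
          (⟨some (emb p.entry), v, contents S Y I⟩ : StackCfg D Λ)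
          ⟨some ex, v', contents (p.eval L S) Y I⟩ := by
  intro p
  induction p with
  | skip =>
    intro emb ex hM _ Y _ I S v
    refine ⟨v, (LeadsTo.step ?_).mono (by simp [cost])⟩
    rw [hM]; simp [stmt, eval]
  | push r s =>
    intro emb ex hM _ Y _ I S v
    refine ⟨v, (LeadsTo.step ?_).mono (by simp [cost])⟩
    rw [hM]; simp [stmt, eval]
  | pop r q ih =>
    intro emb ex hM hD Y hY I S v
    have hle : (q (S r).head?).height ≤ (pop r q).height :=
      Finset.le_sup (f := fun s => (q s).height) (Finset.mem_univ _)
    obtain ⟨v', hv'⟩ := ih (S r).head? (fun l => emb (some ⟨_, l⟩)) ex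
      (fun l => by rw [hM]; rfl) (hle.trans hD) Y (fun i hi => hY i (hi.trans_le hle)) I
      (Function.update S r (S r).tail) (S r).head?
    refine ⟨v', ((LeadsTo.step ?_).trans hv').mono ?_⟩
    · rw [hM]; simp [stmt, entry]
    · simp only [cost, Polynomial.eval_add, Polynomial.eval_one, Polynomial.eval_finsetSum]
      gcongr
      exact Finset.single_le_sum (f := fun s => (q s).cost.eval L) (fun _ _ => Nat.zero_le _)
        (Finset.mem_univ _)
  | seq p q ihp ihq =>
    intro emb ex hM hD Y hY I S v
    obtain ⟨v₁, h₁⟩ := ihp (fun l => emb (.inl l)) (emb (.inr q.entry))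
      (fun l => by rw [hM]; rfl) ((le_max_left _ _).trans hD) Y
      (fun i hi => hY i (hi.trans_le (le_max_left _ _))) I S v
    obtain ⟨v₂, h₂⟩ := ihq (fun l => emb (.inr l)) ex
      (fun l => by rw [hM]; rfl) ((le_max_right _ _).trans hD) Y
      (fun i hi => hY i (hi.trans_le (le_max_right _ _))) I (p.eval L S) v₁
    exact ⟨v₂, (h₁.trans h₂).mono (by simp [cost])⟩
  | rep p ih =>
    intro emb ex hM hD Y hY I S v
    have hlt : p.height < D + 1 := hD
    have hi : (Fin.ofNat (D + 1) p.height).val = p.height := Nat.mod_eq_of_lt hlt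
    obtain ⟨hf, ht⟩ := hY (Fin.ofNat (D + 1) p.height) (by rw [hi]; exact Nat.lt_succ_self _)
    set i : Fin (D + 1) := Fin.ofNat (D + 1) p.height with hidef
    -- `Z a b` is the state in which `a` rounds of this loop are still to be run and `b` tokens have
    -- been moved over.
    let Z : ℕ → ℕ → Fin (D + 1) → Bool → List Sym := fun a b =>
      Function.update Y i fun c => if c then List.replicate b none else List.replicate a none
    have hZ0 : Z L 0 = Y := by
      funext j
      by_cases hj : j = i
      · subst hj
        funext c
        cases c <;> simp [Z, hf, ht]
      · simp [Z, hj]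
    have hpop : ∀ a b x, Function.update (Z a b) i (Function.update (Z a b i) false
        (List.replicate x none)) = Z x b := by
      intro a b x
      simp only [Z, Function.update_idem, Function.update_self]
      congr 1
      funext c
      cases c <;> simp
    have hpush : ∀ a b x, Function.update (Z a b) i (Function.update (Z a b i) true
        (List.replicate x none)) = Z a x := by
      intro a b x
      simp only [Z, Function.update_idem, Function.update_self]
      congr 1
      funext c
      cases c <;> simp
    have hZf : ∀ a b, Z a b i false = List.replicate a none := by intro a b; simp [Z]
    have hZt : ∀ a b, Z a b i true = List.replicate b none := by intro a b; simp [Z]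
    -- the main loop
    have loop : ∀ a b S v, ∃ v', LeadsTo (Turing.TM2.step M) (a * (1 + p.cost.eval L))
        (⟨some (emb (.inl false)), v, contents S (Z a b) I⟩ : StackCfg D Λ)
        ⟨some (emb (.inl false)), v', contents ((p.eval L)^[a] S) (Z 0 (b + a)) I⟩ := by
      intro a
      induction a with
      | zero => intro b S v; exact ⟨v, (LeadsTo.refl _).mono (by simp)⟩
      | succ a iha =>
        intro b S v
        obtain ⟨v₁, h₁⟩ := ih (fun l => emb (.inr l)) (emb (.inl false))
          (fun l => by rw [hM]; rfl) (by omega) (Z a (b + 1)) (fun j hj => by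
            have hji : j ≠ i := by
              rintro rfl
              rw [hi] at hj
              exact lt_irrefl _ hj
            simp only [Z, Function.update_of_ne hji]
            exact hY j (by simp only [height]; omega)) I S (some none)
        obtain ⟨v₂, h₂⟩ := iha (b + 1) (p.eval L S) v₁
        refine ⟨v₂, (((LeadsTo.step ?_).trans h₁).trans
          (t' := a * (1 + p.cost.eval L)) ?_).mono (le_of_eq ?_)⟩
        · rw [hM]
          simp only [stmt, Turing.TM2.stepAux, contents_yard, ← hidef, hZf, List.replicate_succ,
            List.head?_cons, List.tail_cons, Option.isSome_some, cond_true, update_contents_yard,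
            hpop, hZt]
          simp only [← List.replicate_succ, hpush]
        · rw [show b + (a + 1) = b + 1 + a by ring]
          exact h₂
        · ring
    have restore : ∀ b a S v, ∃ v', LeadsTo (Turing.TM2.step M) (b + 1)
        (⟨some (emb (.inl true)), v, contents S (Z a b) I⟩ : StackCfg D Λ)
        ⟨some ex, v', contents S (Z (a + b) 0) I⟩ := by
      intro b
      induction b with
      | zero =>
        intro a S v
        refine ⟨none, (LeadsTo.step ?_).mono (by simp)⟩
        rw [hM]
        simp only [stmt, Turing.TM2.stepAux, contents_yard, ← hidef, hZt, List.replicate_zero,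
          List.head?_nil, List.tail_nil, Option.isSome_none, cond_false, update_contents_yard]
        rw [← List.replicate_zero (a := (none : Sym)), hpush]
        rfl
      | succ b ihb =>
        intro a S v
        obtain ⟨v₂, h₂⟩ := ihb (a + 1) S (some none)
        refine ⟨v₂, ((LeadsTo.step
          (c := ⟨some (emb (.inl true)), some none, contents S (Z (a + 1) b) I⟩) ?_).trans
          (t' := b + 1) ?_).mono (le_of_eq (by ring))⟩
        · rw [hM]
          simp only [stmt, Turing.TM2.stepAux, contents_yard, ← hidef, hZt, List.replicate_succ,
            List.head?_cons, List.tail_cons, Option.isSome_some, cond_true, update_contents_yard,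
            hpush, hZf]
          simp only [← List.replicate_succ, hpop]
        · rw [show a + (b + 1) = a + 1 + b by ring]
          exact h₂
    obtain ⟨v₁, h₁⟩ := loop L 0 S v
    obtain ⟨v₂, h₂⟩ := restore L 0 ((p.eval L)^[L] S) none
    rw [hZ0] at h₁
    refine ⟨v₂, ((h₁.trans (LeadsTo.step
      (c := ⟨some (emb (.inl true)), none, contents ((p.eval L)^[L] S) (Z 0 L) I⟩) ?_)).trans (t' := L + 1) ?_).mono (le_of_eq ?_)⟩
    · rw [hM]
      simp only [stmt, Turing.TM2.stepAux, contents_yard, ← hidef, hZf, List.replicate_zero,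
        List.head?_nil, List.tail_nil, Option.isSome_none, cond_false, update_contents_yard,
        zero_add]
      rw [← List.replicate_zero (a := (none : Sym)), hpop]
    · rw [zero_add, hZ0] at h₂
      exact h₂
    · simp [cost]; ring


/-! ### Reading the input, setting up and clearing the yardsticks -/

/-- Push a token onto the first yardstick of each of the given depths. -/
def pushYards {D : ℕ} {Λ : Type} : List (Fin (D + 1)) → StackStmt D Λ → StackStmt D Λ
  | [], q => q
  | i :: is, q => .push (.yard i false) (fun _ => none) (pushYards is q)

/-- Pop a token from the first yardstick of each of the given depths. -/
def popYards {D : ℕ} {Λ : Type} : List (Fin (D + 1)) → StackStmt D Λ → StackStmt D Λ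
  | [], q => q
  | i :: is, q => .pop (.yard i false) (fun _ x => x) (popYards is q)

/-- Yardsticks of length `a` at the depths in `is`, and of length `b` at all other depths. -/
def yards {D : ℕ} (is : List (Fin (D + 1))) (a b : ℕ) : Fin (D + 1) → Bool → List Sym :=
  fun i c => if c then [] else List.replicate (if i ∈ is then a else b) none

/-- Between two rounds all yardsticks have the same length and one of the two parameters is
irrelevant; this lemma and the next one pass between the forms that a round starts from and ends in.
-/
theorem yards_nil {D : ℕ} (a b : ℕ) :
    yards ([] : List (Fin (D + 1))) a b = yards (List.finRange (D + 1)) b b := by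
  funext i c; simp [yards]

theorem yards_finRange {D : ℕ} (a b : ℕ) :
    yards (List.finRange (D + 1)) a b = yards (List.finRange (D + 1)) a a := by
  funext i c; simp [yards]

theorem update_yards {D : ℕ} {i : Fin (D + 1)} {is : List (Fin (D + 1))} (hi : i ∉ is) (a b : ℕ) :
    Function.update (yards (i :: is) a b) i
      (Function.update (yards (i :: is) a b i) false (List.replicate b none)) = yards is a b := by
  funext j c
  by_cases hj : j = i
  · subst hj
    cases c <;> simp [yards, hi]
  · simp [yards, hj]

theorem stepAux_pushYards {D : ℕ} {Λ : Type} (q : StackStmt D Λ) (v : Option Sym) (S : Store)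
    (I : List Sym) (a : ℕ) : ∀ is : List (Fin (D + 1)), is.Nodup →
    Turing.TM2.stepAux (pushYards is q) v (contents S (yards is a (a + 1)) I) =
      Turing.TM2.stepAux q v (contents S (yards [] a (a + 1)) I)
  | [], _ => rfl
  | i :: is, h => by
    rw [List.nodup_cons] at h
    have h' : yards (i :: is) a (a + 1) i false = List.replicate a none := by simp [yards]
    rw [pushYards, Turing.TM2.stepAux, update_contents_yard, contents_yard, h',
      ← List.replicate_succ, update_yards h.1, stepAux_pushYards q v S I a is h.2]

theorem stepAux_popYards {D : ℕ} {Λ : Type} (q : StackStmt D Λ) (S : Store)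
    (I : List Sym) (a : ℕ) : ∀ is : List (Fin (D + 1)), is.Nodup → ∀ v,
    Turing.TM2.stepAux (popYards is q) v (contents S (yards is a (a - 1)) I) =
      Turing.TM2.stepAux q (if is = [] then v else (List.replicate a none).head?)
        (contents S (yards [] a (a - 1)) I)
  | [], _, _ => rfl
  | i :: is, h, v => by
    rw [List.nodup_cons] at h
    have h' : yards (i :: is) a (a - 1) i false = List.replicate a none := by simp [yards]
    rw [popYards, Turing.TM2.stepAux, update_contents_yard, contents_yard, h', List.tail_replicate,
      update_yards h.1, stepAux_popYards q S I a is h.2]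
    simp

/-- The statements of the machine that moves the input in reverse order to `port`, sets up the
yardsticks, runs a program, and clears the yardsticks. -/
def Prog.machineStmt (p : Prog) : Bool ⊕ p.Lab → StackStmt p.height (Bool ⊕ p.Lab)
  | .inl false =>
    .pop .inp (fun _ x => x) (.branch (fun v => v.isSome)
      (.push (.reg .port) (fun v => v.getD none)
        (pushYards (List.finRange _) (.goto fun _ => .inl false)))
      (pushYards (List.finRange _) (pushYards (List.finRange _) (.goto fun _ => .inr p.entry))))
  | .inl true => popYards (List.finRange _)
      (.branch (fun v => v.isSome) (.goto fun _ => .inl true) .halt)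
  | .inr l => p.stmt p.height .inr (.inl true) l

/-- The Turing machine running a program. -/
def Prog.machine (p : Prog) : Turing.FinTM2 where
  K := Stack p.height
  k₀ := .inp
  k₁ := .reg .port
  Γ := fun _ => Sym
  Λ := Bool ⊕ p.Lab
  main := .inl false
  σ := Option Sym
  initialState := none
  Γk₀Fin := inferInstanceAs (Fintype (Option Bool))
  m := p.machineStmt

/-- The store in which all stacks but `port` are empty. -/
def portStore (x : List Sym) : Store := Function.update (fun _ => []) .port x

/-- The yardsticks receive one token per input symbol and two more at the end of the input. The
surplus makes their length at least `2`, so that powers of it dominate all polynomials even for the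
empty input. They are cleared at the end because a halting configuration may contain nothing but the
output. -/
theorem Prog.leadsTo_machine (p : Prog) (x y : List Sym)
    (h : p.eval (x.length + 2) (portStore x.reverse) = portStore y) :
    LeadsTo (Turing.TM2.step p.machineStmt)
      (x.length + 1 + p.cost.eval (x.length + 2) + (x.length + 3))
      (⟨some (.inl false), none, contents (fun _ => []) (yards (List.finRange _) 0 0) x⟩ :
        StackCfg p.height _)
      ⟨none, none, contents (portStore y) (yards (List.finRange _) 0 0) []⟩ := by
  have hn : (List.finRange (p.height + 1)).Nodup := List.nodup_finRange _
  have init : ∀ (x z : List Sym) (v : Option Sym), LeadsTo (Turing.TM2.step p.machineStmt)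
      (x.length + 1)
      (⟨some (.inl false), v, contents (portStore z) (yards (List.finRange _) z.length z.length) x⟩ :
        StackCfg p.height _)
      ⟨some (.inr p.entry), none, contents (portStore (x.reverse ++ z))
        (yards (List.finRange _) (x.length + z.length + 2) (x.length + z.length + 2)) []⟩ := by
    intro x
    induction x with
    | nil =>
      intro z v
      refine LeadsTo.step ?_
      simp only [Prog.machineStmt, Turing.TM2.stepAux, contents_inp, List.head?_nil,
        Option.isSome_none, cond_false, update_contents_inp, List.tail_nil]
      rw [yards_finRange _ z.length, ← yards_finRange _ (z.length + 1),
        stepAux_pushYards _ _ _ _ _ _ hn, yards_nil, ← yards_finRange _ (z.length + 1 + 1),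
        stepAux_pushYards _ _ _ _ _ _ hn, yards_nil]
      simp only [Turing.TM2.stepAux, List.reverse_nil, List.nil_append, List.length_nil, zero_add]
    | cons s x ih =>
      intro z v
      have h' := ih (s :: z) (some s)
      simp only [List.length_cons, List.reverse_cons, List.append_assoc, List.singleton_append]
        at h' ⊢
      refine ((LeadsTo.step ?_).trans (t := 1) (by
        rw [show x.length + 1 + z.length + 2 = x.length + (z.length + 1) + 2 by ring]
        exact h')).mono (by omega)
      simp only [Prog.machineStmt, Turing.TM2.stepAux, contents_inp, List.head?_cons,
        Option.isSome_some, cond_true, update_contents_inp, List.tail_cons, update_contents_reg,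
        contents_reg, Option.getD_some]
      rw [← yards_finRange _ (z.length + 1), stepAux_pushYards _ _ _ _ _ _ hn, yards_nil]
      simp [Turing.TM2.stepAux, portStore]
  have fin : ∀ (a : ℕ) (v : Option Sym), LeadsTo (Turing.TM2.step p.machineStmt) (a + 1)
      (⟨some (.inl true), v, contents (portStore y) (yards (List.finRange _) a a) []⟩ :
        StackCfg p.height _)
      ⟨none, none, contents (portStore y) (yards (List.finRange _) 0 0) []⟩ := by
    intro a
    induction a with
    | zero =>
      intro v
      refine LeadsTo.step ?_
      rw [Prog.machineStmt, ← yards_finRange _ (0 - 1), stepAux_popYards _ _ _ _ _ hn, yards_nil]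
      simp [Turing.TM2.stepAux]
    | succ a ih =>
      intro v
      refine ((LeadsTo.step ?_).trans (ih (some none))).mono (by omega)
      rw [Prog.machineStmt, ← yards_finRange _ (a + 1 - 1), stepAux_popYards _ _ _ _ _ hn, yards_nil]
      simp [Turing.TM2.stepAux, List.replicate_succ]
  obtain ⟨v, hv⟩ := p.leadsTo (M := p.machineStmt) (L := x.length + 2) Sum.inr (.inl true)
    (fun _ => rfl) (Nat.le_succ _) (yards (List.finRange _) (x.length + 2) (x.length + 2))
    (fun i _ => by simp [yards]) [] (portStore x.reverse) none
  rw [h] at hv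
  have h0 := init x [] none
  simp only [List.append_nil, List.length_nil, add_zero] at h0
  have hport : portStore [] = fun _ => [] := by
    funext r; simp [portStore, Function.update_apply]
  rw [hport] at h0
  exact (h0.trans hv).trans (fin (x.length + 2) v)

theorem isPolyTime_of_prog {A B : Type} {inp : A → Description} {out : B → Description}
    {f : A → B} (p : Prog)
    (h : ∀ a, p.eval ((inp a).toString.length + 2) (portStore (inp a).toString.reverse) =
      portStore (out (f a)).toString) : IsPolyTime inp out f := by
  refine ⟨⟨⟨p.machine, Equiv.refl _, Equiv.refl _⟩,
    -- Reading the input, running the program with yardstick `length + 2`, and clearing the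
    -- yardsticks.
    Polynomial.X + 1 + p.cost.comp (Polynomial.X + 2) + (Polynomial.X + 3), fun a => ?_⟩⟩
  have := p.leadsTo_machine _ _ (h a)
  have hi : Turing.initList p.machine (List.map (Equiv.refl Sym).invFun (inp a).toString) =
      (⟨some (.inl false), none, contents (fun _ => []) (yards (List.finRange _) 0 0)
        (inp a).toString⟩ : StackCfg p.height (Bool ⊕ p.Lab)) := by
    refine congrArg (fun S => (⟨some (.inl false), none, S⟩ : StackCfg p.height (Bool ⊕ p.Lab))) ?_
    funext k
    cases k with
    | reg r => rfl
    | yard i b => cases b <;> simp [yards, Prog.machine]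
    | inp => exact List.map_id _
  have ho : Turing.haltList p.machine (List.map (Equiv.refl Sym).invFun (out (f a)).toString) =
      (⟨none, none, contents (portStore (out (f a)).toString) (yards (List.finRange _) 0 0) []⟩ :
        StackCfg p.height (Bool ⊕ p.Lab)) := by
    refine congrArg (fun S => (⟨none, none, S⟩ : StackCfg p.height (Bool ⊕ p.Lab))) ?_
    funext k
    cases k with
    | reg r =>
      cases r
      case port => exact List.map_id _
      all_goals rfl
    | yard i b => cases b <;> simp [yards, Prog.machine]
    | inp => rfl
  refine Classical.choice ?_
  simp only [Turing.TM2OutputsInTime, Polynomial.eval_add, Polynomial.eval_X, Polynomial.eval_one,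
    Polynomial.eval_comp, Polynomial.eval_ofNat, Option.map_some]
  exact (congrArg₂ (LeadsTo (Turing.TM2.step p.machineStmt) _) hi ho).mpr this


/-! ### Data as binary trees -/

/-- Binary trees, the universal data type. -/
inductive Code : Type
  | leaf
  | node (l r : Code)

namespace Code

/-- The preorder code of a tree. -/
def syms : Code → List Sym
  | leaf => [some false]
  | node l r => some true :: (l.syms ++ r.syms)

def size : Code → ℕ
  | leaf => 1
  | node l r => l.size + r.size + 1

theorem length_syms : ∀ d : Code, d.syms.length = d.size
  | leaf => rfl
  | node l r => by simp [syms, size, length_syms l, length_syms r]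

theorem size_pos : ∀ d : Code, 0 < d.size
  | leaf => Nat.one_pos
  | node _ _ => Nat.succ_pos _

end Code

/-- The store with the given contents. -/
def mkStore (m x t c p : List Sym) : Store
  | .main => m
  | .aux => x
  | .tmp => t
  | .cnt => c
  | .port => p

section
variable (m x t c p y : List Sym)

@[simp] theorem mkStore_main : mkStore m x t c p .main = m := rfl
@[simp] theorem mkStore_aux : mkStore m x t c p .aux = x := rfl
@[simp] theorem mkStore_tmp : mkStore m x t c p .tmp = t := rfl
@[simp] theorem mkStore_cnt : mkStore m x t c p .cnt = c := rfl
@[simp] theorem mkStore_port : mkStore m x t c p .port = p := rfl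

@[simp] theorem update_mkStore_main :
    Function.update (mkStore m x t c p) .main y = mkStore y x t c p := by
  funext r; cases r <;> rfl
@[simp] theorem update_mkStore_aux :
    Function.update (mkStore m x t c p) .aux y = mkStore m y t c p := by
  funext r; cases r <;> rfl
@[simp] theorem update_mkStore_tmp :
    Function.update (mkStore m x t c p) .tmp y = mkStore m x y c p := by
  funext r; cases r <;> rfl
@[simp] theorem update_mkStore_cnt :
    Function.update (mkStore m x t c p) .cnt y = mkStore m x t y p := by
  funext r; cases r <;> rfl
@[simp] theorem update_mkStore_port :
    Function.update (mkStore m x t c p) .port y = mkStore m x t c y := by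
  funext r; cases r <;> rfl

end

theorem portStore_eq (y : List Sym) : portStore y = mkStore [] [] [] [] y := by
  funext r; cases r <;> rfl

namespace Prog

/-- `k` nested loops. -/
def repPow : ℕ → Prog → Prog
  | 0, p => p
  | k + 1, p => rep (repPow k p)

theorem eval_repPow (L : ℕ) (p : Prog) (S : Store) : ∀ k,
    (repPow k p).eval L S = (p.eval L)^[L ^ k] S
  | 0 => rfl
  | k + 1 => by
    have : (repPow k p).eval L = (p.eval L)^[L ^ k] := funext fun S => eval_repPow L p S k
    rw [repPow, eval, this, ← Function.iterate_mul, pow_succ]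

/-- One step of moving a code from a stack to `tmp`; the height of `cnt` is the number of subtrees
that are still to be read. -/
def scanStep (a : Reg) : Prog :=
  .pop .cnt fun h => if h = some (some true) then
      .pop a fun s => if s = some (some true) then
          .seq (.push .tmp (some true)) (.seq (.push .cnt (some true)) (.push .cnt (some true)))
        else .push .tmp (some false)
    else .push .cnt none

/-- One step of moving a code from `tmp` to `main` or `aux` or both. -/
def unloadStep (bm bx : Bool) : Prog :=
  .pop .tmp fun h => match h with
    | some (some s) => .seq (if bm then .push .main (some s) else .skip)
        (if bx then .push .aux (some s) else .skip)
    | _ => .push .tmp none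

/-- Move the code on top of `main` (or of `aux`) to `main`, to `aux`, to both, or to none. -/
def transfer (k : ℕ) (fx bm bx : Bool) : Prog :=
  .seq (.seq (.push .tmp none) (.seq (.push .cnt none) (.push .cnt (some true))))
    (.seq (repPow k (scanStep (if fx then .aux else .main)))
      (.seq (.pop .cnt fun _ => .skip)
        (.seq (repPow k (unloadStep bm bx)) (.pop .tmp fun _ => .skip))))

/-- A yardstick gives only an upper bound for the number of rounds that are needed. Loop bodies are
written so that they do nothing once their work is finished, and surplus rounds have no effect. -/
theorem iterate_of_le {α : Type} {f : α → α} {a b : α} {i j : ℕ} (h : f^[i] a = b) (hb : f b = b)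
    (hij : i ≤ j) : f^[j] a = b := by
  obtain ⟨k, rfl⟩ := Nat.exists_eq_add_of_le hij
  rw [add_comm, Function.iterate_add_apply, h, Function.iterate_fixed hb]

/-- In preorder, a node replaces one pending subtree by two and a leaf settles one. Counting the
pending subtrees thus finds the end of a code without an end mark, one symbol per round. -/
theorem iterate_scanStep (L : ℕ) (fx : Bool) (d : Code) : ∀ (m t c p : List Sym) (x : List Sym),
    ((scanStep (if fx then .aux else .main)).eval L)^[d.size]
      (mkStore (if fx then m else d.syms ++ m) (if fx then d.syms ++ x else x) t
        (some true :: c) p) = mkStore m x (d.syms.reverse ++ t) c p := by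
  induction d with
  | leaf =>
    intro m t c p x
    cases fx <;> simp [Code.size, Code.syms, scanStep, eval]
  | node l r ihl ihr =>
    intro m t c p x
    rw [show (l.node r).size = r.size + (l.size + 1) by simp only [Code.size]; omega,
      Function.iterate_add_apply, Function.iterate_add_apply, Function.iterate_one]
    have h1 : (scanStep (if fx then .aux else .main)).eval L
      (mkStore (if fx then m else (l.node r).syms ++ m) (if fx then (l.node r).syms ++ x else x) t
        (some true :: c) p) =
      mkStore (if fx then m else l.syms ++ (r.syms ++ m)) (if fx then l.syms ++ (r.syms ++ x) else x)
        (some true :: t) (some true :: some true :: c) p := by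
      cases fx <;> simp [Code.syms, scanStep, eval]
    have h2 := ihl (if fx then m else r.syms ++ m) (some true :: t) (some true :: c) p
      (if fx then r.syms ++ x else x)
    have h3 := ihr m (l.syms.reverse ++ some true :: t) c p x
    rw [h1]
    cases fx <;> simp_all [Code.syms]

theorem iterate_unloadStep (L : ℕ) (bm bx : Bool) : ∀ (u : List Bool) (m x t c p : List Sym),
    ((unloadStep bm bx).eval L)^[u.length] (mkStore m x ((u.map some).reverse ++ none :: t) c p) =
      mkStore (if bm then u.map some ++ m else m) (if bx then u.map some ++ x else x)
        (none :: t) c p := by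
  intro u
  induction u using List.reverseRecOn with
  | nil => intro m x t c p; simp
  | append_singleton u s ih =>
    intro m x t c p
    rw [List.length_append, List.length_singleton, Function.iterate_add_apply, Function.iterate_one]
    have h1 : (unloadStep bm bx).eval L
        (mkStore m x (((u ++ [s]).map some).reverse ++ none :: t) c p) =
        mkStore (if bm then some s :: m else m) (if bx then some s :: x else x)
          ((u.map some).reverse ++ none :: t) c p := by
      cases bm <;> cases bx <;> simp [unloadStep, eval]
    rw [h1, ih]
    cases bm <;> cases bx <;> simp

theorem exists_syms_eq_map : ∀ d : Code, ∃ u : List Bool, d.syms = u.map some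
  | .leaf => ⟨[false], rfl⟩
  | .node l r => by
    obtain ⟨u, hu⟩ := exists_syms_eq_map l
    obtain ⟨v, hv⟩ := exists_syms_eq_map r
    exact ⟨true :: (u ++ v), by simp [Code.syms, hu, hv]⟩

/-- The symbols `none` at the bottom of `cnt` and `tmp` stop the two loops and keep the older
contents of these stacks untouched. The detour through `tmp` reverses the code twice. -/
theorem eval_transfer {L k : ℕ} {d : Code} (hd : d.size ≤ L ^ k) (fx bm bx : Bool)
    (m x t c p : List Sym) :
    (transfer k fx bm bx).eval L
      (mkStore (if fx then m else d.syms ++ m) (if fx then d.syms ++ x else x) t c p) =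
      mkStore (if bm then d.syms ++ m else m) (if bx then d.syms ++ x else x) t c p := by
  have h1 := iterate_of_le (iterate_scanStep L fx d m (none :: t) (none :: c) p x)
    (by simp [scanStep, eval]) hd
  obtain ⟨u, hu⟩ := exists_syms_eq_map d
  have h2 := iterate_of_le (iterate_unloadStep L bm bx u m x t c p)
    (by simp [unloadStep, eval]) (j := L ^ k)
    (by rw [← d.length_syms, hu, List.length_map] at hd; exact hd)
  rw [← hu] at h2
  simp only [transfer, eval, eval_repPow, update_mkStore_tmp, update_mkStore_cnt, mkStore_tmp,
    mkStore_cnt, h1, List.tail_cons, h2]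

theorem eval_drop {L k : ℕ} {d : Code} (hd : d.size ≤ L ^ k) (m x t c p : List Sym) :
    (transfer k false false false).eval L (mkStore (d.syms ++ m) x t c p) =
      mkStore m x t c p := eval_transfer hd false false false m x t c p

theorem eval_toAux {L k : ℕ} {d : Code} (hd : d.size ≤ L ^ k) (m x t c p : List Sym) :
    (transfer k false false true).eval L (mkStore (d.syms ++ m) x t c p) =
      mkStore m (d.syms ++ x) t c p := eval_transfer hd false false true m x t c p

theorem eval_ofAux {L k : ℕ} {d : Code} (hd : d.size ≤ L ^ k) (m x t c p : List Sym) :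
    (transfer k true true false).eval L (mkStore m (d.syms ++ x) t c p) =
      mkStore (d.syms ++ m) x t c p := eval_transfer hd true true false m x t c p

theorem eval_copyAux {L k : ℕ} {d : Code} (hd : d.size ≤ L ^ k) (m x t c p : List Sym) :
    (transfer k false true true).eval L (mkStore (d.syms ++ m) x t c p) =
      mkStore (d.syms ++ m) (d.syms ++ x) t c p := eval_transfer hd false true true m x t c p

/-- Push a word in such a way that its first symbol ends up on top. -/
def pushWord : List Sym → Prog
  | [] => .skip
  | s :: u => .seq (pushWord u) (.push .main s)

theorem eval_pushWord (L : ℕ) (m x t c p : List Sym) : ∀ u,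
    (pushWord u).eval L (mkStore m x t c p) = mkStore (u ++ m) x t c p
  | [] => rfl
  | s :: u => by simp [pushWord, eval, eval_pushWord L m x t c p u]

end Prog

/-! ### Types represented by trees, and polynomial-time functions between them -/

/-- A representation of the elements of a type by trees. -/
class Rep (α : Type) where
  enc : α → Code

/-- The size of the representation. -/
def sz {α : Type} [Rep α] (a : α) : ℕ := (Rep.enc a).size

theorem sz_pos {α : Type} [Rep α] (a : α) : 0 < sz a := Code.size_pos _

instance : Rep Unit := ⟨fun _ => .leaf⟩

instance : Rep Bool := ⟨fun b => if b then .node .leaf .leaf else .leaf⟩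

/-- Natural numbers are represented in unary. -/
def encNat : ℕ → Code
  | 0 => .leaf
  | n + 1 => .node .leaf (encNat n)

instance : Rep ℕ := ⟨encNat⟩

instance {α β : Type} [Rep α] [Rep β] : Rep (α × β) := ⟨fun p => .node (Rep.enc p.1) (Rep.enc p.2)⟩

instance {α : Type} [Rep α] : Rep (Option α) :=
  ⟨fun o => match o with
    | none => .leaf
    | some a => .node (Rep.enc a) .leaf⟩

def encList {α : Type} [Rep α] : List α → Code
  | [] => .leaf
  | a :: l => .node (Rep.enc a) (encList l)

instance {α : Type} [Rep α] : Rep (List α) := ⟨encList⟩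

section
variable {α β γ δ τ : Type} [Rep α] [Rep β] [Rep γ] [Rep δ] [Rep τ]

@[simp] theorem sz_unit (a : Unit) : sz a = 1 := rfl
theorem sz_bool_le (b : Bool) : sz b ≤ 3 := by cases b <;> decide
@[simp] theorem sz_nat (n : ℕ) : sz n = 2 * n + 1 := by
  induction n with
  | zero => rfl
  | succ n ih =>
    have : sz (n + 1) = 1 + sz n + 1 := rfl
    omega
@[simp] theorem sz_prod (p : α × β) : sz p = sz p.1 + sz p.2 + 1 := rfl
@[simp] theorem sz_none : sz (none : Option α) = 1 := rfl
@[simp] theorem sz_some (a : α) : sz (some a) = sz a + 2 := rfl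
@[simp] theorem sz_nil : sz ([] : List α) = 1 := rfl
@[simp] theorem sz_cons (a : α) (l : List α) : sz (a :: l) = sz a + sz l + 1 := rfl

/-- `u` is bounded by a polynomial in the size of its argument. -/
def PolyBdd (u : α → ℕ) : Prop := ∃ c : ℕ, ∀ a, u a ≤ (sz a + 2) ^ c

/-- The closure of stack programs under composition and bounded iteration: for inputs whose size is
at most the `k`-th power of the yardstick, some program replaces the code of `a` on top of `main`
by that of `f a`, and the size of `f a` is polynomial in that of `a`. -/
def PolyTime (f : α → β) : Prop :=
  PolyBdd (fun a => sz (f a)) ∧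
    ∀ k : ℕ, ∃ p : Prog, ∀ L : ℕ, 2 ≤ L → ∀ a, sz a ≤ L ^ k → ∀ m x t c q : List Sym,
      p.eval L (mkStore ((Rep.enc a).syms ++ m) x t c q) =
        mkStore ((Rep.enc (f a)).syms ++ m) x t c q

namespace PolyBdd

theorem mono {u v : α → ℕ} (hv : PolyBdd v) (h : ∀ a, u a ≤ v a) : PolyBdd u :=
  hv.imp fun _ hc a => (h a).trans (hc a)

theorem sz_self : PolyBdd (fun a : α => sz a) := ⟨1, fun a => by simp⟩

theorem const (n : ℕ) : PolyBdd (fun _ : α => n) :=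
  ⟨n, fun a => (Nat.lt_two_pow_self).le.trans (Nat.pow_le_pow_left (by omega) _)⟩

theorem add {u v : α → ℕ} (hu : PolyBdd u) (hv : PolyBdd v) : PolyBdd (fun a => u a + v a) := by
  obtain ⟨c, hc⟩ := hu
  obtain ⟨d, hd⟩ := hv
  refine ⟨max c d + 1, fun a => ?_⟩
  have h1 : (sz a + 2) ^ c ≤ (sz a + 2) ^ max c d :=
    Nat.pow_le_pow_right (by omega) (le_max_left _ _)
  have h2 : (sz a + 2) ^ d ≤ (sz a + 2) ^ max c d :=
    Nat.pow_le_pow_right (by omega) (le_max_right _ _)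
  have h3 : 2 * (sz a + 2) ^ max c d ≤ (sz a + 2) ^ (max c d + 1) := by
    rw [pow_succ, mul_comm]
    exact Nat.mul_le_mul_left _ (by omega)
  have := hc a
  have := hd a
  show u a + v a ≤ _
  omega

theorem mul {u v : α → ℕ} (hu : PolyBdd u) (hv : PolyBdd v) : PolyBdd (fun a => u a * v a) := by
  obtain ⟨c, hc⟩ := hu
  obtain ⟨d, hd⟩ := hv
  exact ⟨c + d, fun a => by rw [pow_add]; exact Nat.mul_le_mul (hc a) (hd a)⟩

theorem pow {u : α → ℕ} (hu : PolyBdd u) (k : ℕ) : PolyBdd (fun a => u a ^ k) := by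
  obtain ⟨c, hc⟩ := hu
  exact ⟨c * k, fun a => by rw [pow_mul]; exact Nat.pow_le_pow_left (hc a) _⟩

theorem comp {u : β → ℕ} {f : α → β} (hu : PolyBdd u) (hf : PolyBdd fun a => sz (f a)) :
    PolyBdd (fun a => u (f a)) := by
  obtain ⟨c, hc⟩ := hu
  exact ((hf.add (const 2)).pow c).mono fun a => hc (f a)

/-- In the range of validity of a program, polynomial bounds are powers of the yardstick. -/
theorem exists_pow {u : α → ℕ} (hu : PolyBdd u) (k : ℕ) :
    ∃ k', ∀ L, 2 ≤ L → ∀ a, sz a ≤ L ^ k → u a ≤ L ^ k' := by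
  obtain ⟨c, hc⟩ := hu
  refine ⟨(k + 2) * c, fun L hL a ha => (hc a).trans ?_⟩
  rw [pow_mul]
  refine Nat.pow_le_pow_left ?_ _
  have h1 : 1 ≤ L ^ k := Nat.one_le_pow _ _ (by omega)
  have h2 : L ^ k * 4 ≤ L ^ k * L ^ 2 := Nat.mul_le_mul_left _ (by nlinarith)
  rw [pow_add]
  omega

end PolyBdd

namespace PolyTime

/-- Common choice of a power that bounds the sizes of the input and of an intermediate result. -/
theorem exists_bound {f : α → β} (hf : PolyBdd fun a => sz (f a)) (k : ℕ) :
    ∃ k', ∀ L, 2 ≤ L → ∀ a : α, sz a ≤ L ^ k → sz a ≤ L ^ k' ∧ sz (f a) ≤ L ^ k' := by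
  obtain ⟨k', hk'⟩ := (PolyBdd.sz_self.add hf).exists_pow k
  exact ⟨k', fun L hL a ha => by have := hk' L hL a ha; omega⟩

theorem of_enc_eq {f : α → β} (h : ∀ a, Rep.enc (f a) = Rep.enc a) : PolyTime f :=
  ⟨PolyBdd.sz_self.mono fun a => by rw [sz, sz, h], fun _ => ⟨.skip, fun L _ a _ m x t c q => by
    rw [Prog.eval, h]⟩⟩

theorem id : PolyTime (fun a : α => a) := of_enc_eq fun _ => rfl

/-- The intermediate value may exceed `L ^ k`, so the program for `g` is taken for a larger
exponent. This is why `PolyTime` demands a size bound and a program for every exponent. -/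
theorem comp {g : β → γ} {f : α → β} (hg : PolyTime g) (hf : PolyTime f) :
    PolyTime (fun a => g (f a)) := by
  refine ⟨PolyBdd.comp (u := fun b => sz (g b)) hg.1 hf.1, fun k => ?_⟩
  obtain ⟨k', hk'⟩ := exists_bound hf.1 k
  obtain ⟨p, hp⟩ := hf.2 k
  obtain ⟨p', hp'⟩ := hg.2 k'
  exact ⟨.seq p p', fun L hL a ha m x t c q => by
    rw [Prog.eval, hp L hL a ha, hp' L hL (f a) (hk' L hL a ha).2]⟩

theorem const (b : β) : PolyTime (fun _ : α => b) :=
  ⟨PolyBdd.const _, fun k => ⟨.seq (.transfer k false false false) (.pushWord (Rep.enc b).syms),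
    fun L _ a ha m x t c q => by rw [Prog.eval, Prog.eval_drop ha, Prog.eval_pushWord]⟩⟩

theorem pair {f : α → β} {g : α → γ} (hf : PolyTime f) (hg : PolyTime g) :
    PolyTime (fun a => (f a, g a)) := by
  refine ⟨(((hf.1.add hg.1).add (PolyBdd.const 1))).mono fun a => le_rfl, fun k => ?_⟩
  obtain ⟨p, hp⟩ := hf.2 k
  obtain ⟨p', hp'⟩ := hg.2 k
  refine ⟨.seq (.transfer k false true true) (.seq p' (.seq (.transfer k true true false)
    (.seq p (.push .main (some true))))), fun L hL a ha m x t c q => ?_⟩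
  have h : (Rep.enc (f a, g a)).syms =
    some true :: ((Rep.enc (f a)).syms ++ (Rep.enc (g a)).syms) := rfl
  simp only [Prog.eval, Prog.eval_copyAux ha, hp' L hL a ha, Prog.eval_ofAux ha, hp L hL a ha, h,
    mkStore_main, update_mkStore_main, List.cons_append, List.append_assoc]

theorem fst : PolyTime (fun p : α × β => p.1) := by
  refine ⟨PolyBdd.sz_self.mono fun p => by simp; omega, fun k => ?_⟩
  refine ⟨.pop .main fun _ => .seq (.transfer k false false true)
    (.seq (.transfer k false false false) (.transfer k true true false)),
    fun L hL a ha m x t c q => ?_⟩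
  rw [sz_prod] at ha
  have h1 : (Rep.enc a.1).size ≤ L ^ k := by
    have : sz a.1 = (Rep.enc a.1).size := rfl
    omega
  have h2 : (Rep.enc a.2).size ≤ L ^ k := by
    have : sz a.2 = (Rep.enc a.2).size := rfl
    omega
  have h3 : (Rep.enc a).syms = some true :: ((Rep.enc a.1).syms ++ (Rep.enc a.2).syms) := rfl
  simp only [Prog.eval, h3, List.cons_append, mkStore_main, List.tail_cons, update_mkStore_main,
    List.append_assoc, Prog.eval_toAux h1, Prog.eval_drop h2, Prog.eval_ofAux h1]

theorem snd : PolyTime (fun p : α × β => p.2) := by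
  refine ⟨PolyBdd.sz_self.mono fun p => by simp; omega, fun k => ?_⟩
  refine ⟨.pop .main fun _ => .transfer k false false false, fun L hL a ha m x t c q => ?_⟩
  rw [sz_prod] at ha
  have h1 : (Rep.enc a.1).size ≤ L ^ k := by
    have : sz a.1 = (Rep.enc a.1).size := rfl
    omega
  have h3 : (Rep.enc a).syms = some true :: ((Rep.enc a.1).syms ++ (Rep.enc a.2).syms) := rfl
  simp only [Prog.eval, h3, List.cons_append, mkStore_main, List.tail_cons, update_mkStore_main,
    List.append_assoc, Prog.eval_drop h1]

/-- Case distinction on whether the representation of `u x` is a leaf. -/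
theorem cases {u : γ → δ} {g f : γ → β} {k : γ × α × τ → β} (hu : PolyTime u) (hg : PolyTime g)
    (hk : PolyTime k)
    (h : ∀ x, (Rep.enc (u x) = .leaf ∧ f x = g x) ∨
      ∃ a t, Rep.enc (u x) = .node (Rep.enc a) (Rep.enc t) ∧ f x = k (x, a, t)) :
    PolyTime f := by
  constructor
  · obtain ⟨c, hc⟩ := hk.1
    refine (hg.1.add (((PolyBdd.sz_self.add hu.1).add (PolyBdd.const 4)).pow c)).mono fun x => ?_
    rcases h x with ⟨_, h2⟩ | ⟨a, t, h1, h2⟩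
    · rw [h2]; exact Nat.le_add_right _ _
    · rw [h2]
      refine (hc _).trans ((Nat.pow_le_pow_left ?_ c).trans (Nat.le_add_left _ _))
      have : sz (u x) = sz a + sz t + 1 := by rw [sz, h1]; rfl
      simp only [sz_prod]
      omega
  · intro n
    obtain ⟨n', hn'⟩ := (((PolyBdd.sz_self (α := γ)).add hu.1).add (PolyBdd.const 4)).exists_pow n
    obtain ⟨pu, hpu⟩ := (id.pair hu).2 n
    obtain ⟨pg, hpg⟩ := hg.2 n
    obtain ⟨pk, hpk⟩ := hk.2 n'
    refine ⟨.seq pu (.pop .main fun _ => .seq (.transfer n false false true)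
      (.pop .main fun s => if s = some (some true) then
          -- The root mark of `u x` has been popped; it is put back as the inner pair, and together
          -- with the outer mark this makes the code of `(x, a, t)`.
          .seq (.push .main (some true)) (.seq (.transfer n true true false)
            (.seq (.push .main (some true)) pk))
        else .seq (.transfer n true true false) pg)), fun L hL x hx m y t c q => ?_⟩
    have h3 : (Rep.enc (x, u x)).syms = some true :: ((Rep.enc x).syms ++ (Rep.enc (u x)).syms) :=
      rfl
    simp only [Prog.eval, hpu L hL x hx, h3, List.cons_append, mkStore_main, List.tail_cons,
      update_mkStore_main, List.append_assoc, Prog.eval_toAux hx]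
    have hs := hn' L hL x hx
    rcases h x with ⟨h1, h2⟩ | ⟨a, b, h1, h2⟩
    · rw [h1, h2]
      simp only [Code.syms, List.cons_append, List.nil_append, List.head?_cons, List.tail_cons,
        Option.some.injEq, reduceCtorEq, if_false, Prog.eval, Prog.eval_ofAux hx]
      exact hpg L hL x hx m y t c q
    · have : sz (u x) = sz a + sz b + 1 := by rw [sz, h1]; rfl
      have h4 := hpk L hL (x, a, b) (by simp only [sz_prod]; omega) m y t c q
      have h5 : (Rep.enc (x, a, b)).syms = some true :: ((Rep.enc x).syms ++
        some true :: ((Rep.enc a).syms ++ (Rep.enc b).syms)) := rfl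
      rw [h1, h2, ← h4, h5]
      simp only [Code.syms, List.cons_append, List.head?_cons, List.tail_cons, if_true, Prog.eval,
        mkStore_main, update_mkStore_main, Prog.eval_ofAux hx, List.append_assoc]

/-- Iteration of a function until it is stable. -/
theorem iterate {ini f : γ → δ} {step : δ → δ} (hi : PolyTime ini) (hs : PolyTime step)
    {u v : γ → ℕ} (hu : PolyBdd u) (hb : ∀ x i, sz (step^[i] (ini x)) ≤ u x)
    (hv : PolyBdd v) (h : ∀ x i, v x ≤ i → step^[i] (ini x) = f x) : PolyTime f := by
  refine ⟨hu.mono fun x => by rw [← h x (v x) le_rfl]; exact hb _ _, fun k => ?_⟩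
  obtain ⟨k₁, hk₁⟩ := hu.exists_pow k
  obtain ⟨k₂, hk₂⟩ := hv.exists_pow k
  obtain ⟨p, hp⟩ := hi.2 k
  obtain ⟨p', hp'⟩ := hs.2 k₁
  refine ⟨.seq p (.repPow k₂ p'), fun L hL a ha m x t c q => ?_⟩
  -- The loop runs `L ^ k₂ ≥ v a` times, which is enough for the iteration to have become stable.
  rw [Prog.eval, hp L hL a ha, Prog.eval_repPow, ← h a (L ^ k₂) (hk₂ L hL a ha)]
  generalize L ^ k₂ = n
  induction n with
  | zero => rfl
  | succ n ih =>
    rw [Function.iterate_succ_apply', ih, Function.iterate_succ_apply']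
    exact hp' L hL _ ((hb a n).trans (hk₁ L hL a ha)) m x t c q

end PolyTime
end

/-! ### Input and output -/

namespace Prog

/-- Read a word, given in reverse order on `port`, into a list on `main`. -/
def readStep : Prog :=
  .pop .port fun h => match h with
    | none => .skip
    | some s => .pushWord (some true :: (Rep.enc s).syms)

/-- Move the head of a list of symbols on `main` to `tmp`. -/
def unpackStep : Prog :=
  .pop .main fun h => if h = some (some true) then
    .pop .main fun h => if h = some (some true) then
      .pop .main fun h => if h = some (some true) then
        .seq (.pop .main fun _ => .skip) (.seq (.pop .main fun _ => .skip)
          (.seq (.pop .main fun _ => .skip) (.push .tmp (some true))))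
      else .seq (.pop .main fun _ => .skip) (.push .tmp (some false))
    else .push .tmp none
  else .push .main (some false)

/-- Move a symbol from `tmp` to `port`. -/
def writeStep : Prog :=
  .pop .tmp fun h => match h with
    | none => .skip
    | some s => .push .port s

theorem iterate_readStep (L : ℕ) : ∀ (x m : List Sym) (y : List Sym), m = (Rep.enc y).syms →
    (readStep.eval L)^[x.length] (mkStore m [] [] [] x) =
      mkStore (Rep.enc (x.reverse ++ y)).syms [] [] [] []
  | [], m, y, h => by rw [h]; rfl
  | s :: x, m, y, h => by
    have h1 : readStep.eval L (mkStore m [] [] [] (s :: x)) =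
        mkStore (some true :: (Rep.enc s).syms ++ m) [] [] [] x := by
      simp [readStep, eval, eval_pushWord]
    rw [List.length_cons, Function.iterate_succ_apply, h1,
      iterate_readStep L x _ (s :: y) (by rw [h]; rfl)]
    simp

theorem iterate_unpackStep (L : ℕ) : ∀ (y t : List Sym),
    (unpackStep.eval L)^[y.length] (mkStore (Rep.enc y).syms [] t [] []) =
      mkStore [some false] [] (y.reverse ++ t) [] []
  | [], t => rfl
  | s :: y, t => by
    have h : (Rep.enc (s :: y)).syms = some true :: ((Rep.enc s).syms ++ (Rep.enc y).syms) := rfl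
    have h1 : unpackStep.eval L (mkStore (Rep.enc (s :: y)).syms [] t [] []) =
        mkStore (Rep.enc y).syms [] (s :: t) [] [] := by
      rw [h]
      rcases s with _ | _ | _ <;> simp [unpackStep, eval, Rep.enc, Code.syms]
    rw [List.length_cons, Function.iterate_succ_apply, h1, iterate_unpackStep L y]
    simp

theorem iterate_writeStep (L : ℕ) : ∀ (y p : List Sym),
    (writeStep.eval L)^[y.length] (mkStore [] [] y [] p) = mkStore [] [] [] [] (y.reverse ++ p)
  | [], p => rfl
  | s :: y, p => by
    have h1 : writeStep.eval L (mkStore [] [] (s :: y) [] p) = mkStore [] [] y [] (s :: p) := by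
      simp [writeStep, eval]
    rw [List.length_cons, Function.iterate_succ_apply, h1, iterate_writeStep L y]
    simp

end Prog

theorem length_le_sz {α : Type} [Rep α] : ∀ l : List α, l.length ≤ sz l
  | [] => Nat.zero_le _
  | a :: l => by
    have := length_le_sz l
    simp only [List.length_cons, sz_cons]
    omega

theorem sz_sym_le (s : Sym) : sz s ≤ 5 := by
  rcases s with _ | _ | _ <;> decide

theorem sz_list_le {α : Type} [Rep α] {B : ℕ} : ∀ l : List α, (∀ a ∈ l, sz a ≤ B) →
    sz l ≤ l.length * (B + 1) + 1
  | [], _ => by simp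
  | a :: l, h => by
    have h1 := sz_list_le l fun a ha => h a (List.mem_cons_of_mem _ ha)
    have h2 := h a List.mem_cons_self
    simp only [List.length_cons, sz_cons, Nat.add_mul]
    omega

/-- The passage from the internal notion to machines: only the behaviour of `F` on strings that
encode inputs matters, while `F` itself has to be polynomially bounded on all strings. -/
theorem isPolyTime_of_polyTime {A B : Type} {inp : A → Description} {out : B → Description}
    {f : A → B} {F : List Sym → List Sym} (hF : PolyTime F)
    (h : ∀ a, F (inp a).toString = (out (f a)).toString) : IsPolyTime inp out f := by
  -- The tree of a string of length `l` has at most `6 * l + 1 ≤ (l + 2) ^ 4` nodes, whence the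
  -- exponent.
  obtain ⟨p, hp⟩ := hF.2 4
  obtain ⟨k, hk⟩ := hF.1.exists_pow 4
  -- The input lies on `port` in reverse order, so consing its symbols one by one onto the empty
  -- list (whose code is `some false`) restores the order. On output, unpacking to `tmp` and writing
  -- to `port` reverse twice.
  refine isPolyTime_of_prog (.seq (.seq (.push .main (some false)) (.rep .readStep))
    (.seq p (.seq (.repPow k .unpackStep) (.seq (.pop .main fun _ => .skip)
      (.repPow k .writeStep))))) fun a => ?_
  rw [← h a]
  set x := (inp a).toString
  have hL : 2 ≤ x.length + 2 := by omega
  have hx : sz x ≤ (x.length + 2) ^ 4 := by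
    refine (sz_list_le x fun s _ => sz_sym_le s).trans ?_
    have : 2 ^ 3 ≤ (x.length + 2) ^ 3 := Nat.pow_le_pow_left hL 3
    calc x.length * (5 + 1) + 1 ≤ 8 * (x.length + 2) := by omega
      _ ≤ (x.length + 2) ^ 3 * (x.length + 2) := Nat.mul_le_mul_right _ this
      _ = _ := by ring
  have hy : (F x).length ≤ (x.length + 2) ^ k := (length_le_sz _).trans (hk _ hL x hx)
  have h1 := Prog.iterate_of_le (Prog.iterate_readStep (x.length + 2) x.reverse [some false] [] rfl)
    (by simp [Prog.readStep, Prog.eval]) (j := x.length + 2) (by simp)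
  have h2 := hp _ hL x hx [] [] [] [] []
  have h3 := Prog.iterate_of_le (Prog.iterate_unpackStep (x.length + 2) (F x) [])
    (by simp [Prog.unpackStep, Prog.eval]) hy
  have h4 := Prog.iterate_of_le (Prog.iterate_writeStep (x.length + 2) (F x).reverse [])
    (by simp [Prog.writeStep, Prog.eval]) (j := (x.length + 2) ^ k) (by rwa [List.length_reverse])
  simp only [List.reverse_reverse, List.append_nil] at h1 h2 h3 h4
  simp only [portStore_eq, Prog.eval, update_mkStore_main, mkStore_main, h1, h2,
    Prog.eval_repPow, h3, List.tail_cons, h4]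


/-! ### A library of polynomial-time functions -/

attribute [fun_prop] PolyTime
attribute [fun_prop] PolyTime.id PolyTime.const PolyTime.comp PolyTime.pair PolyTime.fst
  PolyTime.snd

section
variable {α β γ δ τ : Type} [Rep α] [Rep β] [Rep γ] [Rep δ] [Rep τ]

@[simp] theorem sz_append : ∀ l l' : List α, sz (l ++ l') + 1 = sz l + sz l'
  | [], l' => by simp; omega
  | a :: l, l' => by
    have := sz_append l l'
    simp only [List.cons_append, sz_cons]
    omega

theorem sz_le_of_mem {a : α} : ∀ {l : List α}, a ∈ l → sz a ≤ sz l
  | b :: l, h => by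
    rcases List.mem_cons.1 h with rfl | h
    · simp only [sz_cons]; omega
    · have := sz_le_of_mem h
      simp only [sz_cons]; omega

theorem sz_drop_le (l : List α) (i : ℕ) : sz (l.drop i) ≤ sz l := by
  have := sz_append (l.take i) (l.drop i)
  rw [List.take_append_drop] at this
  have := sz_pos (l.take i)
  omega

namespace PolyBdd

theorem exists_mem {u : γ × α → ℕ} (hu : PolyBdd u) {l : γ → List α}
    (hl : PolyBdd fun x => sz (l x)) :
    ∃ v : γ → ℕ, PolyBdd v ∧ ∀ x, ∀ a ∈ l x, u (x, a) ≤ v x := by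
  obtain ⟨c, hc⟩ := hu
  refine ⟨_, ((sz_self.add hl).add (const 3)).pow c, fun x a ha => (hc _).trans ?_⟩
  have := sz_le_of_mem ha
  refine Nat.pow_le_pow_left ?_ c
  simp only [sz_prod]
  omega

end PolyBdd

namespace PolyTime

@[fun_prop]
theorem cond {b : γ → Bool} {f g : γ → α} (hb : PolyTime b) (hf : PolyTime f) (hg : PolyTime g) :
    PolyTime fun x => cond (b x) (f x) (g x) := by
  refine cases (α := Unit) (τ := Unit) (k := fun p => f p.1) hb hg (hf.comp fst) fun x => ?_
  cases h : b x
  · exact .inl ⟨rfl, rfl⟩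
  · exact .inr ⟨(), (), rfl, rfl⟩

/-- Functions of one bit. -/
theorem bit (f : Bool → α) {b : γ → Bool} (hb : PolyTime b) : PolyTime fun x => f (b x) := by
  have : (fun x => f (b x)) = fun x => bif b x then f true else f false := by
    funext x; cases b x <;> rfl
  rw [this]
  fun_prop

/-- Functions of two bits. -/
theorem bits (f : Bool → Bool → α) {b c : γ → Bool} (hb : PolyTime b) (hc : PolyTime c) :
    PolyTime fun x => f (b x) (c x) := by
  have : (fun x => f (b x) (c x)) = fun x => bif b x then f true (c x) else f false (c x) := by
    funext x; cases b x <;> rfl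
  rw [this]
  exact hb.cond (hc.bit _) (hc.bit _)

@[fun_prop]
theorem not {b : γ → Bool} (hb : PolyTime b) : PolyTime fun x => !(b x) := hb.bit Bool.not

@[fun_prop]
theorem xor {b c : γ → Bool} (hb : PolyTime b) (hc : PolyTime c) :
    PolyTime fun x => Bool.xor (b x) (c x) := hb.bits Bool.xor hc

@[fun_prop]
theorem and {b c : γ → Bool} (hb : PolyTime b) (hc : PolyTime c) :
    PolyTime fun x => (b x && c x) := hb.bits Bool.and hc

@[fun_prop]
theorem or {b c : γ → Bool} (hb : PolyTime b) (hc : PolyTime c) :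
    PolyTime fun x => (b x || c x) := hb.bits Bool.or hc

@[fun_prop]
theorem elim {o : γ → Option α} {g : γ → β} {k : γ → α → β} (ho : PolyTime o) (hg : PolyTime g)
    (hk : PolyTime fun p : γ × α => k p.1 p.2) : PolyTime fun x => (o x).elim (g x) (k x) := by
  refine cases (α := α) (τ := Unit) (k := fun p => k p.1 p.2.1) ho hg
    (hk.comp (fst.pair (fst.comp snd))) fun x => ?_
  cases h : o x
  · exact .inl ⟨rfl, rfl⟩
  · exact .inr ⟨_, (), rfl, rfl⟩

@[fun_prop]
theorem some {a : γ → α} (ha : PolyTime a) : PolyTime fun x => Option.some (a x) :=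
  (of_enc_eq (f := fun p : α × Unit => Option.some p.1) fun _ => rfl).comp (ha.pair (const ()))

/-! #### Lists -/

@[fun_prop]
theorem cons {a : γ → α} {l : γ → List α} (ha : PolyTime a) (hl : PolyTime l) :
    PolyTime fun x => a x :: l x :=
  (of_enc_eq (f := fun p : α × List α => p.1 :: p.2) fun _ => rfl).comp (ha.pair hl)

theorem listCases {l : γ → List α} {g : γ → β} {k : γ → α → List α → β} (hl : PolyTime l)
    (hg : PolyTime g) (hk : PolyTime fun p : γ × α × List α => k p.1 p.2.1 p.2.2) :
    PolyTime fun x => List.casesOn (motive := fun _ => β) (l x) (g x) (k x) := by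
  refine cases hl hg hk fun x => ?_
  cases h : l x
  · exact .inl ⟨rfl, rfl⟩
  · exact .inr ⟨_, _, rfl, rfl⟩

@[fun_prop]
theorem tail {l : γ → List α} (hl : PolyTime l) : PolyTime fun x => (l x).tail := by
  have : (fun x => (l x).tail) =
      fun x => List.casesOn (motive := fun _ => List α) (l x) [] fun _ t => t := by
    funext x; cases l x <;> rfl
  rw [this]
  exact hl.listCases (const _) (by fun_prop)

@[fun_prop]
theorem headD {l : γ → List α} {d : γ → α} (hl : PolyTime l) (hd : PolyTime d) :
    PolyTime fun x => (l x).headD (d x) := by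
  have : (fun x => (l x).headD (d x)) =
      fun x => List.casesOn (motive := fun _ => α) (l x) (d x) fun a _ => a := by
    funext x; cases l x <;> rfl
  rw [this]
  exact hl.listCases hd (by fun_prop)

/-- The state of the loop consists of the parameter, the accumulator and the rest of the list; for
an empty rest the step is the identity, as `iterate` needs. The bound on all partial results cannot
be dropped, since repeated polynomial growth may be exponential. -/
theorem foldl {l : γ → List α} {b : γ → β} {f : γ → β → α → β} (hl : PolyTime l) (hb : PolyTime b)
    (hf : PolyTime fun p : γ × β × α => f p.1 p.2.1 p.2.2) {u : γ → ℕ} (hu : PolyBdd u)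
    (h : ∀ x i, sz (((l x).take i).foldl (f x) (b x)) ≤ u x) :
    PolyTime fun x => (l x).foldl (f x) (b x) := by
  let step : γ × β × List α → γ × β × List α := fun s =>
    List.casesOn (motive := fun _ => γ × β × List α) s.2.2 s fun a t => (s.1, f s.1 s.2.1 a, t)
  have hstep : PolyTime step := by
    refine listCases (l := fun s => s.2.2) (g := fun s => s)
      (k := fun s a t => (s.1, f s.1 s.2.1 a, t)) (by fun_prop) (by fun_prop) ?_
    exact pair (by fun_prop) (pair (hf.comp (f := fun p : (γ × β × List α) × α × List α =>
      (p.1.1, p.1.2.1, p.2.1)) (by fun_prop)) (by fun_prop))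
  have hit : ∀ (l : List α) (i : ℕ) (x : γ) (b : β), step^[i] (x, b, l) =
      (x, (l.take i).foldl (f x) b, l.drop i) := by
    intro l
    induction l with
    | nil =>
      intro i x b
      simp only [List.take_nil, List.foldl_nil, List.drop_nil]
      exact Function.iterate_fixed rfl i
    | cons a l ih =>
      intro i x b
      cases i with
      | zero => rfl
      | succ i =>
        rw [Function.iterate_succ_apply]
        exact ih i x _
  refine fst.comp (snd.comp (iterate (ini := fun x => (x, b x, l x))
    (f := fun x => (x, (l x).foldl (f x) (b x), ([] : List α))) (step := step) (by fun_prop) hstep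
    (u := fun x => sz x + (u x + sz (l x) + 1) + 1) (v := fun x => sz (l x)) ?_ ?_ hl.1 ?_))
  · exact (PolyBdd.sz_self.add ((hu.add hl.1).add (PolyBdd.const 1))).add (PolyBdd.const 1)
  · intro x i
    have := h x i
    have := sz_drop_le (l x) i
    rw [hit]
    simp only [sz_prod]
    omega
  · intro x i hi
    have := (length_le_sz (l x)).trans hi
    rw [hit, List.take_of_length_le this, List.drop_of_length_le this]

/-- Folding with a function that increases the size of the accumulator by a bounded amount. -/
theorem foldl_add {l : γ → List α} {b : γ → β} {f : γ → β → α → β} (hl : PolyTime l)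
    (hb : PolyTime b) (hf : PolyTime fun p : γ × β × α => f p.1 p.2.1 p.2.2) {u : γ → ℕ}
    (hu : PolyBdd u) (h : ∀ x, ∀ a ∈ l x, ∀ c, sz (f x c a) ≤ sz c + u x) :
    PolyTime fun x => (l x).foldl (f x) (b x) := by
  refine foldl hl hb hf (u := fun x => sz (b x) + sz (l x) * u x) (hb.1.add (hl.1.mul hu))
    fun x i => ?_
  have key : ∀ (l' : List α), (∀ a ∈ l', a ∈ l x) → ∀ c,
      sz (l'.foldl (f x) c) ≤ sz c + l'.length * u x := by
    intro l'
    induction l' with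
    | nil => intro _ c; simp
    | cons a l' ih =>
      intro ha c
      have h1 := ih (fun a' h' => ha a' (List.mem_cons_of_mem _ h')) (f x c a)
      have h2 := h x a (ha a List.mem_cons_self) c
      rw [List.foldl_cons, List.length_cons, Nat.succ_mul]
      omega
  refine (key _ (fun a ha => List.mem_of_mem_take ha) _).trans ?_
  have : ((l x).take i).length ≤ sz (l x) :=
    (List.length_take_le' _ _).trans (length_le_sz _)
  exact Nat.add_le_add_left (Nat.mul_le_mul_right _ this) _

@[fun_prop]
theorem reverse {l : γ → List α} (hl : PolyTime l) : PolyTime fun x => (l x).reverse := by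
  have : (fun x => (l x).reverse) = fun x => (l x).foldl (fun c a => a :: c) [] := by
    funext x; rw [List.foldl_flip_cons_eq_append]; simp
  rw [this]
  refine foldl_add hl (const _) (by fun_prop) (u := fun x => sz (l x) + 1)
    (hl.1.add (PolyBdd.const 1)) fun x a ha c => ?_
  have := sz_le_of_mem ha
  simp only [sz_cons]
  omega

@[fun_prop]
theorem append {l l' : γ → List α} (hl : PolyTime l) (hl' : PolyTime l') :
    PolyTime fun x => l x ++ l' x := by
  have : (fun x => l x ++ l' x) = fun x => (l x).reverse.foldl (fun c a => a :: c) (l' x) := by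
    funext x; rw [List.foldl_flip_cons_eq_append]; simp
  rw [this]
  refine foldl_add hl.reverse hl' (by fun_prop) (u := fun x => sz (l x) + 1)
    (hl.1.add (PolyBdd.const 1)) fun x a ha c => ?_
  have := sz_le_of_mem (List.mem_reverse.1 ha)
  simp only [sz_cons]
  omega

@[fun_prop]
theorem flatMap {l : γ → List α} {f : γ → α → List β} (hl : PolyTime l)
    (hf : PolyTime fun p : γ × α => f p.1 p.2) : PolyTime fun x => (l x).flatMap (f x) := by
  have : (fun x => (l x).flatMap (f x)) = fun x => (l x).foldl (fun c a => c ++ f x a) [] := by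
    funext x
    have : ∀ (l : List α) c, c ++ l.flatMap (f x) = l.foldl (fun c a => c ++ f x a) c := by
      intro l
      induction l with
      | nil => simp
      | cons a l ih => intro c; rw [List.foldl_cons, ← ih, List.flatMap_cons, List.append_assoc]
    exact this _ []
  rw [this]
  obtain ⟨u, hu, h⟩ := hf.1.exists_mem hl.1
  refine foldl_add hl (const _) ?_ hu fun x a ha c => ?_
  · exact append (by fun_prop) (hf.comp (f := fun p : γ × List β × α => (p.1, p.2.2)) (by fun_prop))
  · have := sz_append c (f x a)
    have := h x a ha
    simp only at this
    omega

@[fun_prop]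
theorem map {l : γ → List α} {f : γ → α → β} (hl : PolyTime l)
    (hf : PolyTime fun p : γ × α => f p.1 p.2) : PolyTime fun x => (l x).map (f x) := by
  have : (fun x => (l x).map (f x)) = fun x => (l x).flatMap (fun a => [f x a]) := by
    funext x; rw [List.map_eq_flatMap]
  rw [this]
  exact flatMap hl (cons hf (const _))

/-! #### Unary numbers -/

@[fun_prop]
theorem succ {n : γ → ℕ} (hn : PolyTime n) : PolyTime fun x => n x + 1 :=
  (of_enc_eq (f := fun p : Unit × ℕ => p.2 + 1) fun _ => rfl).comp ((const ()).pair hn)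

/-- Unary numbers and lists of units have the same trees, so that recursion on numbers is a special
case of folding over lists. -/
theorem encList_unit : ∀ n : ℕ, encList (List.replicate n ()) = encNat n
  | 0 => rfl
  | n + 1 => by rw [List.replicate_succ, encList, encList_unit n]; rfl

@[fun_prop]
theorem units {n : γ → ℕ} (hn : PolyTime n) : PolyTime fun x => List.replicate (n x) () :=
  (of_enc_eq (f := fun n : ℕ => List.replicate n ()) encList_unit).comp hn

@[fun_prop]
theorem length {l : γ → List α} (hl : PolyTime l) : PolyTime fun x => (l x).length := by
  have h : PolyTime fun x => (l x).map fun _ => () := map hl (const _)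
  have : (fun x => (l x).length) = fun x => (l x).foldl (fun n _ => n + 1) 0 := by
    funext x
    simp
  rw [this]
  exact foldl_add hl (const _) (by fun_prop) (PolyBdd.const 2) fun x a _ c => by
    simp only [sz_nat]; omega

theorem foldl_units (f : α → α) (a : α) : ∀ n : ℕ,
    (List.replicate n ()).foldl (fun c _ => f c) a = f^[n] a
  | 0 => rfl
  | n + 1 => by
    rw [List.replicate_succ', List.foldl_append, foldl_units f a n, Function.iterate_succ_apply']
    rfl

/-- Iterating a function a number of times that is given in unary. -/
theorem natIterate {n : γ → ℕ} {b : γ → α} {f : γ → α → α} (hn : PolyTime n) (hb : PolyTime b)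
    (hf : PolyTime fun p : γ × α => f p.1 p.2) {u : γ → ℕ} (hu : PolyBdd u)
    (h : ∀ x, ∀ i ≤ n x, sz ((f x)^[i] (b x)) ≤ u x) : PolyTime fun x => (f x)^[n x] (b x) := by
  simp only [← foldl_units]
  refine foldl (f := fun x c (_ : Unit) => f x c) hn.units hb
    (hf.comp (f := fun p : γ × α × Unit => (p.1, p.2.1)) (by fun_prop)) hu fun x i => ?_
  rw [List.take_replicate, foldl_units]
  exact h x _ (min_le_right _ _)

theorem natIterate_add {n : γ → ℕ} {b : γ → α} {f : γ → α → α} (hn : PolyTime n) (hb : PolyTime b)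
    (hf : PolyTime fun p : γ × α => f p.1 p.2) {u : γ → ℕ} (hu : PolyBdd u)
    (h : ∀ x a, sz (f x a) ≤ sz a + u x) : PolyTime fun x => (f x)^[n x] (b x) := by
  simp only [← foldl_units]
  exact foldl_add (f := fun x c (_ : Unit) => f x c) hn.units hb
    (hf.comp (f := fun p : γ × α × Unit => (p.1, p.2.1)) (by fun_prop)) hu fun x _ _ c => h x c

@[fun_prop]
theorem natAdd {m n : γ → ℕ} (hm : PolyTime m) (hn : PolyTime n) : PolyTime fun x => m x + n x := by
  have : (fun x => m x + n x) = fun x => Nat.succ^[n x] (m x) := by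
    funext x; rw [Nat.succ_iterate]
  rw [this]
  exact natIterate_add hn hm (f := fun _ => Nat.succ) snd.succ (PolyBdd.const 2) fun x a => by
    simp only [sz_nat, Nat.succ_eq_add_one]; omega

@[fun_prop]
theorem natMul {m n : γ → ℕ} (hm : PolyTime m) (hn : PolyTime n) : PolyTime fun x => m x * n x := by
  have : (fun x => m x * n x) = fun x => (fun k => k + m x)^[n x] 0 := by
    funext x
    induction n x with
    | zero => rfl
    | succ n ih => rw [Function.iterate_succ_apply', ← ih, Nat.mul_succ]
  rw [this]
  exact natIterate_add hn (const _) (by fun_prop) hm.1 fun x a => by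
    simp only [sz_nat]; omega

@[fun_prop]
theorem natPow {m : γ → ℕ} (hm : PolyTime m) (k : ℕ) : PolyTime fun x => m x ^ k := by
  induction k with
  | zero => simp only [pow_zero]; fun_prop
  | succ k ih => simp only [pow_succ]; fun_prop

@[fun_prop]
theorem pred {n : γ → ℕ} (hn : PolyTime n) : PolyTime fun x => (n x).pred := by
  refine cases (α := Unit) (τ := ℕ) (g := fun _ => 0) (k := fun p => p.2.2) hn (const _)
    (by fun_prop) fun x => ?_
  cases n x
  · exact .inl ⟨rfl, rfl⟩
  · exact .inr ⟨(), _, rfl, rfl⟩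

@[fun_prop]
theorem natSub {m n : γ → ℕ} (hm : PolyTime m) (hn : PolyTime n) : PolyTime fun x => m x - n x := by
  have : (fun x => m x - n x) = fun x => Nat.pred^[n x] (m x) := by
    funext x; rw [Nat.pred_iterate]
  rw [this]
  exact natIterate_add hn hm (by fun_prop) (PolyBdd.const 0) fun x a => by
    simp only [sz_nat, Nat.pred_eq_sub_one]; omega

@[fun_prop]
theorem isZero {n : γ → ℕ} (hn : PolyTime n) : PolyTime fun x => n x == 0 := by
  refine cases (α := Unit) (τ := ℕ) (g := fun _ => true) (k := fun _ => false) hn (const _)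
    (by fun_prop) fun x => ?_
  cases n x
  · exact .inl ⟨rfl, rfl⟩
  · exact .inr ⟨(), _, rfl, rfl⟩

@[fun_prop]
theorem ble {m n : γ → ℕ} (hm : PolyTime m) (hn : PolyTime n) :
    PolyTime fun x => (m x).ble (n x) := by
  have : (fun x => (m x).ble (n x)) = fun x => m x - n x == 0 := by
    funext x
    rw [Bool.eq_iff_iff, Nat.ble_eq, beq_iff_eq, Nat.sub_eq_zero_iff_le]
  rw [this]
  fun_prop

@[fun_prop]
theorem replicate {n : γ → ℕ} {a : γ → α} (hn : PolyTime n) (ha : PolyTime a) :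
    PolyTime fun x => List.replicate (n x) (a x) := by
  have : (fun x => List.replicate (n x) (a x)) =
      fun x => (List.replicate (n x) ()).map fun _ => a x := by
    funext x; rw [List.map_replicate]
  rw [this]
  exact map hn.units (ha.comp fst)

@[fun_prop]
theorem drop {n : γ → ℕ} {l : γ → List α} (hn : PolyTime n) (hl : PolyTime l) :
    PolyTime fun x => (l x).drop (n x) := by
  have : (fun x => (l x).drop (n x)) = fun x => List.tail^[n x] (l x) := by
    funext x; rw [List.tail_iterate]
  rw [this]
  exact natIterate_add hn hl (by fun_prop) (PolyBdd.const 0) fun x a => by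
    cases a <;> simp only [List.tail_nil, List.tail_cons, sz_cons] <;> omega

@[fun_prop]
theorem take {n : γ → ℕ} {l : γ → List α} (hn : PolyTime n) (hl : PolyTime l) :
    PolyTime fun x => (l x).take (n x) := by
  have : (fun x => (l x).take (n x)) =
      fun x => ((l x).reverse.drop ((l x).length - n x)).reverse := by
    funext x; rw [← List.reverse_take, List.reverse_reverse]
  rw [this]
  fun_prop

end PolyTime
end

/-! ### Words -/

/-- The words of a string in which every word is followed by an end marker. -/
def splitWords (x : List Sym) : List (List Bool) :=
  (x.foldl (fun (c : List Bool × List (List Bool)) s =>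
    s.elim ([], c.2 ++ [c.1]) fun b => (c.1 ++ [b], c.2)) ([], [])).2

theorem splitWords_toString (d : Description) : splitWords d.toString = d := by
  have h1 : ∀ (v u : List Bool) (e : List (List Bool)),
      (v.map some).foldl (fun (c : List Bool × List (List Bool)) (s : Sym) =>
        s.elim ([], c.2 ++ [c.1]) fun b => (c.1 ++ [b], c.2)) (u, e) = (u ++ v, e) := by
    intro v
    induction v with
    | nil => intro u e; simp
    | cons b v ih => intro u e; simp [ih]
  have h2 : ∀ (d : Description) (e : List (List Bool)),
      d.toString.foldl (fun (c : List Bool × List (List Bool)) (s : Sym) =>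
        s.elim ([], c.2 ++ [c.1]) fun b => (c.1 ++ [b], c.2)) ([], e) = ([], e ++ d) := by
    intro d
    induction d with
    | nil => intro e; simp [Description.toString]
    | cons v d ih =>
      intro e
      simp only [Description.toString] at ih ⊢
      rw [List.flatMap_cons, List.foldl_append, List.foldl_append, h1]
      simp [ih]
  rw [splitWords, h2]
  rfl

/-- Consecutive pairs of elements. -/
def pairUp {α : Type} (l : List α) : List (α × α) :=
  (l.foldl (fun (s : Option α × List (α × α)) a =>
    s.1.elim (some a, s.2) fun b => (none, s.2 ++ [(b, a)])) (none, [])).2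

@[simp] theorem pairUp_nil {α : Type} : pairUp ([] : List α) = [] := rfl

/-- Pair the elements of a list with those of another one, which is extended by `d`. -/
def zipPad {α β : Type} (d : β) : List α → List β → List (α × β)
  | [], _ => []
  | a :: l, l' => (a, l'.headD d) :: zipPad d l l'.tail

/-- The elements at even positions, or at odd positions. -/
def everySecond {α : Type} (b : Bool) (l : List α) : List α :=
  (l.foldl (fun (s : Bool × List α) a => (!s.1, bif s.1 then s.2 else s.2 ++ [a])) (b, [])).2

/-- The elements whose position has the given lowest binary digits. -/
def select {α : Type} (l : List α) (j : List Bool) : List α :=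
  j.foldl (fun l b => everySecond b l) l

/-- Half of a natural number, and its logarithm. -/
def half (n : ℕ) : ℕ :=
  ((fun s : Bool × ℕ => (!s.1, bif s.1 then s.2 + 1 else s.2))^[n] (false, 0)).2

/-- The number of binary digits of `n`, at least one. -/
def lg (n : ℕ) : ℕ :=
  ((fun s : ℕ × ℕ => bif Nat.ble 2 s.1 then (half s.1, s.2 + 1) else s)^[n] (n, 1)).2

/-- Sum modulo two. -/
def xorWord (u v : List Bool) : List Bool := (zipPad false u v).map fun p => Bool.xor p.1 p.2

/-- Subtraction of binary numbers, lowest digit first, with a flag for negative results. -/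
def subWord (u v : List Bool) : Bool × List Bool :=
  (zipPad false u v).foldl (fun s p => ((!p.1 && (p.2 || s.1)) || (p.2 && s.1),
    s.2 ++ [Bool.xor p.1 (Bool.xor p.2 s.1)])) (false, [])

/-- The quotient of two binary numbers, but at most `cap`. -/
def divWord (cap : ℕ) (u v : List Bool) : ℕ :=
  ((fun s : List Bool × ℕ => bif (subWord s.1 v).1 then s else ((subWord s.1 v).2, s.2 + 1))^[cap]
    (u ++ v.map (fun _ => false), 0)).2

namespace PolyTime
variable {α β γ δ τ : Type} [Rep α] [Rep β] [Rep γ] [Rep δ] [Rep τ]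

@[fun_prop]
theorem splitWords {x : γ → List Sym} (hx : PolyTime x) :
    PolyTime fun a => XZSubsampling.splitWords (x a) := by
  unfold XZSubsampling.splitWords
  refine snd.comp (foldl_add (u := fun _ => 10)
    (f := fun _ (c : List Bool × List (List Bool)) (s : Sym) =>
      s.elim ([], c.2 ++ [c.1]) fun b => (c.1 ++ [b], c.2)) hx (const _) ?_ (PolyBdd.const _) ?_)
  · refine elim (γ := γ × (List Bool × List (List Bool)) × Sym)
      (g := fun p => ([], p.2.1.2 ++ [p.2.1.1])) (k := fun p b => (p.2.1.1 ++ [b], p.2.1.2))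
      ?_ ?_ ?_ <;> fun_prop
  · rintro _ s _ ⟨u, e⟩
    cases s with
    | none =>
      have := sz_append e [u]
      simp only [Option.elim, sz_prod, sz_cons, sz_nil] at *
      omega
    | some b =>
      have := sz_append u [b]
      have := sz_bool_le b
      simp only [Option.elim, sz_prod, sz_cons, sz_nil] at *
      omega

@[fun_prop]
theorem pairUp {l : γ → List α} (hl : PolyTime l) : PolyTime fun a => XZSubsampling.pairUp (l a) := by
  unfold XZSubsampling.pairUp
  refine snd.comp (foldl_add (u := fun x => sz (l x) + 10)
    (f := fun _ (s : Option α × List (α × α)) (a : α) =>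
      s.1.elim (Option.some a, s.2) fun b => (none, s.2 ++ [(b, a)])) hl (const _) ?_
    (hl.1.add (PolyBdd.const _)) ?_)
  · refine elim (γ := γ × (Option α × List (α × α)) × α) (o := fun p => p.2.1.1)
      (g := fun p => (Option.some p.2.2, p.2.1.2))
      (k := fun p b => (none, p.2.1.2 ++ [(b, p.2.2)])) ?_ ?_ ?_ <;> fun_prop
  · rintro x a ha ⟨o, e⟩
    have := sz_le_of_mem ha
    cases o with
    | none =>
      simp only [Option.elim, sz_prod, sz_none, sz_some] at *
      omega
    | some b =>
      have := sz_append e [(b, a)]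
      simp only [Option.elim, sz_prod, sz_cons, sz_nil, sz_none, sz_some] at *
      omega

theorem foldl_zipPad {d : β} : ∀ (l : List α) (l' : List β) (e : List (α × β)),
    (l.foldl (fun (s : List β × List (α × β)) a => (s.1.tail, s.2 ++ [(a, s.1.headD d)]))
      (l', e)).2 = e ++ zipPad d l l'
  | [], l', e => by simp [zipPad]
  | a :: l, l', e => by
    rw [List.foldl_cons, foldl_zipPad l, XZSubsampling.zipPad]
    simp

@[fun_prop]
theorem zipPad (d : β) {l : γ → List α} {l' : γ → List β} (hl : PolyTime l) (hl' : PolyTime l') :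
    PolyTime fun a => XZSubsampling.zipPad d (l a) (l' a) := by
  have : (fun a => XZSubsampling.zipPad d (l a) (l' a)) = fun a =>
      ((l a).foldl (fun (s : List β × List (α × β)) a => (s.1.tail, s.2 ++ [(a, s.1.headD d)]))
        (l' a, [])).2 := by
    funext a; rw [foldl_zipPad, List.nil_append]
  rw [this]
  refine snd.comp (foldl_add (u := fun x => sz (l x) + sz d + 10)
    (f := fun _ (s : List β × List (α × β)) (a : α) => (s.1.tail, s.2 ++ [(a, s.1.headD d)]))
    hl (by fun_prop) (by fun_prop) ((hl.1.add (PolyBdd.const _)).add (PolyBdd.const _)) ?_)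
  rintro x a ha ⟨v, e⟩
  have := sz_le_of_mem ha
  have := sz_append e [(a, v.headD d)]
  cases v <;> simp only [sz_prod, sz_cons, sz_nil, List.tail_nil, List.tail_cons,
    List.headD_nil, List.headD_cons] at * <;> omega

theorem sz_everySecond_le (b : Bool) (l : List α) : sz (XZSubsampling.everySecond b l) ≤ sz l := by
  have : ∀ (l : List α) (b : Bool) (e : List α),
      sz (l.foldl (fun (s : Bool × List α) a => (!s.1, bif s.1 then s.2 else s.2 ++ [a])) (b, e)).2 + 1
        ≤ sz l + sz e := by
    intro l
    induction l with
    | nil => intro b e; simp [add_comm]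
    | cons a l ih =>
      intro b e
      have h1 := ih (!b) (bif b then e else e ++ [a])
      have h2 := sz_append e [a]
      cases b <;> simp only [cond_true, cond_false, List.foldl_cons, sz_cons, sz_nil] at * <;> omega
  have := this l b []
  simp only [sz_nil] at this
  exact Nat.le_of_succ_le_succ this

@[fun_prop]
theorem everySecond {b : γ → Bool} {l : γ → List α} (hb : PolyTime b) (hl : PolyTime l) :
    PolyTime fun a => XZSubsampling.everySecond (b a) (l a) := by
  unfold XZSubsampling.everySecond
  refine snd.comp (foldl_add (u := fun x => sz (l x) + 10)
    (f := fun _ (s : Bool × List α) (a : α) => (!s.1, bif s.1 then s.2 else s.2 ++ [a]))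
    hl (by fun_prop) (by fun_prop) (hl.1.add (PolyBdd.const _)) ?_)
  rintro x a ha ⟨b, e⟩
  have := sz_le_of_mem ha
  have := sz_append e [a]
  have := sz_bool_le (!b)
  have := sz_bool_le b
  cases b <;> simp only [cond_true, cond_false, sz_prod, sz_cons, sz_nil] at * <;> omega

@[fun_prop]
theorem select {j : γ → List Bool} {l : γ → List α} (hj : PolyTime j) (hl : PolyTime l) :
    PolyTime fun a => XZSubsampling.select (l a) (j a) := by
  unfold XZSubsampling.select
  exact foldl_add (f := fun _ (l : List α) b => XZSubsampling.everySecond b l) hj hl (by fun_prop)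
    (PolyBdd.const 0) fun _ b _ l => sz_everySecond_le b l

@[fun_prop]
theorem half {n : γ → ℕ} (hn : PolyTime n) : PolyTime fun a => XZSubsampling.half (n a) := by
  unfold XZSubsampling.half
  refine snd.comp (natIterate_add (u := fun _ => 10)
    (f := fun _ (s : Bool × ℕ) => (!s.1, bif s.1 then s.2 + 1 else s.2)) hn (const _)
    (by fun_prop) (PolyBdd.const _) ?_)
  rintro _ ⟨b, m⟩
  have := sz_bool_le (!b)
  cases b <;> simp only [cond_true, cond_false, sz_prod, sz_nat] at * <;> omega

end PolyTime

theorem half_eq (n : ℕ) : half n = n / 2 := by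
  have : ∀ n, (fun s : Bool × ℕ => (!s.1, bif s.1 then s.2 + 1 else s.2))^[n] (false, 0) =
      (decide (n % 2 = 1), n / 2) := by
    intro n
    induction n with
    | zero => rfl
    | succ n ih =>
      rw [Function.iterate_succ_apply', ih]
      rcases Nat.mod_two_eq_zero_or_one n with h | h
      · have h1 : (n + 1) % 2 = 1 := by omega
        have h2 : (n + 1) / 2 = n / 2 := by omega
        simp [h, h1, h2]
      · have h1 : (n + 1) % 2 = 0 := by omega
        have h2 : (n + 1) / 2 = n / 2 + 1 := by omega
        simp [h, h1, h2]
  rw [half, this]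

theorem lg_eq (n : ℕ) : lg n = Nat.log 2 n + 1 := by
  have : ∀ n m k, m ≤ n →
      ((fun s : ℕ × ℕ => bif Nat.ble 2 s.1 then (half s.1, s.2 + 1) else s)^[n] (m, k)).2 =
        k + Nat.log 2 m := by
    intro n
    induction n with
    | zero => intro m k h; obtain rfl := Nat.le_zero.1 h; simp
    | succ n ih =>
      intro m k h
      rw [Function.iterate_succ_apply]
      by_cases hm : 2 ≤ m
      · have : Nat.ble 2 m = true := by rw [Nat.ble_eq]; exact hm
        simp only [this, cond_true]
        rw [ih _ _ (by rw [half_eq]; omega), half_eq, Nat.log_of_one_lt_of_le one_lt_two hm]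
        ring
      · have : Nat.ble 2 m = false := by
          rw [Bool.eq_false_iff]; intro h'; rw [Nat.ble_eq] at h'; exact hm h'
        simp only [this, cond_false]
        rw [Function.iterate_fixed (by simp only [this, cond_false]), Nat.log_of_lt (by omega)]
        rfl
  rw [lg, this n n 1 le_rfl, add_comm]

namespace PolyTime
variable {α β γ δ τ : Type} [Rep α] [Rep β] [Rep γ] [Rep δ] [Rep τ]

@[fun_prop]
theorem lg {n : γ → ℕ} (hn : PolyTime n) : PolyTime fun a => XZSubsampling.lg (n a) := by
  unfold XZSubsampling.lg
  refine snd.comp (natIterate_add (u := fun _ => 10)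
    (f := fun _ (s : ℕ × ℕ) => bif Nat.ble 2 s.1 then (XZSubsampling.half s.1, s.2 + 1) else s)
    hn (by fun_prop) (by fun_prop) (PolyBdd.const _) ?_)
  rintro _ ⟨m, k⟩
  have : XZSubsampling.half m ≤ m := by rw [half_eq]; omega
  cases h : Nat.ble 2 m <;> simp only [h, cond_true, cond_false, sz_prod, sz_nat] at * <;> omega

@[fun_prop]
theorem xorWord {u v : γ → List Bool} (hu : PolyTime u) (hv : PolyTime v) :
    PolyTime fun a => XZSubsampling.xorWord (u a) (v a) := by
  unfold XZSubsampling.xorWord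
  fun_prop

theorem foldl_subWord_sz (l : List (Bool × Bool)) : ∀ s : Bool × List Bool,
    (l.foldl (fun s p => ((!p.1 && (p.2 || s.1)) || (p.2 && s.1),
      s.2 ++ [Bool.xor p.1 (Bool.xor p.2 s.1)])) s).2.length = s.2.length + l.length := by
  induction l with
  | nil => intro s; rfl
  | cons p l ih => intro s; rw [List.foldl_cons, ih]; simp; omega

@[fun_prop]
theorem subWord {u v : γ → List Bool} (hu : PolyTime u) (hv : PolyTime v) :
    PolyTime fun a => XZSubsampling.subWord (u a) (v a) := by
  unfold XZSubsampling.subWord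
  refine foldl_add (u := fun _ => 10) (f := fun _ (s : Bool × List Bool) (p : Bool × Bool) =>
    ((!p.1 && (p.2 || s.1)) || (p.2 && s.1), s.2 ++ [Bool.xor p.1 (Bool.xor p.2 s.1)]))
    (by fun_prop) (const _) (by fun_prop) (PolyBdd.const _) ?_
  rintro _ ⟨b, c⟩ _ ⟨d, e⟩
  have := sz_append e [Bool.xor b (Bool.xor c d)]
  have := sz_bool_le (Bool.xor b (Bool.xor c d))
  have := sz_bool_le ((!b && (c || d)) || (c && d))
  simp only [sz_prod, sz_cons, sz_nil] at *
  omega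

theorem _root_.XZSubsampling.length_zipPad (d : β) : ∀ (l : List α) (l' : List β),
    (XZSubsampling.zipPad d l l').length = l.length
  | [], _ => rfl
  | a :: l, l' => by simp [XZSubsampling.zipPad, length_zipPad d l]

theorem _root_.XZSubsampling.length_subWord (u v : List Bool) :
    (XZSubsampling.subWord u v).2.length = u.length := by
  rw [XZSubsampling.subWord, foldl_subWord_sz, length_zipPad]
  simp

theorem sz_word_le (u : List Bool) : sz u ≤ u.length * 4 + 1 :=
  sz_list_le u fun b _ => sz_bool_le b

-- Subtraction preserves the length of the word, and the quotient is at most the number of rounds,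
-- which is bounded because `cap` is given in unary.
@[fun_prop]
theorem divWord {cap : γ → ℕ} {u v : γ → List Bool} (hc : PolyTime cap) (hu : PolyTime u)
    (hv : PolyTime v) : PolyTime fun a => XZSubsampling.divWord (cap a) (u a) (v a) := by
  unfold XZSubsampling.divWord
  refine snd.comp (natIterate (f := fun a (s : List Bool × ℕ) =>
    bif (XZSubsampling.subWord s.1 (v a)).1 then s
      else ((XZSubsampling.subWord s.1 (v a)).2, s.2 + 1))
    (u := fun a => (sz (u a) + sz (v a)) * 4 + 1 + sz (cap a) + 1)
    hc (by fun_prop) (by fun_prop) ?_ ?_)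
  · exact ((((hu.1.add hv.1).mul (PolyBdd.const _)).add (PolyBdd.const _)).add hc.1).add
      (PolyBdd.const _)
  · intro a i hi
    have h : ∀ i, ((fun s : List Bool × ℕ =>
        bif (XZSubsampling.subWord s.1 (v a)).1 then s
          else ((XZSubsampling.subWord s.1 (v a)).2, s.2 + 1))^[i]
        (u a ++ (v a).map (fun _ => false), 0)).1.length = (u a).length + (v a).length ∧
        ((fun s : List Bool × ℕ => bif (XZSubsampling.subWord s.1 (v a)).1 then s
          else ((XZSubsampling.subWord s.1 (v a)).2, s.2 + 1))^[i]
        (u a ++ (v a).map (fun _ => false), 0)).2 ≤ i := by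
      intro i
      induction i with
      | zero => simp
      | succ i ih =>
        rw [Function.iterate_succ_apply']
        generalize ((fun s : List Bool × ℕ => bif (XZSubsampling.subWord s.1 (v a)).1 then s
          else ((XZSubsampling.subWord s.1 (v a)).2, s.2 + 1))^[i]
          (u a ++ (v a).map (fun _ => false), 0)) = s at ih ⊢
        cases (XZSubsampling.subWord s.1 (v a)).1
        · simp only [cond_false, length_subWord]
          omega
        · simp only [cond_true]
          omega
    obtain ⟨h1, h2⟩ := h i
    have h3 := sz_word_le ((fun s : List Bool × ℕ => bif (XZSubsampling.subWord s.1 (v a)).1 then s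
          else ((XZSubsampling.subWord s.1 (v a)).2, s.2 + 1))^[i]
          (u a ++ (v a).map (fun _ => false), 0)).1
    have h4 := length_le_sz (u a)
    have h5 := length_le_sz (v a)
    simp only [sz_prod, sz_nat]
    omega

end PolyTime

/-! ### The algorithms -/

theorem two_pow_lg_le (n : ℕ) : 2 ^ lg n ≤ 2 * n + 2 := by
  rw [lg_eq, pow_succ]
  rcases Nat.eq_zero_or_pos n with rfl | h
  · simp
  · have := Nat.pow_log_le_self 2 h.ne'
    omega

/-- The list of all sums of the first word of `r` and some of its next `τ` words, each of
length `q`. -/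
def blockIndices (q τ : ℕ) (r : List Bool) : List (List Bool) :=
  (List.range τ).foldl (fun l j => l ++ l.map fun u => xorWord u ((r.drop ((j + 1) * q)).take q))
    [r.take q]

/-- The letters of one block: for every index the corresponding entry of the table, which is trivial
if there is none, and then the end mark of the block. -/
def blockBits (q τ n : ℕ) (y : List (List Bool)) (r : List Bool) : List Bool :=
  (blockIndices q τ r).flatMap (fun j => (select y j).headD (List.replicate (4 * (n + 1)) false)) ++
    [false, true, false, false]

/-- The letters of all blocks, cut or extended to length `N`. -/
def sampleLetters (q τ K n N : ℕ) (y : List (List Bool)) (r : List Bool) : List (Bool × Bool) :=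
  (pairUp ((List.range K).flatMap fun k => blockBits q τ n y (r.drop (k * ((τ + 1) * q)))) ++
    List.replicate N (false, false)).take N

/-- The letter described by two bits. -/
def toLetter (p : Bool × Bool) : PauliLetter := bif p.1 then .X else bif p.2 then .Z else .I

theorem bits_toLetter (p : Bool × Bool) : (toLetter p).bits = [p.1, p.2 && !p.1] := by
  rcases p with ⟨_ | _, _ | _⟩ <;> rfl

/-- The state of the decision procedure: a parity, the numbers of positive and negative scores
in the current block, and the numbers of accepted and rejected blocks. -/
abbrev DecState : Type := Bool × (ℕ × ℕ) × (ℕ × ℕ)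

/-- Processing of two letters and their outcomes: the first letter tells whether a score is
complete, a block is complete, or the second outcome contributes to the current score (unless its
letter is trivial). -/
def decideStep (s : DecState) (r : ((Bool × Bool) × Bool) × ((Bool × Bool) × Bool)) : DecState :=
  bif r.1.1.1 then
    (false, (bif Bool.xor s.1 r.2.1.1 then (s.2.1.1, s.2.1.2 + 1) else (s.2.1.1 + 1, s.2.1.2)),
      s.2.2)
  else bif r.1.1.2 then
    (false, (0, 0), bif Nat.ble s.2.1.1 s.2.1.2 then (s.2.2.1 + 1, s.2.2.2)
      else (s.2.2.1, s.2.2.2 + 1))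
  else (Bool.xor s.1 (r.2.2 && (r.2.1.1 || r.2.1.2)), s.2)

/-- Acceptance by a majority of the blocks. -/
def decideWord (w a : List Bool) : Bool :=
  let s := (pairUp (zipPad false (pairUp w) a)).foldl decideStep (false, (0, 0), (0, 0))
  Nat.ble s.2.2.2 s.2.2.1

/-- A table entry: the letters of a Pauli string, each marked as contributing to the score, and the
sign of the score. -/
def entryBits (neg : Bool) (w : List Bool) : List Bool :=
  (pairUp w).flatMap (fun p => [false, false, p.1, p.2]) ++ [true, false, neg, false]

/-- The entries for a term whose weight has the given numerator and denominator. -/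
def termEntries (cap sh : ℕ) (neg : Bool) (num den w : List Bool) : List (List Bool) :=
  List.replicate (divWord cap (List.replicate sh false ++ num) den) (entryBits neg w)

/-- The table for a described problem. -/
def entryTable (c n : ℕ) (d : List (List Bool)) : List (List Bool) :=
  termEntries (n ^ (8 * c)) (2 * c * lg n) (!((d.drop 1).headD []).headD false)
      ((d.drop 2).headD []) ((d.drop 3).headD []) (List.replicate (2 * n) false) ++
    (termEntries (n ^ (8 * c)) (2 * c * lg n) (!((d.drop 4).headD []).headD false)
      ((d.drop 5).headD []) ((d.drop 6).headD []) (List.replicate (2 * n) false) ++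
    (pairUp (pairUp (d.drop 7))).flatMap fun g =>
      termEntries (n ^ (8 * c)) (2 * c * lg n + 1) (g.1.1.headD false) g.1.2 g.2.1 g.2.2)

/-- The words of `2 ^ (-k)` and `1 - 2 ^ (-k)`. -/
def thresholdWords (k : ℕ) : List (List Bool) :=
  [[false], [true], List.replicate k false ++ [true],
    [false], List.replicate k true, List.replicate k false ++ [true]]

namespace PolyTime
variable {α β γ δ τ : Type} [Rep α] [Rep β] [Rep γ] [Rep δ] [Rep τ]

@[fun_prop]
theorem range {n : γ → ℕ} (hn : PolyTime n) : PolyTime fun x => List.range (n x) := by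
  have h : ∀ n, (fun l : List ℕ => l ++ [l.length])^[n] [] = List.range n := by
    intro n
    induction n with
    | zero => rfl
    | succ n ih => rw [Function.iterate_succ_apply', ih, List.length_range, List.range_succ]
  simp only [← h]
  refine natIterate (f := fun _ (l : List ℕ) => l ++ [l.length]) (u := fun x =>
    sz (n x) * (sz (n x) + 1) + 1) hn (const _) (by fun_prop)
    ((hn.1.mul (hn.1.add (PolyBdd.const _))).add (PolyBdd.const _)) fun x i hi => ?_
  rw [h]
  refine (sz_list_le (List.range i) (B := sz (n x)) fun a ha => ?_).trans ?_
  · have := List.mem_range.1 ha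
    simp only [sz_nat]
    omega
  · rw [List.length_range]
    refine Nat.add_le_add_right (Nat.mul_le_mul_right _ ?_) _
    rw [sz_nat]
    omega

theorem length_xorWord (u v : List Bool) : (XZSubsampling.xorWord u v).length = u.length := by
  rw [XZSubsampling.xorWord, List.length_map, length_zipPad]

-- The list of indices doubles in every round. Its length `2 ^ τ` is polynomial because the number
-- of rounds is a fixed multiple of `lg` of a unary number.
@[fun_prop]
theorem blockIndices {q n : γ → ℕ} {r : γ → List Bool} (hq : PolyTime q) (e : ℕ) (hn : PolyTime n)
    (hr : PolyTime r) :
    PolyTime fun x => XZSubsampling.blockIndices (q x) (e * XZSubsampling.lg (n x)) (r x) := by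
  unfold XZSubsampling.blockIndices
  refine foldl (f := fun x (l : List (List Bool)) j => l ++ l.map fun u =>
      XZSubsampling.xorWord u (((r x).drop ((j + 1) * q x)).take (q x)))
    (u := fun x => (2 * sz (n x) + 2) ^ e * ((sz (r x) * 4 + 1) + 1) + 1)
    (by fun_prop) (by fun_prop) (by fun_prop) ?_ ?_
  · exact ((((PolyBdd.const 2).mul hn.1).add (PolyBdd.const 2)).pow e).mul
      (((hr.1.mul (PolyBdd.const 4)).add (PolyBdd.const 1)).add (PolyBdd.const 1)) |>.add
      (PolyBdd.const 1)
  · intro x i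
    have key : ∀ (js : List ℕ) (l : List (List Bool)), (∀ u ∈ l, u.length ≤ sz (r x)) →
        (js.foldl (fun l j => l ++ l.map fun u => XZSubsampling.xorWord u
          (((r x).drop ((j + 1) * q x)).take (q x))) l).length = 2 ^ js.length * l.length ∧
        ∀ u ∈ js.foldl (fun l j => l ++ l.map fun u => XZSubsampling.xorWord u
          (((r x).drop ((j + 1) * q x)).take (q x))) l, u.length ≤ sz (r x) := by
      intro js
      induction js with
      | nil => intro l hl; exact ⟨by simp, hl⟩
      | cons j js ih =>
        intro l hl
        rw [List.foldl_cons]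
        have := ih (l ++ l.map fun u => XZSubsampling.xorWord u
          (((r x).drop ((j + 1) * q x)).take (q x))) (fun u hu => by
            rcases List.mem_append.1 hu with hu | hu
            · exact hl u hu
            · obtain ⟨v, hv, rfl⟩ := List.mem_map.1 hu
              rw [length_xorWord]
              exact hl v hv)
        refine ⟨?_, this.2⟩
        rw [this.1, List.length_append, List.length_map, List.length_cons, pow_succ]
        ring
    obtain ⟨h1, h2⟩ := key ((List.range (e * XZSubsampling.lg (n x))).take i) [(r x).take (q x)]
      (fun u hu => by
        rw [List.mem_singleton.1 hu]
        exact (List.length_take_le' _ _).trans (length_le_sz _))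
    refine (sz_list_le _ (B := sz (r x) * 4 + 1) fun u hu => ?_).trans ?_
    · exact (sz_word_le u).trans (Nat.add_le_add_right (Nat.mul_le_mul_right _ (h2 u hu)) _)
    · rw [h1, List.length_singleton, mul_one]
      refine Nat.add_le_add_right (Nat.mul_le_mul_right _ ?_) _
      calc 2 ^ ((List.range (e * XZSubsampling.lg (n x))).take i).length
          ≤ 2 ^ (e * XZSubsampling.lg (n x)) := Nat.pow_le_pow_right two_pos
            ((List.length_take_le' _ _).trans (List.length_range).le)
        _ = (2 ^ XZSubsampling.lg (n x)) ^ e := by rw [mul_comm, pow_mul]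
        _ ≤ (2 * sz (n x) + 2) ^ e := Nat.pow_le_pow_left ((two_pow_lg_le _).trans (by
            rw [sz_nat]; omega)) _

@[fun_prop]
theorem sampleLetters {q n K N : γ → ℕ} {r : γ → List Bool} {y : γ → List (List Bool)}
    (hq : PolyTime q) (e : ℕ) (hn : PolyTime n) (hK : PolyTime K) (hN : PolyTime N)
    (hy : PolyTime y) (hr : PolyTime r) : PolyTime fun x =>
      XZSubsampling.sampleLetters (q x) (e * XZSubsampling.lg (n x)) (K x) (n x) (N x) (y x)
        (r x) := by
  unfold XZSubsampling.sampleLetters XZSubsampling.blockBits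
  fun_prop

theorem foldl_decideStep {r : γ → List (((Bool × Bool) × Bool) × ((Bool × Bool) × Bool))}
    (hr : PolyTime r) {s : γ → DecState} (hs : PolyTime s) :
    PolyTime fun x => (r x).foldl decideStep (s x) := by
  refine foldl_add (f := fun _ => decideStep) (u := fun _ => 20) hr hs ?_ (PolyBdd.const _) ?_
  · unfold decideStep
    fun_prop
  · rintro _ ⟨⟨⟨b₁, b₂⟩, b₃⟩, ⟨⟨b₄, b₅⟩, b₆⟩⟩ _ ⟨p, ⟨i, j⟩, k, l⟩
    have h1 := sz_bool_le (Bool.xor p (b₆ && (b₄ || b₅)))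
    have h2 := sz_bool_le false
    unfold decideStep
    cases b₁ <;> cases b₂ <;> cases h : Bool.xor p b₄ <;> cases h' : Nat.ble i j <;>
      simp only [h, h', cond_true, cond_false, sz_prod, sz_nat] at * <;> omega

@[fun_prop]
theorem decideWord {w a : γ → List Bool} (hw : PolyTime w) (ha : PolyTime a) :
    PolyTime fun x => XZSubsampling.decideWord (w x) (a x) := by
  unfold XZSubsampling.decideWord
  have := foldl_decideStep (r := fun x => XZSubsampling.pairUp
    (XZSubsampling.zipPad false (XZSubsampling.pairUp (w x)) (a x))) (s := fun _ => (false, (0, 0), (0, 0)))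
    (by fun_prop) (const _)
  exact ble (snd.comp (snd.comp (snd.comp this))) (fst.comp (snd.comp (snd.comp this)))

@[fun_prop]
theorem termEntries {cap sh : γ → ℕ} {neg : γ → Bool} {num den w : γ → List Bool}
    (hc : PolyTime cap) (hs : PolyTime sh) (h1 : PolyTime neg) (h2 : PolyTime num)
    (h3 : PolyTime den) (h4 : PolyTime w) : PolyTime fun x =>
      XZSubsampling.termEntries (cap x) (sh x) (neg x) (num x) (den x) (w x) := by
  unfold XZSubsampling.termEntries XZSubsampling.entryBits
  fun_prop

@[fun_prop]
theorem entryTable (c : ℕ) {n : γ → ℕ} {d : γ → List (List Bool)} (hn : PolyTime n)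
    (hd : PolyTime d) : PolyTime fun x => XZSubsampling.entryTable c (n x) (d x) := by
  unfold XZSubsampling.entryTable
  fun_prop

@[fun_prop]
theorem thresholdWords {k : γ → ℕ} (hk : PolyTime k) :
    PolyTime fun x => XZSubsampling.thresholdWords (k x) := by
  unfold XZSubsampling.thresholdWords
  fun_prop

@[fun_prop]
theorem description_toString {d : γ → List (List Bool)} (hd : PolyTime d) :
    PolyTime fun x => Description.toString (d x) := by
  unfold Description.toString
  refine flatMap (α := List Bool) (f := fun _ v => v.map Option.some ++ [none]) hd ?_
  fun_prop

end PolyTime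

/-! ### The reduction, the sampler and the decision procedure -/

/-- The sampled Pauli string. -/
def sampler (c n N : ℕ) (y : Description) {s : ℕ} (r : BitString s) : PauliString N := fun i =>
  toLetter ((sampleLetters (9 * c * lg n) ((18 * c + 3) * lg n) (2 * lg n) n N y
    (List.ofFn r)).getD i (false, false))

/-- The accepted outcomes. -/
def accepting {N : ℕ} (w : PauliString N) : Finset (BitString N) :=
  Finset.univ.filter fun a => decideWord (pauliWord w) (bitWord a) = true

theorem length_sampleLetters (q τ K n N : ℕ) (y : List (List Bool)) (r : List Bool) :
    (sampleLetters q τ K n N y r).length = N := by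
  simp [sampleLetters]

theorem ofFn_getD {α : Type} {N : ℕ} {l : List α} (h : l.length = N) (d : α) :
    List.ofFn (fun i : Fin N => l.getD i d) = l := by
  subst h
  refine List.ext_getElem (by simp) fun i h1 h2 => ?_
  simp [h2]

/-- A description that does not come from the reduction may produce the bits `(true, true)`, which
`toLetter` reads as `X`; the second bit is corrected accordingly. -/
theorem pauliWord_sampler (c n N : ℕ) (y : Description) {s : ℕ} (r : BitString s) :
    pauliWord (sampler c n N y r) =
      (sampleLetters (9 * c * lg n) ((18 * c + 3) * lg n) (2 * lg n) n N y (List.ofFn r)).flatMap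
        fun p => [p.1, p.2 && !p.1] := by
  have h := ofFn_getD (length_sampleLetters (9 * c * lg n) ((18 * c + 3) * lg n) (2 * lg n) n N y
    (List.ofFn r)) (false, false)
  conv_rhs => rw [← h]
  rw [pauliWord, List.flatMap_def, List.flatMap_def, List.map_ofFn, List.map_ofFn]
  congr 2
  funext i
  simp only [Function.comp_apply, sampler, bits_toLetter]

theorem length_unaryWord (n : ℕ) : (unaryWord n).length = n := List.length_replicate

theorem isPolyTime_sampler (c D : ℕ) (s : ℕ → ℕ) :
    IsPolyTime
      (fun i : (n : ℕ) × (BitString (s n) × Description) =>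
        unaryWord i.1 :: bitWord i.2.1 :: i.2.2)
      (fun w : (N : ℕ) × PauliString N => [pauliWord w.2])
      (fun i => ⟨(Polynomial.X ^ D : Polynomial ℕ).eval i.1 * i.1,
        sampler c i.1 _ i.2.2 i.2.1⟩) := by
  let n : List Sym → ℕ := fun x => ((splitWords x).headD []).length
  have hn : PolyTime n := by unfold n; fun_prop
  have hF : PolyTime fun x : List Sym => Description.toString
      [(sampleLetters (9 * c * lg (n x)) ((18 * c + 3) * lg (n x)) (2 * lg (n x)) (n x)
        (n x ^ D * n x) ((splitWords x).drop 2) (((splitWords x).drop 1).headD [])).flatMap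
        fun p => [p.1, p.2 && !p.1]] := by
    fun_prop
  refine isPolyTime_of_polyTime hF fun ⟨m, r, y⟩ => ?_
  simp only [n, splitWords_toString, List.headD_cons, length_unaryWord, List.drop_succ_cons,
    List.drop_zero, pauliWord_sampler, Polynomial.eval_pow, Polynomial.eval_X, bitWord]

/-- The string `w` itself marks the ends of scores and blocks and contains the signs, so neither `n`
nor the description is consulted. -/
theorem isPolyTime_accepting (D : ℕ → ℕ) :
    IsPolyTime
      (fun i : (n : ℕ) × (PauliString (D n) × BitString (D n) × Description) =>
        unaryWord i.1 :: pauliWord i.2.1 :: bitWord i.2.2.1 :: i.2.2.2)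
      (fun b : Bool => [[b]])
      (fun i => decide (i.2.2.1 ∈ accepting i.2.1)) := by
  have hF : PolyTime fun x : List Sym => Description.toString
      [[decideWord (((splitWords x).drop 1).headD []) (((splitWords x).drop 2).headD [])]] := by
    fun_prop
  refine isPolyTime_of_polyTime hF fun ⟨m, w, a, y⟩ => ?_
  simp [splitWords_toString, accepting]

/-! ### Binary encodings of numbers and the running time of the reduction -/

/-- The value of a binary word, lowest digit first. -/
def wordVal : List Bool → ℕ
  | [] => 0
  | b :: l => b.toNat + 2 * wordVal l

theorem wordVal_encodePosNum : ∀ p : PosNum, wordVal (Computability.encodePosNum p) = p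
  | .one => rfl
  | .bit0 p => by
    simp [Computability.encodePosNum, wordVal, wordVal_encodePosNum p, PosNum.cast_bit0]; ring
  | .bit1 p => by
    simp [Computability.encodePosNum, wordVal, wordVal_encodePosNum p, PosNum.cast_bit1]; ring

theorem wordVal_encodeNat (n : ℕ) : wordVal (Computability.encodeNat n) = n := by
  rw [Computability.encodeNat]
  conv_rhs => rw [← Num.to_of_nat n]
  cases (n : Num) with
  | zero => rfl
  | pos p => exact wordVal_encodePosNum p

theorem encodeNat_bit0 {n : ℕ} (hn : n ≠ 0) :
    Computability.encodeNat (2 * n) = false :: Computability.encodeNat n := by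
  have h : ((2 * n : ℕ) : Num) = Num.bit0 n := by
    rw [two_mul, Nat.cast_add, Num.bit0_of_bit0]
  have h0 : (n : Num) ≠ 0 := by exact_mod_cast hn
  rw [Computability.encodeNat, Computability.encodeNat, h]
  cases hp : (n : Num) with
  | zero => exact absurd hp h0
  | pos p => rfl

theorem encodeNat_bit1 (n : ℕ) :
    Computability.encodeNat (2 * n + 1) = true :: Computability.encodeNat n := by
  have h : ((2 * n + 1 : ℕ) : Num) = Num.bit1 n := by
    rw [two_mul, Nat.cast_add, Nat.cast_add, Nat.cast_one, Num.bit1_of_bit1]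
  rw [Computability.encodeNat, Computability.encodeNat, h]
  cases (n : Num) with
  | zero => rfl
  | pos p => rfl

theorem encodeNat_two_pow : ∀ k : ℕ,
    Computability.encodeNat (2 ^ k) = List.replicate k false ++ [true]
  | 0 => rfl
  | k + 1 => by
    rw [pow_succ', encodeNat_bit0 (by positivity), encodeNat_two_pow k]
    rfl

theorem encodeNat_two_pow_sub_one : ∀ k : ℕ,
    Computability.encodeNat (2 ^ k - 1) = List.replicate k true
  | 0 => rfl
  | k + 1 => by
    have : 2 ^ (k + 1) - 1 = 2 * (2 ^ k - 1) + 1 := by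
      have := Nat.one_le_two_pow (n := k)
      rw [pow_succ]
      omega
    rw [this, encodeNat_bit1, encodeNat_two_pow_sub_one k]
    rfl

/-- Both fractions are in lowest terms with denominator `2 ^ k`, because `2 ^ k - 1` and `2 ^ k` are
coprime (also for `k = 0`); hence numerators and denominators can be read off. -/
theorem ratWords_thresholds (k : ℕ) :
    ratWords (1 / 2 ^ k) ++ ratWords (1 - 1 / 2 ^ k) = thresholdWords k := by
  have h1 : (1 / 2 ^ k : ℚ) = Rat.divInt 1 ((2 ^ k : ℕ) : ℤ) := by
    rw [Rat.divInt_eq_div]; push_cast; rfl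
  have h2 : (1 - 1 / 2 ^ k : ℚ) = Rat.divInt ((2 ^ k - 1 : ℕ) : ℤ) ((2 ^ k : ℕ) : ℤ) := by
    rw [Rat.divInt_eq_div, Nat.cast_sub Nat.one_le_two_pow]; push_cast
    rw [sub_div, div_self (by positivity)]
  have hc : Nat.Coprime (2 ^ k - 1) (2 ^ k) := by
    exact (Nat.coprime_self_sub_left Nat.one_le_two_pow).2 (Nat.coprime_one_left _)
  have n1 : (1 / 2 ^ k : ℚ).num = 1 := by
    rw [h1, ← Rat.mk_eq_divInt (nz := by positivity) (c := by simp)]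
  have d1 : (1 / 2 ^ k : ℚ).den = 2 ^ k := by
    rw [h1, ← Rat.mk_eq_divInt (nz := by positivity) (c := by simp)]
  have n2 : (1 - 1 / 2 ^ k : ℚ).num = (2 ^ k - 1 : ℕ) := by
    rw [h2, ← Rat.mk_eq_divInt (nz := by positivity) (c := by rw [Int.natAbs_natCast]; exact hc)]
  have d2 : (1 - 1 / 2 ^ k : ℚ).den = 2 ^ k := by
    rw [h2, ← Rat.mk_eq_divInt (nz := by positivity) (c := by rw [Int.natAbs_natCast]; exact hc)]
  have e1 : Computability.encodeNat 1 = [true] := encodeNat_two_pow 0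
  rw [ratWords, ratWords, n1, d1, n2, d2, Int.natAbs_natCast, encodeNat_two_pow,
    encodeNat_two_pow_sub_one, Int.natAbs_one, e1, thresholdWords]
  simpa using (one_le_pow₀ one_le_two : (1 : ℤ) ≤ 2 ^ k)

theorem isPolyTime_reduction (c : ℕ) :
    IsPolyTime
      (fun P : (n : ℕ) × XZProblem n => P.2.describe)
      (fun o : ℚ × ℚ × Description => ratWords o.1 ++ ratWords o.2.1 ++ o.2.2)
      (fun P => (1 / 2 ^ (Nat.log 2 P.1 * Nat.log 2 P.1),
        1 - 1 / 2 ^ (Nat.log 2 P.1 * Nat.log 2 P.1), entryTable c P.1 P.2.describe)) := by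
  let n : List Sym → ℕ := fun x => ((splitWords x).headD []).length
  have hn : PolyTime n := by unfold n; fun_prop
  have hF : PolyTime fun x : List Sym => Description.toString
      (thresholdWords ((lg (n x) - 1) * (lg (n x) - 1)) ++ entryTable c (n x) (splitWords x)) := by
    fun_prop
  refine isPolyTime_of_polyTime hF fun ⟨m, P⟩ => ?_
  have h : ((P.describe).headD []).length = m := length_unaryWord m
  simp only [n, splitWords_toString, h, ratWords_thresholds, lg_eq, Nat.add_sub_cancel]


/-! ### Quadratic forms of operators -/

section QuadForm
open Matrix
variable {ι : Type*} [Fintype ι]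

/-- The quadratic form `⟨v, A v⟩` (its real part) as a function of the operator. -/
def quadForm (v : ι → ℂ) : Matrix ι ι ℂ →ₗ[ℝ] ℝ where
  toFun A := (star v ⬝ᵥ A *ᵥ v).re
  map_add' A B := by simp [add_mulVec, dotProduct_add]
  map_smul' c A := by simp [smul_mulVec, dotProduct_smul]

theorem quadForm_apply (v : ι → ℂ) (A : Matrix ι ι ℂ) :
    quadForm v A = (star v ⬝ᵥ A *ᵥ v).re := rfl

theorem quadForm_ofReal_smul (v : ι → ℂ) (c : ℝ) (A : Matrix ι ι ℂ) :
    quadForm v ((c : ℂ) • A) = c * quadForm v A := by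
  rw [← smul_eq_mul, ← map_smul]
  congr 1

variable [DecidableEq ι]

theorem quadForm_one (v : ι → ℂ) : quadForm v 1 = ∑ i, Complex.normSq (v i) := by
  simp [quadForm_apply, dotProduct, Complex.normSq_apply]

theorem quadForm_one_nonneg (v : ι → ℂ) : 0 ≤ quadForm v 1 := by
  rw [quadForm_one]
  exact Finset.sum_nonneg fun i _ => Complex.normSq_nonneg _

theorem quadForm_one_pos {v : ι → ℂ} (hv : v ≠ 0) : 0 < quadForm v 1 := by
  obtain ⟨i, hi⟩ := Function.ne_iff.1 hv
  rw [quadForm_one]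
  exact Finset.sum_pos' (fun i _ => Complex.normSq_nonneg _)
    ⟨i, Finset.mem_univ i, Complex.normSq_pos.2 hi⟩

theorem quadForm_conjTranspose_mul (v : ι → ℂ) (B A : Matrix ι ι ℂ) :
    quadForm v (Bᴴ * A) = (star (B *ᵥ v) ⬝ᵥ A *ᵥ v).re := by
  rw [quadForm_apply, ← mulVec_mulVec, dotProduct_mulVec, star_mulVec]

theorem quadForm_conjTranspose_mul_self (v : ι → ℂ) (B : Matrix ι ι ℂ) :
    quadForm v (Bᴴ * B) = quadForm (B *ᵥ v) 1 := by
  rw [quadForm_conjTranspose_mul, quadForm_apply, one_mulVec]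

theorem quadForm_mul_self_nonneg (v : ι → ℂ) {B : Matrix ι ι ℂ} (hB : B.IsHermitian) :
    0 ≤ quadForm v (B * B) := by
  have h := quadForm_conjTranspose_mul_self v B
  rw [hB.eq] at h
  exact h ▸ quadForm_one_nonneg _

theorem quadForm_mul_of_eigenvector {A : Matrix ι ι ℂ} {v : ι → ℂ} {a : ℝ}
    (h : A *ᵥ v = (a : ℂ) • v) (B : Matrix ι ι ℂ) : quadForm v (B * A) = a * quadForm v B := by
  rw [quadForm_apply, ← mulVec_mulVec, h, mulVec_smul, dotProduct_smul, quadForm_apply, smul_eq_mul,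
    Complex.re_ofReal_mul]

theorem quadForm_eigenvector_mul {A : Matrix ι ι ℂ} (hA : A.IsHermitian) {v : ι → ℂ} {a : ℝ}
    (h : A *ᵥ v = (a : ℂ) • v) (B : Matrix ι ι ℂ) : quadForm v (A * B) = a * quadForm v B := by
  have h1 := quadForm_conjTranspose_mul v A B
  rw [hA.eq, h] at h1
  rw [h1, star_smul, smul_dotProduct, quadForm_apply, smul_eq_mul, Complex.star_def,
    Complex.conj_ofReal, Complex.re_ofReal_mul]

theorem quadForm_of_eigenvector {A : Matrix ι ι ℂ} {v : ι → ℂ} {a : ℝ}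
    (h : A *ᵥ v = (a : ℂ) • v) : quadForm v A = a * quadForm v 1 := by
  simpa using quadForm_mul_of_eigenvector h 1

open scoped ComplexOrder in
theorem quadForm_nonneg_of_posSemidef {A : Matrix ι ι ℂ} (hA : A.PosSemidef) (v : ι → ℂ) :
    0 ≤ quadForm v A := by
  have := hA.dotProduct_mulVec_nonneg v
  exact (Complex.le_def.1 this).1

open scoped ComplexOrder in
theorem posSemidef_of_eigenvectors {A : Matrix ι ι ℂ} (hA : A.IsHermitian)
    (h : ∀ (v : ι → ℂ) (a : ℝ), v ≠ 0 → A *ᵥ v = (a : ℂ) • v → 0 ≤ a) : A.PosSemidef := by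
  rw [hA.posSemidef_iff_eigenvalues_nonneg]
  intro j
  refine h (hA.eigenvectorBasis j) _ ?_ (by
    rw [hA.mulVec_eigenvectorBasis]
    ext i
    simp)
  intro h0
  apply hA.eigenvectorBasis.toBasis.ne_zero j
  ext i
  simpa using congr_fun h0 i

theorem isHermitian_sub_smul_one {A : Matrix ι ι ℂ} (hA : A.IsHermitian) (c : ℝ) :
    (A - (c : ℂ) • 1).IsHermitian := by
  refine hA.sub ?_
  rw [Matrix.IsHermitian, conjTranspose_smul, conjTranspose_one, Complex.star_def,
    Complex.conj_ofReal]

open scoped ComplexOrder in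
theorem posSemidef_sub_of_eigenvectors {A : Matrix ι ι ℂ} (hA : A.IsHermitian) {c : ℝ}
    (h : ∀ (v : ι → ℂ) (a : ℝ), v ≠ 0 → A *ᵥ v = (a : ℂ) • v → c ≤ a) :
    (A - (c : ℂ) • 1).PosSemidef := by
  refine posSemidef_of_eigenvectors (isHermitian_sub_smul_one hA c) fun v a hv hav => ?_
  have := h v (a + c) hv (by
    rw [sub_mulVec, smul_mulVec, one_mulVec, sub_eq_iff_eq_add] at hav
    rw [hav, ← add_smul, Complex.ofReal_add])
  linarith

theorem le_quadForm_of_eigenvectors {A : Matrix ι ι ℂ} (hA : A.IsHermitian) {c : ℝ}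
    (h : ∀ (v : ι → ℂ) (a : ℝ), v ≠ 0 → A *ᵥ v = (a : ℂ) • v → c ≤ a) (v : ι → ℂ) :
    c * quadForm v 1 ≤ quadForm v A := by
  have := quadForm_nonneg_of_posSemidef (posSemidef_sub_of_eigenvectors hA h) v
  rw [map_sub, quadForm_ofReal_smul] at this
  linarith

theorem quadForm_le_of_eigenvectors {A : Matrix ι ι ℂ} (hA : A.IsHermitian) {c : ℝ}
    (h : ∀ (v : ι → ℂ) (a : ℝ), v ≠ 0 → A *ᵥ v = (a : ℂ) • v → a ≤ c) (v : ι → ℂ) :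
    quadForm v A ≤ c * quadForm v 1 := by
  have := le_quadForm_of_eigenvectors hA.neg (c := -c) (fun v a hv hav => by
    have := h v (-a) hv (by
      rw [neg_mulVec, neg_eq_iff_eq_neg] at hav
      rw [hav, Complex.ofReal_neg, neg_smul])
    linarith) v
  rw [map_neg] at this
  linarith

-- Such a factorization survives multiplicative maps that respect adjoints; it carries positivity
-- over to a larger set of qubits in `liftOp_quadForm`.
open scoped ComplexOrder MatrixOrder in
theorem exists_eq_conjTranspose_mul_self {A : Matrix ι ι ℂ} (hA : A.PosSemidef) :
    ∃ B : Matrix ι ι ℂ, A = Bᴴ * B :=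
  CStarAlgebra.nonneg_iff_eq_star_mul_self.mp hA.nonneg

/-! ### The lowest eigenvalue -/

theorem mem_spectrum_real_iff {A : Matrix ι ι ℂ} {a : ℝ} :
    a ∈ spectrum ℝ A ↔ ∃ v : ι → ℂ, v ≠ 0 ∧ A *ᵥ v = (a : ℂ) • v := by
  rw [← spectrum.algebraMap_mem_iff ℂ, ← Matrix.spectrum_toLin', ← Module.End.hasEigenvalue_iff_mem_spectrum]
  constructor
  · intro h
    obtain ⟨v, hv⟩ := h.exists_hasEigenvector
    exact ⟨v, hv.2, by simpa using hv.apply_eq_smul⟩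
  · rintro ⟨v, hv, h⟩
    exact Module.End.hasEigenvalue_of_hasEigenvector (x := v)
      ⟨Module.End.mem_eigenspace_iff.2 (by simpa using h), hv⟩

variable [Nonempty ι]

theorem exists_groundState {A : Matrix ι ι ℂ} (hA : A.IsHermitian) :
    ∃ v : ι → ℂ, v ≠ 0 ∧ A *ᵥ v = ((sInf (spectrum ℝ A) : ℝ) : ℂ) • v := by
  rw [← mem_spectrum_real_iff]
  refine Set.Nonempty.csInf_mem ?_ A.finite_real_spectrum
  rw [hA.spectrum_real_eq_range_eigenvalues]
  exact Set.range_nonempty _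

theorem sInf_spectrum_mul_le_quadForm {A : Matrix ι ι ℂ} (hA : A.IsHermitian) (v : ι → ℂ) :
    sInf (spectrum ℝ A) * quadForm v 1 ≤ quadForm v A :=
  le_quadForm_of_eigenvectors hA (fun v a hv h =>
    csInf_le A.finite_real_spectrum.bddBelow (mem_spectrum_real_iff.2 ⟨v, hv, h⟩)) v

theorem sInf_spectrum_le {A : Matrix ι ι ℂ} (hA : A.IsHermitian) {v : ι → ℂ} (hv : v ≠ 0) {c : ℝ}
    (h : quadForm v A ≤ c * quadForm v 1) : sInf (spectrum ℝ A) ≤ c :=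
  le_of_mul_le_mul_right ((sInf_spectrum_mul_le_quadForm hA v).trans h) (quadForm_one_pos hv)

theorem le_sInf_spectrum {A : Matrix ι ι ℂ} (hA : A.IsHermitian) {c : ℝ}
    (h : ∀ v, c * quadForm v 1 ≤ quadForm v A) : c ≤ sInf (spectrum ℝ A) := by
  obtain ⟨v, hv, hav⟩ := exists_groundState hA
  have := h v
  rw [quadForm_of_eigenvector hav] at this
  exact le_of_mul_le_mul_right this (quadForm_one_pos hv)

end QuadForm


/-! ### Tensor products and measurements of Pauli strings -/

section Tensor
open Matrix
variable {N : ℕ}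

theorem tensor_mul (A B : Fin N → Matrix Bool Bool ℂ) :
    tensor A * tensor B = tensor fun i => A i * B i := by
  ext x z
  simp only [tensor, mul_apply, of_apply, ← Finset.prod_mul_distrib]
  rw [Finset.prod_univ_sum, Fintype.piFinset_univ]

theorem tensor_one : tensor (fun _ : Fin N => (1 : Matrix Bool Bool ℂ)) = 1 := by
  ext x y
  simp only [tensor, of_apply, one_apply, Finset.prod_ite_zero, Finset.prod_const_one,
    Finset.mem_univ, true_imp_iff, funext_iff]

theorem tensor_eq_zero {A : Fin N → Matrix Bool Bool ℂ} (i : Fin N) (h : A i = 0) :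
    tensor A = 0 := by
  ext x y
  exact Finset.prod_eq_zero (Finset.mem_univ i) (by simp [h])

/-- Distributivity of the product over qubits. It gives both the completeness of the projections of
a measurement and the identification of products of outcomes with Pauli operators. -/
theorem sum_smul_tensor (f : Fin N → Bool → ℂ) (A : Fin N → Bool → Matrix Bool Bool ℂ) :
    ∑ a : BitString N, (∏ i, f i (a i)) • tensor (fun i => A i (a i)) =
      tensor fun i => ∑ b, f i b • A i b := by
  ext x y
  simp only [tensor, Matrix.sum_apply, Matrix.smul_apply, of_apply, smul_eq_mul,
    ← Finset.prod_mul_distrib]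
  rw [Finset.prod_univ_sum, Fintype.piFinset_univ]

theorem PauliLetter.mat_mul_self (p : PauliLetter) : p.mat * p.mat = 1 := by
  ext x y
  cases p <;> cases x <;> cases y <;> simp [PauliLetter.mat, mul_apply]

/-- `(𝟙 + (-1)^b σ_p) / 2`. -/
noncomputable def letterProj (p : PauliLetter) (b : Bool) : Matrix Bool Bool ℂ :=
  (1 / 2 : ℂ) • (1 + ((-1 : ℂ) ^ b.toNat) • p.mat)

theorem letterProj_mul (p : PauliLetter) (b c : Bool) :
    letterProj p b * letterProj p c = if b = c then letterProj p b else 0 := by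
  have h := p.mat_mul_self
  have key : letterProj p b * letterProj p c = (1 / 4 : ℂ) •
      ((1 + (-1 : ℂ) ^ b.toNat * (-1 : ℂ) ^ c.toNat) • (1 : Matrix Bool Bool ℂ) +
        ((-1 : ℂ) ^ b.toNat + (-1 : ℂ) ^ c.toNat) • p.mat) := by
    simp only [letterProj, smul_mul_assoc, mul_smul_comm, add_mul, mul_add, one_mul, mul_one, h]
    module
  rw [key, letterProj]
  cases b <;> cases c <;> simp <;> module

theorem pauliProj_eq (w : PauliString N) (u : BitString N) :
    pauliProj w u = tensor fun i => letterProj (w i) (u i) := rfl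

theorem pauliProj_mul (w : PauliString N) (a b : BitString N) :
    pauliProj w a * pauliProj w b = if a = b then pauliProj w a else 0 := by
  rw [pauliProj_eq, pauliProj_eq, tensor_mul]
  simp only [letterProj_mul]
  split_ifs with h
  · simp [h]
  · obtain ⟨i, hi⟩ := Function.ne_iff.1 h
    exact tensor_eq_zero i (if_neg hi)

/-- The observable with value `f a` on the outcome `a` of the measurement of `w`. -/
noncomputable def measOp (w : PauliString N) : (BitString N → ℂ) →ₐ[ℂ] QubitOp N :=
  AlgHom.ofLinearMap
    { toFun := fun f => ∑ a, f a • pauliProj w a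
      map_add' := fun f g => by simp [add_smul, Finset.sum_add_distrib]
      map_smul' := fun c f => by simp [Finset.smul_sum, mul_smul] }
    (by
      have h := sum_smul_tensor (fun _ _ => (1 : ℂ)) (fun i => letterProj (w i))
      have h1 : ∀ p, ∑ b, (1 : ℂ) • letterProj p b = 1 := fun p => by
        simp only [Fintype.sum_bool, letterProj, Bool.toNat_true, Bool.toNat_false]
        module
      simp only [h1, tensor_one, Finset.prod_const_one] at h
      exact h)
    (by
      intro f g
      simp only [LinearMap.coe_mk, AddHom.coe_mk, Finset.sum_mul_sum, smul_mul_smul_comm,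
        pauliProj_mul, smul_ite, smul_zero, Finset.sum_ite_eq, Finset.mem_univ, if_true,
        Pi.mul_apply])

theorem measOp_apply (w : PauliString N) (f : BitString N → ℂ) :
    measOp w f = ∑ a, f a • pauliProj w a := rfl

theorem measOp_conjTranspose (w : PauliString N) (f : BitString N → ℂ) :
    (measOp w f)ᴴ = measOp w (star f) := by
  simp only [measOp_apply, conjTranspose_sum, conjTranspose_smul, (pauliProj_isHermitian w _).eq,
    Pi.star_apply]

theorem measOp_isHermitian (w : PauliString N) (f : BitString N → ℝ) :
    (measOp w fun a => (f a : ℂ)).IsHermitian := by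
  rw [Matrix.IsHermitian, measOp_conjTranspose]
  congr 1
  funext a
  exact Complex.conj_ofReal _

/-- As `measOp w` is multiplicative, the square root of `f` provides a Hermitian square root of the
observable. -/
theorem quadForm_measOp_nonneg (w : PauliString N) {f : BitString N → ℝ} (hf : ∀ a, 0 ≤ f a)
    (v : BitString N → ℂ) : 0 ≤ quadForm v (measOp w fun a => (f a : ℂ)) := by
  have h : (fun a => (f a : ℂ)) = (fun a => ((√(f a) : ℝ) : ℂ)) * fun a => ((√(f a) : ℝ) : ℂ) := by
    funext a
    rw [Pi.mul_apply, ← Complex.ofReal_mul, Real.mul_self_sqrt (hf a)]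
  rw [h, map_mul]
  exact quadForm_mul_self_nonneg v (measOp_isHermitian w _)

theorem quadForm_measOp_mono (w : PauliString N) {f g : BitString N → ℝ} (hf : ∀ a, f a ≤ g a)
    (v : BitString N → ℂ) :
    quadForm v (measOp w fun a => (f a : ℂ)) ≤ quadForm v (measOp w fun a => (g a : ℂ)) := by
  have h := quadForm_measOp_nonneg w (f := fun a => g a - f a) (fun a => sub_nonneg.2 (hf a)) v
  have e : (fun a => ((g a - f a : ℝ) : ℂ)) = (fun a => (g a : ℂ)) - fun a => (f a : ℂ) := by
    funext a
    simp
  rw [e, map_sub, map_sub] at h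
  linarith

/-- The product of the outcomes at the positions where `u` is not trivial. -/
def scoreSign (u : PauliString N) (a : BitString N) : ℤ :=
  ∏ i, if u i = .I then 1 else (-1) ^ (a i).toNat

/-- On a qubit in the support of `u` the two projections are combined to the Pauli matrix; elsewhere
they add up to the identity, whatever letter is measured there. One string `w` therefore measures
all entries placed on it at once. -/
theorem measOp_scoreSign {w u : PauliString N} (h : ∀ i, u i ≠ .I → w i = u i) :
    measOp w (fun a => (scoreSign u a : ℂ)) = pauliOp u := by
  have h1 := sum_smul_tensor (fun i b => if u i = .I then (1 : ℂ) else (-1) ^ b.toNat)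
    (fun i => letterProj (w i))
  have h2 : ∀ i, ∑ b, (if u i = .I then (1 : ℂ) else (-1) ^ b.toNat) • letterProj (w i) b =
      (u i).mat := fun i => by
    simp only [Fintype.sum_bool, letterProj, Bool.toNat_true, Bool.toNat_false]
    split_ifs with hi
    · rw [hi, PauliLetter.mat]
      module
    · rw [h i hi]
      module
  simp only [h2] at h1
  rw [pauliOp, ← h1, measOp_apply]
  refine Finset.sum_congr rfl fun a _ => ?_
  congr 1
  simp only [scoreSign]
  push_cast
  refine Finset.prod_congr rfl fun i _ => ?_
  split_ifs <;> simp

theorem pauliOp_mul_self (w : PauliString N) : pauliOp w * pauliOp w = 1 := by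
  rw [pauliOp, tensor_mul]
  simp only [PauliLetter.mat_mul_self, tensor_one]

theorem pauliOp_commute {u w : PauliString N} (h : ∀ i, u i = .I ∨ w i = .I) :
    Commute (pauliOp u) (pauliOp w) := by
  rw [Commute, SemiconjBy, pauliOp, pauliOp, tensor_mul, tensor_mul]
  congr 1
  funext i
  rcases h i with hi | hi <;> simp [hi, PauliLetter.mat]

end Tensor

/-! ### Operators on a subset of the qubits -/

section Lift
open Matrix
variable {n N : ℕ}

/-- The operator `A` acting on the qubits in the range of `ι`. -/
noncomputable def liftOp (ι : Fin n → Fin N) (A : QubitOp n) : QubitOp N :=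
  open scoped Classical in
  Matrix.of fun x y => if ∀ i, i ∉ Set.range ι → x i = y i then A (x ∘ ι) (y ∘ ι) else 0

/-- In row `x` only the strings that agree with `x` outside the range of `ι` matter, and these are
the extensions by `x` of strings on the range. -/
theorem liftOp_mulVec {ι : Fin n → Fin N} (hι : Function.Injective ι) (A : QubitOp n)
    (v : BitString N → ℂ) (x : BitString N) :
    (liftOp ι A *ᵥ v) x = ∑ u, A (x ∘ ι) u * v (Function.extend ι u x) := by
  classical
  simp only [mulVec, dotProduct, liftOp, of_apply, ite_mul, zero_mul]
  rw [← Finset.sum_filter]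
  symm
  refine Finset.sum_bij' (fun u _ => Function.extend ι u x) (fun y _ => y ∘ ι) ?_ ?_ ?_ ?_ ?_
  · intro u _
    simp only [Finset.mem_filter, Finset.mem_univ, true_and]
    intro i hi
    rw [Function.extend_apply' _ _ _ (by simpa using hi)]
  · simp
  · intro u _
    exact Function.extend_comp hι _ _
  · intro y hy
    simp only [Finset.mem_filter, Finset.mem_univ, true_and] at hy
    funext i
    by_cases hi : i ∈ Set.range ι
    · obtain ⟨j, rfl⟩ := hi
      rw [hι.extend_apply, Function.comp_apply]
    · rw [Function.extend_apply' _ _ _ (by simpa using hi), hy i hi]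
  · intro u _
    rw [Function.extend_comp hι]

theorem liftOp_mul {ι : Fin n → Fin N} (hι : Function.Injective ι) (A B : QubitOp n) :
    liftOp ι (A * B) = liftOp ι A * liftOp ι B := by
  refine Matrix.toLin'.injective (LinearMap.ext fun v => ?_)
  rw [Matrix.toLin'_apply, Matrix.toLin'_apply, ← mulVec_mulVec]
  funext x
  have key : ∀ u u' : BitString n,
      Function.extend ι u' (Function.extend ι u x) = Function.extend ι u' x := by
    intro u u'
    funext i
    by_cases hi : ∃ j, ι j = i
    · obtain ⟨j, rfl⟩ := hi
      rw [hι.extend_apply, hι.extend_apply]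
    · rw [Function.extend_apply' _ _ _ hi, Function.extend_apply' _ _ _ hi,
        Function.extend_apply' _ _ _ hi]
  simp only [liftOp_mulVec hι, Function.extend_comp hι, key, mul_apply, Finset.sum_mul,
    Finset.mul_sum]
  rw [Finset.sum_comm]
  simp only [mul_assoc]

theorem liftOp_conjTranspose (ι : Fin n → Fin N) (A : QubitOp n) :
    liftOp ι Aᴴ = (liftOp ι A)ᴴ := by
  classical
  ext x y
  simp only [liftOp, of_apply, conjTranspose_apply]
  rw [apply_ite star, star_zero]
  simp only [eq_comm]

theorem liftOp_add (ι : Fin n → Fin N) (A B : QubitOp n) :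
    liftOp ι (A + B) = liftOp ι A + liftOp ι B := by
  ext x y
  simp only [liftOp, of_apply, Matrix.add_apply]
  split_ifs
  · rfl
  · exact (add_zero 0).symm

theorem liftOp_smul (ι : Fin n → Fin N) (c : ℂ) (A : QubitOp n) :
    liftOp ι (c • A) = c • liftOp ι A := by
  ext x y
  simp [liftOp]

theorem liftOp_sum {κ : Type*} (s : Finset κ) (ι : Fin n → Fin N) (A : κ → QubitOp n) :
    liftOp ι (∑ i ∈ s, A i) = ∑ i ∈ s, liftOp ι (A i) :=
  map_sum (AddMonoidHom.mk' (liftOp ι) (liftOp_add ι)) A s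

theorem liftOp_pauliOp {ι : Fin n → Fin N} (hι : Function.Injective ι) (u : PauliString n) :
    liftOp ι (pauliOp u) = pauliOp (Function.extend ι u fun _ => .I) := by
  classical
  ext x y
  simp only [liftOp, of_apply, pauliOp, tensor]
  rw [← Finset.prod_mul_prod_compl (Finset.univ.image ι), Finset.prod_image hι.injOn]
  simp only [hι.extend_apply, Function.comp_apply]
  split_ifs with h
  · refine (mul_one _).symm.trans (congrArg _ (Finset.prod_eq_one fun i hi => ?_).symm)
    have hi : i ∉ Set.range ι := by simpa using hi
    rw [Function.extend_apply' _ _ _ (by simpa using hi), h i hi]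
    simp [PauliLetter.mat]
  · push Not at h
    obtain ⟨i, hi, hne⟩ := h
    rw [Finset.prod_eq_zero (i := i), mul_zero]
    · simpa using hi
    · rw [Function.extend_apply' _ _ _ (by simpa using hi)]
      simp [PauliLetter.mat, hne]

theorem liftOp_one {ι : Fin n → Fin N} (hι : Function.Injective ι) : liftOp ι 1 = 1 := by
  have h := liftOp_pauliOp hι fun _ => .I
  have h1 : ∀ {m : ℕ}, pauliOp (fun _ : Fin m => PauliLetter.I) = 1 := tensor_one
  rwa [h1, Function.extend_const, h1] at h

/-- If `A - c` is `Bᴴ * B`, then the lift of `A` minus `c` is the corresponding square of the lift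
of `B`. The vector `v` may be entangled with the other qubits, which is essential for soundness. -/
theorem liftOp_quadForm {ι : Fin n → Fin N} (hι : Function.Injective ι) {A : QubitOp n}
    (hA : A.IsHermitian) {c : ℝ} (h : ∀ v, c * quadForm v 1 ≤ quadForm v A)
    (v : BitString N → ℂ) : c * quadForm v 1 ≤ quadForm v (liftOp ι A) := by
  obtain ⟨B, hB⟩ := exists_eq_conjTranspose_mul_self (posSemidef_sub_of_eigenvectors hA (c := c)
    fun v a hv hav => by
      have := h v
      rw [quadForm_of_eigenvector hav] at this
      exact le_of_mul_le_mul_right this (quadForm_one_pos hv))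
  have e : A = Bᴴ * B + (c : ℂ) • 1 := by rw [← hB, sub_add_cancel]
  rw [e, liftOp_add, liftOp_mul hι, liftOp_conjTranspose, liftOp_smul, liftOp_one hι, map_add,
    quadForm_conjTranspose_mul_self, quadForm_ofReal_smul]
  linarith [quadForm_one_nonneg (liftOp ι B *ᵥ v)]

/-- The tensor product of copies of the state `ψ` on disjoint sets of qubits. -/
def productState {κ : Type*} [Fintype κ] (ι : κ → Fin n → Fin N) (ψ : BitString n → ℂ)
    (x : BitString N) : ℂ := ∏ k, ψ (x ∘ ι k)

/-- The registers are disjoint, so changing the bits of register `k` changes only the factor number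
`k`. -/
theorem liftOp_productState {κ : Type*} [Fintype κ] {ι : κ → Fin n → Fin N}
    (hι : Function.Injective fun p : κ × Fin n => ι p.1 p.2) {A : QubitOp n} {ψ : BitString n → ℂ}
    {a : ℂ} (h : A *ᵥ ψ = a • ψ) (k : κ) :
    liftOp (ι k) A *ᵥ productState ι ψ = a • productState ι ψ := by
  classical
  have hk : Function.Injective (ι k) := fun l l' hl =>
    (Prod.mk.inj (hι (a₁ := (k, l)) (a₂ := (k, l')) hl)).2
  funext x
  rw [liftOp_mulVec hk, Pi.smul_apply]
  have h1 : ∀ u, productState ι ψ (Function.extend (ι k) u x) =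
      ψ u * ∏ k' ∈ Finset.univ.erase k, ψ (x ∘ ι k') := by
    intro u
    rw [productState, ← Finset.mul_prod_erase _ _ (Finset.mem_univ k), Function.extend_comp hk]
    congr 1
    refine Finset.prod_congr rfl fun k' hk' => ?_
    congr 1
    funext l
    rw [Function.comp_apply, Function.extend_apply', Function.comp_apply]
    rintro ⟨l', hl'⟩
    exact (Finset.mem_erase.1 hk').1 (Prod.mk.inj (hι (a₁ := (k, l')) (a₂ := (k', l)) hl')).1.symm
  have h2 := congr_fun h (x ∘ ι k)
  simp only [mulVec, dotProduct, Pi.smul_apply] at h2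
  simp only [h1, ← mul_assoc, ← Finset.sum_mul]
  rw [h2, productState, ← Finset.mul_prod_erase _ _ (Finset.mem_univ k), smul_eq_mul, smul_eq_mul,
    mul_assoc]

theorem productState_ne_zero {κ : Type*} [Fintype κ] {ι : κ → Fin n → Fin N}
    (hι : Function.Injective fun p : κ × Fin n => ι p.1 p.2) {ψ : BitString n → ℂ} (h : ψ ≠ 0) :
    productState ι ψ ≠ 0 := by
  obtain ⟨u, hu⟩ := Function.ne_iff.1 h
  refine Function.ne_iff.2 ⟨Function.extend (fun p : κ × Fin n => ι p.1 p.2) (fun p => u p.2)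
    fun _ => false, ?_⟩
  refine Finset.prod_ne_zero_iff.2 fun k _ => ?_
  rw [Pi.zero_apply] at hu
  convert hu using 2
  funext l
  exact hι.extend_apply (fun p => u p.2) (fun _ => false) (k, l)

end Lift


/-! ### Pairwise independent indices -/

section SeedIndex
variable {E : Type*} [AddCommGroup E] {τ : ℕ}

/-- The index number `p` generated by the seed `ρ`. -/
def seedIndex (ρ : Fin (τ + 1) → E) (p : Fin (2 ^ τ)) : E :=
  ρ 0 + ∑ l : Fin τ, if Nat.testBit p l then ρ l.succ else 0

theorem seedIndex_add_single_zero [DecidableEq E] (ρ : Fin (τ + 1) → E) (e : E)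
    (p : Fin (2 ^ τ)) : seedIndex (ρ + Pi.single 0 e) p = seedIndex ρ p + e := by
  simp [seedIndex, Fin.succ_ne_zero, add_right_comm]

theorem seedIndex_add_single_succ [DecidableEq E] (ρ : Fin (τ + 1) → E) (l : Fin τ) (e : E)
    (p : Fin (2 ^ τ)) : seedIndex (ρ + Pi.single l.succ e) p =
      seedIndex ρ p + if Nat.testBit p l then e else 0 := by
  simp only [seedIndex, Pi.add_apply, Pi.single_apply, (Fin.succ_ne_zero l).symm, if_false,
    add_zero, Fin.succ_inj, add_assoc]
  congr 1
  have h : (if Nat.testBit p l then e else 0) =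
      ∑ x : Fin τ, if x = l then (if Nat.testBit p x then e else 0) else 0 := by simp
  rw [h, ← Finset.sum_add_distrib]
  refine Finset.sum_congr rfl fun x _ => ?_
  split_ifs <;> simp

theorem exists_testBit_ne {p p' : Fin (2 ^ τ)} (h : p ≠ p') :
    ∃ l : Fin τ, Nat.testBit p l ≠ Nat.testBit p' l := by
  by_contra! hl
  refine h (Fin.ext (Nat.eq_of_testBit_eq fun i => ?_))
  by_cases hi : i < τ
  · exact hl ⟨i, hi⟩
  · have : ∀ q : Fin (2 ^ τ), Nat.testBit q i = false := fun q =>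
      Nat.testBit_lt_two_pow (q.2.trans_le (Nat.pow_le_pow_right two_pos (not_lt.1 hi)))
    rw [this, this]

variable [Fintype E] {A : Type*} [Ring A] [Algebra ℂ A]

/-- A sum over all seeds is invariant under translation of one coordinate, hence equal to its
average over these translations. -/
theorem card_smul_sum_seed [DecidableEq E] (F : (Fin (τ + 1) → E) → A) (i : Fin (τ + 1)) :
    (Fintype.card E : ℂ) • ∑ ρ, F ρ =
      ∑ ρ, ∑ e : E, F (ρ + (Pi.single i e : Fin (τ + 1) → E)) := by
  rw [Finset.sum_comm]
  have : ∀ e : E, ∑ ρ, F (ρ + (Pi.single i e : Fin (τ + 1) → E)) = ∑ ρ, F ρ := fun e =>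
    Equiv.sum_comp (Equiv.addRight (Pi.single i e : Fin (τ + 1) → E)) F
  simp [this, Nat.cast_smul_eq_nsmul]

/-- Translating the coordinate `0` of the seed translates every index, so each single index is
uniform. -/
theorem sum_seedIndex (f : E → A) (p : Fin (2 ^ τ)) :
    (Fintype.card E : ℂ) • ∑ ρ : Fin (τ + 1) → E, f (seedIndex ρ p) =
      (Fintype.card (Fin (τ + 1) → E) : ℂ) • ∑ e, f e := by
  classical
  rw [card_smul_sum_seed _ 0]
  simp only [seedIndex_add_single_zero]
  have : ∀ x, ∑ e, f (x + e) = ∑ e, f e := fun x => Equiv.sum_comp (Equiv.addLeft x) f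
  simp only [this, Finset.sum_const, Finset.card_univ, Nat.cast_smul_eq_nsmul]

/-- Choose a binary digit in which `p` and `p'` differ. Translating the corresponding coordinate of
the seed shifts exactly one of the two indices, and averaging that factor gives zero. The factors
keep their order, so operators that do not commute are allowed. -/
theorem sum_seedIndex_mul {f g : E → A} (hf : ∑ e, f e = 0) (hg : ∑ e, g e = 0)
    {p p' : Fin (2 ^ τ)} (h : p ≠ p') :
    ∑ ρ : Fin (τ + 1) → E, f (seedIndex ρ p) * g (seedIndex ρ p') = 0 := by
  classical
  obtain ⟨l, hl⟩ := exists_testBit_ne h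
  have hE : (Fintype.card E : ℂ) ≠ 0 := Nat.cast_ne_zero.2 Fintype.card_ne_zero
  rw [← smul_right_inj hE, card_smul_sum_seed _ l.succ, smul_zero]
  simp only [seedIndex_add_single_succ]
  refine Finset.sum_eq_zero fun ρ _ => ?_
  have hx : ∀ (f : E → A) x, ∑ e, f (x + e) = ∑ e, f e :=
    fun f x => Equiv.sum_comp (Equiv.addLeft x) f
  cases hp : Nat.testBit p l
  · have hp' : Nat.testBit p' l = true := by rw [hp] at hl; simpa using hl.symm
    simp only [hp', if_true, Bool.false_eq_true, if_false, add_zero, ← Finset.mul_sum, hx, hg,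
      mul_zero]
  · have hp' : Nat.testBit p' l = false := by rw [hp] at hl; simpa using hl.symm
    simp only [hp', if_true, Bool.false_eq_true, if_false, add_zero, ← Finset.sum_mul, hx, hf,
      zero_mul]

end SeedIndex

/-! ### Second moments -/

section Variance
open Matrix
variable {ι : Type*} [Fintype ι] [DecidableEq ι] {E : Type*} [AddCommGroup E] [Fintype E] {τ : ℕ}

/-- The mean of the observables `O e`. -/
noncomputable def meanOp (O : E → Matrix ι ι ℂ) : Matrix ι ι ℂ :=
  ((1 / Fintype.card E : ℝ) : ℂ) • ∑ e, O e

theorem sum_eq_card_smul_meanOp (O : E → Matrix ι ι ℂ) :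
    ∑ e, O e = (Fintype.card E : ℂ) • meanOp O := by
  have hE : (Fintype.card E : ℂ) ≠ 0 := Nat.cast_ne_zero.2 Fintype.card_ne_zero
  rw [meanOp, smul_smul]
  push_cast
  rw [mul_one_div_cancel hE, one_smul]

theorem meanOp_isHermitian {O : E → Matrix ι ι ℂ} (hO : ∀ e, (O e).IsHermitian) :
    (meanOp O).IsHermitian := by
  rw [Matrix.IsHermitian, meanOp, conjTranspose_smul, conjTranspose_sum, Complex.star_def,
    Complex.conj_ofReal]
  simp only [(hO _).eq]

/-- The sum of the observables selected by the seed `ρ`. -/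
def sampleSum (O : Fin (2 ^ τ) → E → Matrix ι ι ℂ) (ρ : Fin (τ + 1) → E) : Matrix ι ι ℂ :=
  ∑ p, O p (seedIndex ρ p)

theorem isHermitian_sum {κ : Type*} {s : Finset κ} {A : κ → Matrix ι ι ℂ}
    (h : ∀ i, (A i).IsHermitian) : (∑ i ∈ s, A i).IsHermitian := by
  rw [Matrix.IsHermitian, conjTranspose_sum]
  simp only [(h _).eq]

/-- The variance of a sum of pairwise independent terms: after centring, the mixed terms cancel and
each of the `2 ^ τ` diagonal terms contributes at most the second moment of one observable. -/
theorem sum_quadForm_sampleSum_sub_le {O : Fin (2 ^ τ) → E → Matrix ι ι ℂ}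
    (hO : ∀ p e, (O p e).IsHermitian) (v : ι → ℂ)
    (hle : ∀ p e, quadForm v (O p e * O p e) ≤ quadForm v 1) :
    ∑ ρ : Fin (τ + 1) → E, quadForm v
        ((sampleSum O ρ - ∑ p, meanOp (O p)) * (sampleSum O ρ - ∑ p, meanOp (O p))) ≤
      Fintype.card (Fin (τ + 1) → E) * 2 ^ τ * quadForm v 1 := by
  let D : Fin (2 ^ τ) → E → Matrix ι ι ℂ := fun p e => O p e - meanOp (O p)
  have hD : ∀ p, ∑ e, D p e = 0 := fun p => by
    simp [D, sum_eq_card_smul_meanOp, Nat.cast_smul_eq_nsmul]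
  have hE : (0 : ℝ) < Fintype.card E := Nat.cast_pos.2 Fintype.card_pos
  have h1 : ∀ p, quadForm v (∑ ρ : Fin (τ + 1) → E, D p (seedIndex ρ p) * D p (seedIndex ρ p)) ≤
      Fintype.card (Fin (τ + 1) → E) * quadForm v 1 := by
    intro p
    have e1 := congrArg (quadForm v) (sum_seedIndex (τ := τ) (fun e => D p e * D p e) p)
    rw [← Complex.ofReal_natCast, quadForm_ofReal_smul, ← Complex.ofReal_natCast,
      quadForm_ofReal_smul] at e1
    -- Variance is second moment minus squared mean; the latter is a square of a Hermitian operator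
    -- and may be dropped from the upper bound.
    have e2 : ∑ e, D p e * D p e = ∑ e, O p e * O p e -
        ((Fintype.card E : ℝ) : ℂ) • (meanOp (O p) * meanOp (O p)) := by
      have : ∀ e, D p e * D p e = O p e * O p e - meanOp (O p) * O p e -
          O p e * meanOp (O p) + meanOp (O p) * meanOp (O p) := fun e => by
        simp only [D]; noncomm_ring
      simp only [this, Finset.sum_add_distrib, Finset.sum_sub_distrib, ← Finset.mul_sum,
        ← Finset.sum_mul, sum_eq_card_smul_meanOp, Finset.sum_const, Finset.card_univ,
        smul_mul_assoc, mul_smul_comm, Complex.ofReal_natCast, ← Nat.cast_smul_eq_nsmul ℂ]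
      abel
    have e3 : quadForm v (∑ e, D p e * D p e) ≤ Fintype.card E * quadForm v 1 := by
      rw [e2, map_sub, quadForm_ofReal_smul, map_sum]
      have := quadForm_mul_self_nonneg v (meanOp_isHermitian (hO p))
      have h2 := Finset.sum_le_sum fun e (_ : e ∈ Finset.univ) => hle p e
      rw [Finset.sum_const, Finset.card_univ, nsmul_eq_mul] at h2
      nlinarith
    refine le_of_mul_le_mul_left ?_ hE
    rw [e1]
    calc _ ≤ (Fintype.card (Fin (τ + 1) → E) : ℝ) * (Fintype.card E * quadForm v 1) :=
          mul_le_mul_of_nonneg_left e3 (Nat.cast_nonneg _)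
      _ = _ := by ring
  have h2 : ∀ ρ : Fin (τ + 1) → E,
      sampleSum O ρ - ∑ p, meanOp (O p) = ∑ p, D p (seedIndex ρ p) := fun ρ => by
    rw [sampleSum, ← Finset.sum_sub_distrib]
  rw [← map_sum]
  simp only [h2, Finset.sum_mul_sum]
  rw [Finset.sum_comm]
  have h3 : ∀ p, ∑ ρ : Fin (τ + 1) → E, ∑ p', D p (seedIndex ρ p) * D p' (seedIndex ρ p') =
      ∑ ρ : Fin (τ + 1) → E, D p (seedIndex ρ p) * D p (seedIndex ρ p) := by
    intro p
    rw [Finset.sum_comm, Finset.sum_eq_single p]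
    · intro p' _ hp
      exact sum_seedIndex_mul (hD p) (hD p') hp.symm
    · simp
  simp only [h3, map_sum (quadForm v) _ (Finset.univ : Finset (Fin (2 ^ τ)))]
  calc _ ≤ ∑ _p : Fin (2 ^ τ), (Fintype.card (Fin (τ + 1) → E) : ℝ) * quadForm v 1 :=
        Finset.sum_le_sum fun p _ => h1 p
    _ = _ := by
      rw [Finset.sum_const, Finset.card_univ, Fintype.card_fin, nsmul_eq_mul]
      push_cast
      ring

/-- A second moment inequality for projections `Q` onto subspaces on which `S` is not positive,
although the mean `M` of `S` is at least `g`. -/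
theorem sq_mul_sum_quadForm_le {κ : Type*} [Fintype κ] {S Q : κ → Matrix ι ι ℂ}
    {M : Matrix ι ι ℂ} (hS : ∀ k, (S k).IsHermitian) (hM : M.IsHermitian)
    (hQ : ∀ k, (Q k).IsHermitian) (hQQ : ∀ k, Q k * Q k = Q k) {v : ι → ℂ}
    (hSQ : ∀ k, quadForm v (S k * Q k + Q k * S k) ≤ 0) {g V : ℝ} (hg : 0 ≤ g)
    (hMQ : 2 * g * quadForm v (∑ k, Q k) ≤ quadForm v (M * ∑ k, Q k + (∑ k, Q k) * M))
    (hV : ∑ k, quadForm v ((S k - M) * (S k - M)) ≤ V) :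
    g ^ 2 * quadForm v (∑ k, Q k) ≤ V := by
  -- This is the expansion of `0 ≤ (S - M + g Q) ^ 2`, with `Q ^ 2 = Q`. Summed over `k`, the four
  -- terms are at most `V`, `0`, `-2 * g ^ 2 * ⟨∑ Q⟩` and `g ^ 2 * ⟨∑ Q⟩`.
  have h0 : ∀ k, 0 ≤ quadForm v ((S k - M) * (S k - M)) + g * quadForm v (S k * Q k + Q k * S k) -
      g * quadForm v (M * Q k + Q k * M) + g ^ 2 * quadForm v (Q k) := fun k => by
    have h := quadForm_mul_self_nonneg v (((hS k).sub hM).add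
      (show ((g : ℂ) • Q k).IsHermitian by
        rw [Matrix.IsHermitian, conjTranspose_smul, (hQ k).eq, Complex.star_def,
          Complex.conj_ofReal]))
    have e : (S k - M + (g : ℂ) • Q k) * (S k - M + (g : ℂ) • Q k) =
        (S k - M) * (S k - M) + (g : ℂ) • (S k * Q k + Q k * S k) -
          (g : ℂ) • (M * Q k + Q k * M) + ((g ^ 2 : ℝ) : ℂ) • Q k := by
      have : ((g ^ 2 : ℝ) : ℂ) • Q k = ((g : ℂ) • Q k) * ((g : ℂ) • Q k) := by
        rw [smul_mul_smul_comm, hQQ, ← Complex.ofReal_mul, sq]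
      rw [this]
      simp only [add_mul, mul_add, sub_mul, mul_sub, smul_mul_assoc, mul_smul_comm, smul_add, smul_sub]
      module
    rwa [e, map_add, map_sub, map_add, quadForm_ofReal_smul, quadForm_ofReal_smul,
      quadForm_ofReal_smul] at h
  have h1 := Finset.sum_nonneg fun k (_ : k ∈ Finset.univ) => h0 k
  simp only [Finset.sum_add_distrib, Finset.sum_sub_distrib, ← Finset.mul_sum] at h1
  have h2 : ∑ k, quadForm v (S k * Q k + Q k * S k) ≤ 0 := Finset.sum_nonpos fun k _ => hSQ k
  have h3 : ∑ k, quadForm v (M * Q k + Q k * M) = quadForm v (M * ∑ k, Q k + (∑ k, Q k) * M) := by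
    rw [← map_sum, Finset.sum_add_distrib, Finset.mul_sum, Finset.sum_mul]
  rw [h3, ← map_sum (quadForm v) Q] at h1
  nlinarith

/-- The operators `M` and `∑ Q` need not commute, so `g ≤ M` gives no lower bound for their
anticommutator in general. At an eigenvector of `∑ Q` with eigenvalue `a` it does, as the
anticommutator becomes `2 * a * ⟨M⟩` there; and it suffices to bound the eigenvalues of `∑ Q`. -/
theorem sq_mul_sum_quadForm_le_of_le {κ : Type*} [Fintype κ] {S Q : κ → Matrix ι ι ℂ}
    {M : Matrix ι ι ℂ} (hS : ∀ k, (S k).IsHermitian) (hM : M.IsHermitian)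
    (hQ : ∀ k, (Q k).IsHermitian) (hQQ : ∀ k, Q k * Q k = Q k)
    (hSQ : ∀ k v, quadForm v (S k * Q k + Q k * S k) ≤ 0) {g V : ℝ} (hg : 0 < g)
    (hgM : ∀ v, g * quadForm v 1 ≤ quadForm v M)
    (hV : ∀ v, ∑ k, quadForm v ((S k - M) * (S k - M)) ≤ V * quadForm v 1) (v : ι → ℂ) :
    g ^ 2 * quadForm v (∑ k, Q k) ≤ V * quadForm v 1 := by
  have hA : (∑ k, Q k).IsHermitian := isHermitian_sum hQ
  have key := quadForm_le_of_eigenvectors hA (c := V / g ^ 2) (fun v a hv hav => by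
    have ha : 0 ≤ a := by
      have h1 : 0 ≤ quadForm v (∑ k, Q k) := by
        rw [map_sum]
        refine Finset.sum_nonneg fun k _ => ?_
        rw [← hQQ k]
        exact quadForm_mul_self_nonneg v (hQ k)
      rw [quadForm_of_eigenvector hav] at h1
      exact nonneg_of_mul_nonneg_left h1 (quadForm_one_pos hv)
    have h := sq_mul_sum_quadForm_le hS hM hQ hQQ (hSQ · v) hg.le (by
      rw [map_add, quadForm_mul_of_eigenvector hav, quadForm_eigenvector_mul hA hav,
        quadForm_of_eigenvector hav]
      have := mul_le_mul_of_nonneg_left (hgM v) ha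
      linarith) (hV v)
    rw [quadForm_of_eigenvector hav, ← mul_assoc] at h
    rw [le_div_iff₀ (by positivity), mul_comm]
    exact le_of_mul_le_mul_right h (quadForm_one_pos hv)) v
  rw [div_mul_eq_mul_div, le_div_iff₀ (by positivity)] at key
  linarith

/-- Now `v` is an eigenvector of the mean, and the anticommutator has the form `2 * m * ⟨∑ Q⟩` at
this vector without any assumption on other vectors. -/
theorem sq_mul_sum_quadForm_le_of_eigenvector {κ : Type*} [Fintype κ] {S Q : κ → Matrix ι ι ℂ}
    {M : Matrix ι ι ℂ} (hS : ∀ k, (S k).IsHermitian) (hM : M.IsHermitian)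
    (hQ : ∀ k, (Q k).IsHermitian) (hQQ : ∀ k, Q k * Q k = Q k) {v : ι → ℂ}
    (hSQ : ∀ k, quadForm v (S k * Q k + Q k * S k) ≤ 0) {g m V : ℝ} (hg : 0 ≤ g)
    (hgm : g ≤ m) (hMv : M *ᵥ v = (m : ℂ) • v)
    (hV : ∑ k, quadForm v ((S k - M) * (S k - M)) ≤ V) :
    g ^ 2 * quadForm v (∑ k, Q k) ≤ V := by
  refine sq_mul_sum_quadForm_le hS hM hQ hQQ hSQ hg ?_ hV
  have h1 : 0 ≤ quadForm v (∑ k, Q k) := by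
    rw [map_sum]
    refine Finset.sum_nonneg fun k _ => ?_
    rw [← hQQ k]
    exact quadForm_mul_self_nonneg v (hQ k)
  rw [map_add, quadForm_mul_of_eigenvector hMv, quadForm_eigenvector_mul hM hMv]
  nlinarith

/-- Products of independently chosen operators. -/
theorem sum_quadForm_prod_le {R : Type*} [Fintype R] : ∀ {K : ℕ} (C : Fin K → R → Matrix ι ι ℂ)
    (G : Fin K → (ι → ℂ) → Prop) {b : ℝ} (_ : 0 ≤ b)
    (_ : ∀ k k' ρ v, k ≠ k' → G k v → G k (C k' ρ *ᵥ v))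
    (_ : ∀ k v, G k v → ∑ ρ, quadForm (C k ρ *ᵥ v) 1 ≤ b * quadForm v 1)
    {v : ι → ℂ} (_ : ∀ k, G k v),
    ∑ r : Fin K → R, quadForm ((List.ofFn fun k => C k (r k)).prod *ᵥ v) 1 ≤ b ^ K * quadForm v 1
  | 0, C, G, b, hb, hG, hC, v, hv => by simp
  | K + 1, C, G, b, hb, hG, hC, v, hv => by
    have ih := sum_quadForm_prod_le (fun k => C k.succ) (fun k => G k.succ) hb
      (fun k k' ρ v hk => hG _ _ ρ v fun h => hk (Fin.succ_injective _ h))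
      (fun k => hC k.succ) (fun k => hv k.succ)
    -- The operators of the other blocks preserve the condition for block `0`, so this block can be
    -- averaged for any fixed choice of the other seeds.
    have hpres : ∀ (l : List (Fin K)) (r : Fin K → R),
        G 0 ((l.map fun k => C k.succ (r k)).prod *ᵥ v) := by
      intro l r
      induction l with
      | nil => simpa using hv 0
      | cons k l ihl =>
        rw [List.map_cons, List.prod_cons, ← mulVec_mulVec]
        exact hG _ _ _ _ (Fin.succ_ne_zero k).symm ihl
    have hsplit : ∀ F : (Fin (K + 1) → R) → ℝ,
        ∑ r, F r = ∑ r' : Fin K → R, ∑ ρ, F (Fin.cons ρ r') := fun F => by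
      rw [← (Fin.consEquiv fun _ => R).sum_comp, Fintype.sum_prod_type_right]
      rfl
    rw [hsplit]
    simp only [List.ofFn_succ, Fin.cons_zero, Fin.cons_succ, List.prod_cons, ← mulVec_mulVec]
    calc _ ≤ ∑ r' : Fin K → R,
          b * quadForm ((List.ofFn fun k => C k.succ (r' k)).prod *ᵥ v) 1 := by
          refine Finset.sum_le_sum fun r' _ => hC 0 _ ?_
          have := hpres (List.ofFn id) r'
          rwa [List.map_ofFn] at this
      _ ≤ _ := by
        rw [← Finset.mul_sum, pow_succ', mul_assoc]
        exact mul_le_mul_of_nonneg_left ih hb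

end Variance


/-! ### Majority votes over independent blocks -/

section Majority
open Matrix

theorem Commute.aeval_right {A : Type*} [Ring A] [Algebra ℂ A] {X S : A} (h : Commute X S)
    (p : Polynomial ℂ) : Commute X (Polynomial.aeval S p) := by
  induction p using Polynomial.induction_on' with
  | add p q hp hq => rw [map_add]; exact hp.add_right hq
  | monomial n a =>
    rw [Polynomial.aeval_monomial]
    exact (Algebra.commute_algebraMap_right a X).mul_right (h.pow_right n)

theorem aeval_fun_apply {Ω : Type*} (f : Ω → ℂ) (p : Polynomial ℂ) :
    Polynomial.aeval f p = fun a => p.eval (f a) := by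
  funext a
  have := Polynomial.aeval_algHom_apply (Pi.evalAlgHom ℂ (fun _ : Ω => ℂ) a) f p
  simpa using this.symm

/-- This makes the projection onto a set of scores a polynomial in the block sum. It therefore
depends on the seed of its own block only and commutes with everything that the block sum commutes
with. -/
theorem exists_indicator_polynomial (s : Finset ℤ) (A : ℤ → Prop) [DecidablePred A] :
    ∃ p : Polynomial ℂ, ∀ z ∈ s, p.eval (z : ℂ) = if A z then 1 else 0 :=
  ⟨Lagrange.interpolate s (fun z => (z : ℂ)) fun z => if A z then 1 else 0, fun z hz =>
    Lagrange.eval_interpolate_at_node (v := fun z : ℤ => (z : ℂ))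
      (fun z : ℤ => if A z then (1 : ℂ) else 0) (Int.cast_injective.injOn) hz⟩

variable {N K τ : ℕ} {E : Type*} [AddCommGroup E] [Fintype E]

/-- If the sums of the sampled observables have mean at least `g` in every block, then it is
unlikely that at least half of these sums are not positive. -/
theorem sum_quadForm_majority_le (w : (Fin K → Fin (τ + 1) → E) → PauliString N)
    {O : Fin K → Fin (2 ^ τ) → E → QubitOp N} (hO : ∀ k p e, (O k p e).IsHermitian)
    (hle : ∀ k p e u, quadForm u (O k p e * O k p e) ≤ quadForm u 1)
    (hcomm : ∀ k k' p p' e e', k ≠ k' → Commute (O k p e) (O k' p' e'))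
    {sc : Fin K → Fin (2 ^ τ) → (Fin K → Fin (τ + 1) → E) → BitString N → ℤ}
    (hsc : ∀ k p r, measOp (w r) (fun a => (sc k p r a : ℂ)) = O k p (seedIndex (r k) p))
    {A : ℤ → Prop} [DecidablePred A] (hA : ∀ z, A z → z ≤ 0) {g y : ℝ} (hg : 0 < g) (hy : 1 ≤ y)
    (hgy : y ^ 2 * 2 ^ τ ≤ g ^ 2) {v : BitString N → ℂ}
    (hv : (∀ k u, g * quadForm u 1 ≤ quadForm u (∑ p, meanOp (O k p))) ∨
      ∀ k, ∃ m : ℝ, g ≤ m ∧ (∑ p, meanOp (O k p)) *ᵥ v = (m : ℂ) • v) :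
    ∑ r, quadForm v (measOp (w r) fun a =>
        (((if K ≤ 2 * (Finset.univ.filter fun k => A (∑ p, sc k p r a)).card then 1 else 0) : ℝ) :
          ℂ)) ≤
      (Fintype.card (Fin (τ + 1) → E) : ℝ) ^ K * (2 / y) ^ K * quadForm v 1 := by
  set s : Fin K → (Fin K → Fin (τ + 1) → E) → BitString N → ℤ := fun k r a => ∑ p, sc k p r a
    with hs
  have hS : ∀ k r, measOp (w r) (fun a => (s k r a : ℂ)) = sampleSum (O k) (r k) := by
    intro k r
    rw [sampleSum, ← Finset.sum_congr rfl fun p _ => hsc k p r, ← map_sum]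
    congr 1
    funext a
    simp [hs]
  obtain ⟨P, hP⟩ := exists_indicator_polynomial
    (Finset.univ.image fun x : Fin K × (Fin K → Fin (τ + 1) → E) × BitString N =>
      s x.1 x.2.1 x.2.2) A
  have hP : ∀ k r a, P.eval (s k r a : ℂ) = if A (s k r a) then 1 else 0 := fun k r a =>
    hP _ (Finset.mem_image.2 ⟨(k, r, a), Finset.mem_univ _, rfl⟩)
  let Q : Fin K → (Fin (τ + 1) → E) → QubitOp N := fun k ρ => Polynomial.aeval (sampleSum (O k) ρ) P
  have hQ : ∀ k r, Q k (r k) = measOp (w r) fun a => (((if A (s k r a) then 1 else 0) : ℝ) : ℂ) := by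
    intro k r
    simp only [Q, ← hS]
    rw [Polynomial.aeval_algHom_apply, aeval_fun_apply]
    congr 1
    funext a
    rw [hP]
    split_ifs <;> simp
  have hSh : ∀ k ρ, (sampleSum (O k) ρ).IsHermitian := fun k ρ => isHermitian_sum fun p => hO k p _
  have hMh : ∀ k, (∑ p, meanOp (O k p)).IsHermitian := fun k =>
    isHermitian_sum fun p => meanOp_isHermitian (hO k p)
  -- As `Q k ρ` involves only the seed of block `k`, properties of it can be checked in the string
  -- sampled when all blocks have the seed `ρ`.
  have hQh : ∀ k ρ, (Q k ρ).IsHermitian := fun k ρ => by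
    rw [hQ k fun _ => ρ]
    exact measOp_isHermitian _ _
  have hQQ : ∀ k ρ, Q k ρ * Q k ρ = Q k ρ := fun k ρ => by
    rw [hQ k fun _ => ρ, ← map_mul]
    congr 1
    funext a
    rw [Pi.mul_apply]
    split_ifs <;> simp
  have hSQ : ∀ k ρ u, quadForm u (sampleSum (O k) ρ * Q k ρ + Q k ρ * sampleSum (O k) ρ) ≤ 0 := by
    intro k ρ u
    rw [hQ k fun _ => ρ, ← hS k fun _ => ρ, ← map_mul, ← map_mul, ← map_add, ← neg_nonneg,
      ← map_neg, ← map_neg]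
    convert quadForm_measOp_nonneg (w fun _ => ρ) (f := fun a =>
      -2 * s k (fun _ => ρ) a * if A (s k (fun _ => ρ) a) then 1 else 0) (fun a => ?_) u using 3
    · funext a
      simp only [Pi.neg_apply, Pi.add_apply, Pi.mul_apply]
      push_cast
      ring
    · split_ifs with h
      · have : ((s k (fun _ => ρ) a : ℤ) : ℝ) ≤ 0 := by exact_mod_cast hA _ h
        linarith
      · simp
  have hvar : ∀ k u, ∑ ρ : Fin (τ + 1) → E, quadForm u
        ((sampleSum (O k) ρ - ∑ p, meanOp (O k p)) * (sampleSum (O k) ρ - ∑ p, meanOp (O k p))) ≤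
      Fintype.card (Fin (τ + 1) → E) * 2 ^ τ * quadForm u 1 := fun k u =>
    sum_quadForm_sampleSum_sub_le (hO k) u fun p e => hle k p e u
  -- Soundness uses the first alternative, a condition on the mean alone; completeness uses the
  -- second one, a condition on the vector that has to be preserved by the other blocks.
  let G : Fin K → (BitString N → ℂ) → Prop := fun k u =>
    (∀ u, g * quadForm u 1 ≤ quadForm u (∑ p, meanOp (O k p))) ∨
      ∃ m : ℝ, g ≤ m ∧ (∑ p, meanOp (O k p)) *ᵥ u = (m : ℂ) • u
  have hGQ : ∀ k u, G k u → g ^ 2 * quadForm u (∑ ρ, Q k ρ) ≤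
      Fintype.card (Fin (τ + 1) → E) * 2 ^ τ * quadForm u 1 := by
    rintro k u (h | ⟨m, hm, h⟩)
    · exact sq_mul_sum_quadForm_le_of_le (hSh k) (hMh k) (hQh k) (hQQ k) (hSQ k) hg h (hvar k) u
    · exact sq_mul_sum_quadForm_le_of_eigenvector (hSh k) (hMh k) (hQh k) (hQQ k) (hSQ k · u)
        hg.le hm h (hvar k u)
  -- Amplitudes on which block `k` fails are multiplied by `y`; the square of this operator is `1 +
  -- (y ^ 2 - 1) * Q`.
  let C : Fin K → (Fin (τ + 1) → E) → QubitOp N := fun k ρ => 1 + ((y - 1 : ℝ) : ℂ) • Q k ρ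
  have hCG : ∀ k k' ρ u, k ≠ k' → G k u → G k (C k' ρ *ᵥ u) := by
    rintro k k' ρ u hk (h | ⟨m, hm, h⟩)
    · exact Or.inl h
    · refine Or.inr ⟨m, hm, ?_⟩
      have hc : Commute (∑ p, meanOp (O k p)) (C k' ρ) := by
        refine Commute.add_right (Commute.one_right _) (Commute.smul_right
          (Commute.aeval_right ?_ P) _)
        refine Commute.sum_left _ _ _ fun p _ => Commute.smul_left (Commute.sum_left _ _ _
          fun e _ => Commute.sum_right _ _ _ fun p' _ => hcomm _ _ _ _ _ _ hk) _
      rw [mulVec_mulVec, hc.eq, ← mulVec_mulVec, h, mulVec_smul]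
  -- By the Chebyshev bound and the choice of `y`, the average of `y ^ 2 * ⟨Q⟩` is at most `⟨1⟩`, so
  -- that weighting one block costs a factor of at most `2`.
  have hC : ∀ k u, G k u → ∑ ρ, quadForm (C k ρ *ᵥ u) 1 ≤
      2 * Fintype.card (Fin (τ + 1) → E) * quadForm u 1 := by
    intro k u hu
    have e : ∀ ρ, quadForm (C k ρ *ᵥ u) 1 = quadForm u 1 + (y ^ 2 - 1) * quadForm u (Q k ρ) := by
      intro ρ
      have hCh : (C k ρ)ᴴ = C k ρ := by
        simp only [C, conjTranspose_add, conjTranspose_one, conjTranspose_smul, (hQh k ρ).eq,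
          Complex.star_def, Complex.conj_ofReal]
      have hCC : C k ρ * C k ρ = 1 + ((y ^ 2 - 1 : ℝ) : ℂ) • Q k ρ := by
        simp only [C, add_mul, mul_add, one_mul, mul_one, smul_mul_assoc, mul_smul_comm, hQQ]
        push_cast
        module
      rw [← quadForm_conjTranspose_mul_self, hCh, hCC, map_add, quadForm_ofReal_smul]
    simp only [e, Finset.sum_add_distrib, ← Finset.mul_sum, Finset.sum_const, Finset.card_univ,
      nsmul_eq_mul, ← map_sum]
    have h1 := hGQ k u hu
    have h2 : 0 ≤ quadForm u (∑ ρ, Q k ρ) := by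
      rw [map_sum]
      refine Finset.sum_nonneg fun ρ _ => ?_
      rw [← hQQ k]
      exact quadForm_mul_self_nonneg u (hQh k ρ)
    have h3 := quadForm_one_nonneg u
    have h4 : y ^ 2 * quadForm u (∑ ρ, Q k ρ) ≤
        Fintype.card (Fin (τ + 1) → E) * quadForm u 1 := by
      have hT : (0 : ℝ) < 2 ^ τ := by positivity
      refine le_of_mul_le_mul_right ?_ hT
      calc y ^ 2 * quadForm u (∑ ρ, Q k ρ) * 2 ^ τ = y ^ 2 * 2 ^ τ * quadForm u (∑ ρ, Q k ρ) := by
            ring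
        _ ≤ g ^ 2 * quadForm u (∑ ρ, Q k ρ) := mul_le_mul_of_nonneg_right hgy h2
        _ ≤ _ := h1.trans_eq (by ring)
    linarith
  have hprod := sum_quadForm_prod_le C G (b := 2 * Fintype.card (Fin (τ + 1) → E))
    (by positivity) hCG hC (v := v)
    (fun k => hv.elim (fun h => Or.inl (h k)) fun h => Or.inr (h k))
  have hy0 : 0 < y := by linarith
  -- Markov's inequality: if at least half of the blocks fail, then the squared weights multiply to
  -- at least `y ^ K`.
  have hbound : ∀ r, quadForm v (measOp (w r) fun a =>
        (((if K ≤ 2 * (Finset.univ.filter fun k => A (s k r a)).card then 1 else 0) : ℝ) : ℂ)) ≤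
      (1 / y) ^ K * quadForm ((List.ofFn fun k => C k (r k)).prod *ᵥ v) 1 := by
    intro r
    let c : Fin K → BitString N → ℝ := fun k a => if A (s k r a) then y else 1
    have hCc : ∀ k, C k (r k) = measOp (w r) fun a => (c k a : ℂ) := by
      intro k
      simp only [C, hQ]
      rw [← map_one (measOp (w r)), ← map_smul, ← map_add]
      congr 1
      funext a
      simp only [Pi.add_apply, Pi.one_apply, Pi.smul_apply, smul_eq_mul, c]
      split_ifs <;> simp
    have hp : (List.ofFn fun k => C k (r k)).prod =
        measOp (w r) fun a => ((∏ k, c k a : ℝ) : ℂ) := by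
      have : (fun k => C k (r k)) = measOp (w r) ∘ fun k a => (c k a : ℂ) := funext hCc
      rw [this, ← List.map_ofFn, ← map_list_prod, List.prod_ofFn]
      congr 1
      funext a
      rw [Finset.prod_apply, Complex.ofReal_prod]
    rw [← quadForm_conjTranspose_mul_self, hp, (measOp_isHermitian (w r) _).eq, ← map_mul,
      ← quadForm_ofReal_smul, ← map_smul]
    convert quadForm_measOp_mono (w r)
      (f := fun a => if K ≤ 2 * (Finset.univ.filter fun k => A (s k r a)).card then 1 else 0)
      (g := fun a => (1 / y) ^ K * ((∏ k, c k a) * ∏ k, c k a)) (fun a => ?_) v using 3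
    · funext a
      simp only [Pi.smul_apply, Pi.mul_apply, smul_eq_mul]
      push_cast
      ring
    · have e : ∏ k, c k a = y ^ (Finset.univ.filter fun k => A (s k r a)).card := by
        simp only [c]
        rw [Finset.prod_ite, Finset.prod_const, Finset.prod_const_one, mul_one]
      simp only [e, ← pow_add, ← two_mul]
      split_ifs with h
      · rw [one_div, inv_pow, ← div_eq_inv_mul, le_div_iff₀ (by positivity), one_mul]
        exact pow_le_pow_right₀ hy h
      · positivity
  calc _ ≤ ∑ r : Fin K → Fin (τ + 1) → E,
        (1 / y) ^ K * quadForm ((List.ofFn fun k => C k (r k)).prod *ᵥ v) 1 :=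
        Finset.sum_le_sum fun r _ => hbound r
    _ ≤ (1 / y) ^ K * ((2 * Fintype.card (Fin (τ + 1) → E)) ^ K * quadForm v 1) := by
      rw [← Finset.mul_sum]
      exact mul_le_mul_of_nonneg_left hprod (by positivity)
    _ = _ := by
      rw [mul_pow, div_pow, div_pow, one_pow]
      ring

end Majority


/-! ### The letters of the sampled strings -/

theorem foldl_pairUp_append {α : Type} (l : List α) : ∀ (o : Option α) (e : List (α × α)),
    (l.foldl (fun (s : Option α × List (α × α)) a =>
      s.1.elim (some a, s.2) fun b => (none, s.2 ++ [(b, a)])) (o, e)).2 =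
    e ++ (l.foldl (fun (s : Option α × List (α × α)) a =>
      s.1.elim (some a, s.2) fun b => (none, s.2 ++ [(b, a)])) (o, [])).2 := by
  induction l with
  | nil => simp
  | cons a l ih =>
    intro o e
    cases o with
    | none => exact ih _ _
    | some b =>
      simp only [List.foldl_cons, Option.elim_some, List.nil_append]
      rw [ih none (e ++ [(b, a)]), ih none [(b, a)], List.append_assoc]

theorem pairUp_cons₂ {α : Type} (a b : α) (l : List α) : pairUp (a :: b :: l) = (a, b) :: pairUp l :=
  foldl_pairUp_append l none [(a, b)]

theorem pairUp_singleton {α : Type} (a : α) : pairUp [a] = [] := rfl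

theorem pairUp_flatMap {α β : Type} (f g : α → β) (l : List α) :
    pairUp (l.flatMap fun x => [f x, g x]) = l.map fun x => (f x, g x) := by
  induction l with
  | nil => rfl
  | cons a l ih =>
    rw [List.flatMap_cons, List.map_cons, ← ih]
    exact pairUp_cons₂ _ _ _

theorem pairUp_eq_map {α : Type} (d : α) : ∀ l : List α,
    pairUp l = (List.range (l.length / 2)).map fun j => (l.getD (2 * j) d, l.getD (2 * j + 1) d)
  | [] => by simp
  | [a] => by simp [pairUp_singleton]
  | a :: b :: l => by
    rw [pairUp_cons₂, pairUp_eq_map d l, List.length_cons, List.length_cons,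
      show (l.length + 1 + 1) / 2 = l.length / 2 + 1 by omega, List.range_succ_eq_map,
      List.map_cons, List.map_map]
    rfl

theorem getD_flatMap {α β : Type} {f : α → List β} {L : ℕ} {d : β} {i : ℕ} (hi : i < L) :
    ∀ {l : List α} (_ : ∀ x ∈ l, (f x).length = L) {k : ℕ} (hk : k < l.length),
    (l.flatMap f).getD (k * L + i) d = (f l[k]).getD i d
  | [], _, k, hk => absurd hk (Nat.not_lt_zero _)
  | a :: l, h, 0, hk => by
    rw [List.flatMap_cons, zero_mul, zero_add, List.getD_append]
    · rfl
    · rwa [h a (List.mem_cons_self)]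
  | a :: l, h, k + 1, hk => by
    rw [List.flatMap_cons, List.getD_append_right, h a (List.mem_cons_self),
      show (k + 1) * L + i - L = k * L + i by rw [Nat.succ_mul]; omega,
      getD_flatMap hi (fun x hx => h x (List.mem_cons_of_mem _ hx)) (Nat.lt_of_succ_lt_succ hk)]
    · rfl
    · rw [h a (List.mem_cons_self), Nat.succ_mul]
      omega

theorem length_flatMap_of_forall {α β : Type} {f : α → List β} {L : ℕ} {l : List α}
    (h : ∀ x ∈ l, (f x).length = L) : (l.flatMap f).length = l.length * L := by
  induction l with
  | nil => simp
  | cons a l ih =>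
    rw [List.flatMap_cons, List.length_append, h a List.mem_cons_self,
      ih fun x hx => h x (List.mem_cons_of_mem _ hx), List.length_cons, Nat.succ_mul, add_comm]

theorem everySecond_cons {α : Type} (b : Bool) (a : α) (l : List α) :
    everySecond b (a :: l) = if b then everySecond (!b) l else a :: everySecond (!b) l := by
  have : ∀ (l : List α) (b : Bool) (e : List α),
      (l.foldl (fun (s : Bool × List α) a => (!s.1, bif s.1 then s.2 else s.2 ++ [a])) (b, e)).2 =
        e ++ everySecond b l := by
    intro l
    induction l with
    | nil => intro b e; simp [everySecond]
    | cons a l ih =>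
      intro b e
      rw [everySecond, List.foldl_cons, List.foldl_cons, ih, ih]
      cases b <;> simp
  rw [everySecond, List.foldl_cons, this]
  cases b <;> simp

theorem getD_everySecond {α : Type} (d : α) (l : List α) : ∀ (b : Bool) (i : ℕ),
    (everySecond b l).getD i d = l.getD (2 * i + b.toNat) d := by
  induction l with
  | nil => intro b i; simp [everySecond]
  | cons a l ih =>
    intro b i
    rw [everySecond_cons]
    cases b
    · cases i with
      | zero => rfl
      | succ i =>
        have := ih true i
        simpa [show 2 * (i + 1) = 2 * i + 1 + 1 by ring] using this
    · have := ih false i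
      simpa using this

/-- Keeping every second element fixes one binary digit of the position, the lowest one first. The
lookup thus follows the binary index and never writes it in unary. -/
theorem getD_select {α : Type} (d : α) : ∀ (j : List Bool) (l : List α) (i : ℕ),
    (select l j).getD i d = l.getD (i * 2 ^ j.length + wordVal j) d
  | [], l, i => by simp [select, wordVal]
  | b :: j, l, i => by
    have := getD_select d j (everySecond b l) i
    rw [select] at this ⊢
    rw [List.foldl_cons, this, getD_everySecond, wordVal, List.length_cons, pow_succ]
    congr 1
    ring

theorem headD_select {α : Type} (d : α) (l : List α) (j : List Bool) :
    (select l j).headD d = l.getD (wordVal j) d := by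
  rw [← zero_add (wordVal j), ← zero_mul (2 ^ j.length), ← getD_select]
  cases select l j <;> rfl

/-- The two bits of a letter. -/
def PauliLetter.pair : PauliLetter → Bool × Bool
  | .I => (false, false)
  | .X => (true, false)
  | .Z => (false, true)

theorem PauliLetter.bits_eq (p : PauliLetter) : p.bits = [p.pair.1, p.pair.2] := by
  cases p <;> rfl

theorem toLetter_pair (p : PauliLetter) : toLetter p.pair = p := by
  cases p <;> rfl

theorem pairUp_pauliWord {N : ℕ} (w : PauliString N) :
    pairUp (pauliWord w) = List.ofFn fun i => (w i).pair := by
  have : PauliLetter.bits = fun p => [p.pair.1, p.pair.2] := funext PauliLetter.bits_eq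
  rw [pauliWord, this, pairUp_flatMap, List.map_ofFn]
  rfl

/-- The records of a table entry; there are only trivial ones if the entry is missing. -/
def entryRecs {n : ℕ} : Option (Bool × PauliString n) → List (PauliLetter × PauliLetter)
  | none => List.replicate (n + 1) (.I, .I)
  | some e => List.ofFn (fun l => (PauliLetter.I, e.2 l)) ++ [(.X, if e.1 then .X else .I)]

/-- Missing entries are as long as actual ones, so the place of every register is independent of the
seeds. -/
theorem length_entryRecs {n : ℕ} (e : Option (Bool × PauliString n)) :
    (entryRecs e).length = n + 1 := by
  cases e <;> simp [entryRecs]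

def recBits (p : PauliLetter × PauliLetter) : List Bool := p.1.bits ++ p.2.bits

theorem pairUp_flatMap_recBits (l : List (PauliLetter × PauliLetter)) :
    pairUp (l.flatMap recBits) = l.flatMap fun p => [p.1.pair, p.2.pair] := by
  induction l with
  | nil => rfl
  | cons p l ih =>
    rw [List.flatMap_cons, List.flatMap_cons, ← ih, recBits, PauliLetter.bits_eq,
      PauliLetter.bits_eq]
    exact (pairUp_cons₂ _ _ _).trans (congrArg _ (pairUp_cons₂ _ _ _))

theorem flatMap_recBits_entryRecs_none (n : ℕ) :
    (entryRecs (none : Option (Bool × PauliString n))).flatMap recBits =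
      List.replicate (4 * (n + 1)) false := by
  rw [entryRecs]
  generalize n + 1 = m
  induction m with
  | zero => rfl
  | succ m ih =>
    rw [List.replicate_succ, List.flatMap_cons, ih, Nat.mul_succ, add_comm, List.replicate_add]
    rfl

theorem flatMap_recBits_entryRecs_some {n : ℕ} (e : Bool × PauliString n) :
    (entryRecs (some e)).flatMap recBits = entryBits e.1 (pauliWord e.2) := by
  rw [entryBits, pairUp_pauliWord, entryRecs, List.flatMap_append, List.flatMap_def,
    List.flatMap_def, List.flatMap_def, List.map_ofFn, List.map_ofFn]
  congr 1
  · congr 2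
    funext l
    simp [recBits, PauliLetter.bits_eq, PauliLetter.pair]
  · cases e.1 <;> rfl

/-- The table of the given entries. -/
def tableWords {n : ℕ} (es : List (Bool × PauliString n)) : List (List Bool) :=
  es.map fun e => entryBits e.1 (pauliWord e.2)

theorem headD_select_tableWords {n : ℕ} (es : List (Bool × PauliString n)) (j : List Bool) :
    (select (tableWords es) j).headD (List.replicate (4 * (n + 1)) false) =
      (entryRecs es[wordVal j]?).flatMap recBits := by
  rw [headD_select, List.getD_eq_getElem?_getD, tableWords, List.getElem?_map]
  cases h : es[wordVal j]? with
  | none => rw [flatMap_recBits_entryRecs_none]; rfl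
  | some e => rw [flatMap_recBits_entryRecs_some]; rfl

theorem zipPad_ofFn {α β : Type} (d : β) : ∀ {N : ℕ} (f : Fin N → α) (g : Fin N → β),
    zipPad d (List.ofFn f) (List.ofFn g) = List.ofFn fun i => (f i, g i)
  | 0, _, _ => by simp [zipPad]
  | N + 1, f, g => by
    rw [List.ofFn_succ, List.ofFn_succ, List.ofFn_succ, zipPad, List.headD_cons, List.tail_cons,
      zipPad_ofFn]

theorem xorWord_ofFn {q : ℕ} (a b : Fin q → Bool) :
    xorWord (List.ofFn a) (List.ofFn b) = List.ofFn (a + b) := by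
  rw [xorWord, zipPad_ofFn, List.map_ofFn]
  rfl

/-- Addition of bits is exclusive or. The doubling in round `τ` appends the indices whose number has
the binary digit `τ`, which is the order of `seedIndex`. -/
theorem foldl_append_map_xorWord {q : ℕ} (ρ : ℕ → Fin q → Bool) (τ : ℕ) :
    (List.range τ).foldl (fun l j => l ++ l.map fun u => xorWord u (List.ofFn (ρ (j + 1))))
      [List.ofFn (ρ 0)] =
    (List.range (2 ^ τ)).map fun p =>
      List.ofFn (ρ 0 + ∑ l ∈ Finset.range τ, if Nat.testBit p l then ρ (l + 1) else 0) := by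
  induction τ with
  | zero => simp
  | succ τ ih =>
    rw [List.range_succ, List.foldl_append, ih, List.foldl_cons, List.foldl_nil, pow_succ, mul_two,
      List.range_add, List.map_append, List.map_map, List.map_map]
    congr 1
    · refine List.map_congr_left fun p hp => ?_
      rw [Finset.sum_range_succ, Nat.testBit_lt_two_pow (List.mem_range.1 hp)]
      simp
    · refine List.map_congr_left fun p hp => ?_
      simp only [Function.comp_apply]
      rw [xorWord_ofFn, Finset.sum_range_succ, Nat.testBit_two_pow_add_eq,
        Nat.testBit_lt_two_pow (List.mem_range.1 hp), add_assoc]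
      congr 3
      refine Finset.sum_congr rfl fun l hl => ?_
      rw [Nat.testBit_two_pow_add_gt (Finset.mem_range.1 hl)]

theorem take_drop_ofFn {α : Type} {s : ℕ} (r : Fin s → α) {x q : ℕ} (h : x + q ≤ s) :
    ((List.ofFn r).drop x).take q = List.ofFn fun i : Fin q => r ⟨x + i, by omega⟩ := by
  refine List.ext_getElem (by simp; omega) fun i h1 h2 => ?_
  simp

/-- The seeds of the blocks. -/
def seedBlocks {K τ q : ℕ} (r : BitString (K * ((τ + 1) * q))) (k : Fin K) (j : Fin (τ + 1)) :
    Fin q → Bool :=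
  fun i => r (finProdFinEquiv (k, finProdFinEquiv (j, i)))

/-- Uniform random bits are therefore the same as independent uniform seeds for all blocks. -/
theorem seedBlocks_bijective (K τ q : ℕ) :
    Function.Bijective (seedBlocks : BitString (K * ((τ + 1) * q)) → _) := by
  have : (seedBlocks : BitString (K * ((τ + 1) * q)) → _) =
    ((Equiv.arrowCongr (finProdFinEquiv (m := K) (n := (τ + 1) * q)).symm
    (Equiv.refl Bool)).trans (Equiv.curry _ _ _)).trans
    (Equiv.arrowCongr (Equiv.refl (Fin K)) ((Equiv.arrowCongr
      (finProdFinEquiv (m := τ + 1) (n := q)).symm (Equiv.refl Bool)).trans (Equiv.curry _ _ _))) := by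
    funext r k j i
    rfl
  rw [this]
  exact Equiv.bijective _

theorem blockIndices_eq {K τ q : ℕ} (r : BitString (K * ((τ + 1) * q))) (k : Fin K) :
    blockIndices q τ ((List.ofFn r).drop (k * ((τ + 1) * q))) =
      List.ofFn fun p : Fin (2 ^ τ) => List.ofFn (seedIndex (seedBlocks r k) p) := by
  have hw : ∀ j : ℕ, j < τ + 1 → ∀ h : _, (((List.ofFn r).drop (k * ((τ + 1) * q))).drop
      (j * q)).take q = List.ofFn (seedBlocks r k ⟨j, h⟩) := by
    intro j hj h
    have h1 : k * ((τ + 1) * q) + j * q + q ≤ K * ((τ + 1) * q) := by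
      have h2 : (j + 1) * q ≤ (τ + 1) * q := Nat.mul_le_mul_right _ hj
      have h3 : (k + 1) * ((τ + 1) * q) ≤ K * ((τ + 1) * q) := Nat.mul_le_mul_right _ k.2
      rw [Nat.succ_mul] at h2 h3
      omega
    rw [List.drop_drop, take_drop_ofFn r h1]
    congr 1
    funext i
    rw [seedBlocks]
    congr 1
    ext
    simp only [finProdFinEquiv_apply_val]
    ring
  let ρ : ℕ → Fin q → Bool := fun j => if h : j < τ + 1 then seedBlocks r k ⟨j, h⟩ else 0
  have e1 : blockIndices q τ ((List.ofFn r).drop (k * ((τ + 1) * q))) =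
      (List.range τ).foldl (fun l j => l ++ l.map fun u => xorWord u (List.ofFn (ρ (j + 1))))
        [List.ofFn (ρ 0)] := by
    rw [blockIndices]
    have h0 := hw 0 (Nat.succ_pos τ) (Nat.succ_pos τ)
    rw [zero_mul, List.drop_zero] at h0
    rw [h0]
    have hρ : ρ 0 = seedBlocks r k ⟨0, Nat.succ_pos τ⟩ := dif_pos _
    rw [hρ]
    refine List.foldl_ext _ _ _ fun l j hj => ?_
    have hj := Nat.succ_lt_succ (List.mem_range.1 hj)
    rw [hw (j + 1) hj hj]
    simp only [ρ, dif_pos hj]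
  rw [e1, foldl_append_map_xorWord, ← List.map_coe_finRange_eq_range, List.map_map, List.ofFn_eq_map]
  refine List.map_congr_left fun p _ => ?_
  rw [Function.comp_apply, seedIndex]
  congr 2
  rw [Finset.sum_range]
  refine Finset.sum_congr rfl fun l _ => ?_
  have : ρ (l + 1) = seedBlocks r k l.succ := dif_pos (Nat.succ_lt_succ l.2)
  rw [this]

/-- The records of the string sampled with the given seeds. -/
def sampleRecs {K τ q n : ℕ} (es : List (Bool × PauliString n))
    (ρ : Fin K → Fin (τ + 1) → Fin q → Bool) : List (PauliLetter × PauliLetter) :=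
  (List.ofFn ρ).flatMap fun σ => (List.ofFn fun p : Fin (2 ^ τ) =>
    entryRecs es[wordVal (List.ofFn (seedIndex σ p))]?).flatten ++ [(.Z, .I)]

theorem flatMap_blockBits {K τ q n : ℕ} (es : List (Bool × PauliString n))
    (r : BitString (K * ((τ + 1) * q))) :
    ((List.range K).flatMap fun k =>
      blockBits q τ n (tableWords es) ((List.ofFn r).drop (k * ((τ + 1) * q)))) =
    (sampleRecs es (seedBlocks r)).flatMap recBits := by
  rw [sampleRecs, List.flatMap_assoc, ← List.map_coe_finRange_eq_range, List.flatMap_map,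
    List.ofFn_eq_map (f := seedBlocks r), List.flatMap_map]
  refine List.flatMap_congr fun k _ => ?_
  rw [blockBits, blockIndices_eq, List.flatMap_append]
  congr 1
  rw [List.ofFn_eq_map, List.ofFn_eq_map, List.flatMap_map, ← List.flatMap_def, List.flatMap_assoc]
  refine List.flatMap_congr fun p _ => ?_
  rw [headD_select_tableWords]

theorem length_sampleRecs_aux {τ q n : ℕ} (es : List (Bool × PauliString n))
    (σ : Fin (τ + 1) → Fin q → Bool) : ((List.ofFn fun p : Fin (2 ^ τ) =>
    entryRecs es[wordVal (List.ofFn (seedIndex σ p))]?).flatten ++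
      [(PauliLetter.Z, PauliLetter.I)]).length = 2 ^ τ * (n + 1) + 1 := by
  rw [List.length_append, List.ofFn_eq_map, ← List.flatMap_def,
    length_flatMap_of_forall (L := n + 1) fun p _ => length_entryRecs _]
  simp

theorem length_sampleRecs {K τ q n : ℕ} (es : List (Bool × PauliString n))
    (ρ : Fin K → Fin (τ + 1) → Fin q → Bool) :
    (sampleRecs es ρ).length = K * (2 ^ τ * (n + 1) + 1) := by
  rw [sampleRecs, length_flatMap_of_forall fun σ _ => length_sampleRecs_aux es σ, List.length_ofFn]

theorem getD_sampleRecs_entry {K τ q n : ℕ} (es : List (Bool × PauliString n))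
    (ρ : Fin K → Fin (τ + 1) → Fin q → Bool) (k : Fin K) (p : Fin (2 ^ τ)) {l : ℕ} (hl : l < n + 1)
    (d : PauliLetter × PauliLetter) :
    (sampleRecs es ρ).getD (k * (2 ^ τ * (n + 1) + 1) + (p * (n + 1) + l)) d =
      (entryRecs es[wordVal (List.ofFn (seedIndex (ρ k) p))]?).getD l d := by
  have h : (p : ℕ) * (n + 1) + l < 2 ^ τ * (n + 1) := by
    have := Nat.mul_le_mul_right (n + 1) p.2
    rw [Nat.succ_mul] at this
    omega
  rw [sampleRecs, getD_flatMap (h.trans (Nat.lt_succ_self _))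
    (fun σ _ => length_sampleRecs_aux es σ) (by simp), List.getElem_ofFn,
    List.ofFn_eq_map, ← List.flatMap_def, List.getD_append _ _ _ _ (by
      rw [length_flatMap_of_forall (L := n + 1) fun p _ => length_entryRecs _]
      simpa using h), getD_flatMap hl (fun p _ => length_entryRecs _) (by simp)]
  simp

theorem getD_sampleRecs_end {K τ q n : ℕ} (es : List (Bool × PauliString n))
    (ρ : Fin K → Fin (τ + 1) → Fin q → Bool) (k : Fin K) (d : PauliLetter × PauliLetter) :
    (sampleRecs es ρ).getD (k * (2 ^ τ * (n + 1) + 1) + 2 ^ τ * (n + 1)) d = (.Z, .I) := by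
  have h : (List.finRange (2 ^ τ)).length * (n + 1) = 2 ^ τ * (n + 1) := by simp
  rw [sampleRecs, getD_flatMap (Nat.lt_succ_self _)
    (fun σ _ => length_sampleRecs_aux es σ) (by simp), List.getElem_ofFn,
    List.ofFn_eq_map, ← List.flatMap_def, List.getD_append_right _ _ _ _ (by
      rw [length_flatMap_of_forall (L := n + 1) fun p _ => length_entryRecs _, h]),
    length_flatMap_of_forall (L := n + 1) fun p _ => length_entryRecs _, h, Nat.sub_self]
  rfl

theorem sampleLetters_tableWords {K τ q n N : ℕ} (es : List (Bool × PauliString n))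
    (r : BitString (K * ((τ + 1) * q))) {i : ℕ} (hi : i < N) :
    toLetter ((sampleLetters q τ K n N (tableWords es) (List.ofFn r)).getD i (false, false)) =
      ((sampleRecs es (seedBlocks r)).flatMap fun p => [p.1, p.2]).getD i .I := by
  rw [sampleLetters, flatMap_blockBits, pairUp_flatMap_recBits]
  generalize sampleRecs es (seedBlocks r) = R
  -- Padding with the trivial letter and cutting at `N` are invisible at positions below `N`, since
  -- the default value is the trivial letter as well.
  have h1 : ∀ l : List (Bool × Bool), ((l ++ List.replicate N (false, false)).take N).getD i
      (false, false) = l.getD i (false, false) := by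
    intro l
    rw [List.getD_eq_getElem?_getD, List.getD_eq_getElem?_getD, List.getElem?_take_of_lt hi]
    rcases lt_or_ge i l.length with h | h
    · rw [List.getElem?_append_left h]
    · rw [List.getElem?_append_right h, List.getElem?_replicate, List.getElem?_eq_none h]
      split_ifs <;> rfl
  have h2 : (R.flatMap fun p => [p.1.pair, p.2.pair]) =
      (R.flatMap fun p => [p.1, p.2]).map PauliLetter.pair := by
    rw [List.map_flatMap]
    rfl
  rw [h1, h2]
  have := List.getD_map (l := R.flatMap fun p => [p.1, p.2]) (d := PauliLetter.I) (n := i)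
    (f := PauliLetter.pair)
  rw [show (false, false) = PauliLetter.pair .I from rfl, this, toLetter_pair]


/-! ### The accepted outcomes -/

theorem foldl_range_mul {α : Type} (f : α → ℕ → α) (L : ℕ) (s : α) : ∀ m,
    (List.range (m * L)).foldl f s =
      (List.range m).foldl (fun s k => (List.range L).foldl (fun s i => f s (k * L + i)) s) s
  | 0 => by simp
  | m + 1 => by
    rw [Nat.succ_mul, List.range_add, List.foldl_append, foldl_range_mul f L s m, List.range_succ,
      List.foldl_append, List.foldl_map]
    rfl

theorem decideWord_eq {N : ℕ} (w : PauliString N) (a : BitString N) (R : List (PauliLetter × PauliLetter))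
    (hw : ∀ i : Fin N, w i = (R.flatMap fun p => [p.1, p.2]).getD i .I) :
    decideWord (pauliWord w) (bitWord a) =
      let s := (List.range (N / 2)).foldl (fun s j => decideStep s
        (((R.getD j (.I, .I)).1.pair, (List.ofFn a).getD (2 * j) false),
          ((R.getD j (.I, .I)).2.pair, (List.ofFn a).getD (2 * j + 1) false)))
        (false, (0, 0), (0, 0))
      Nat.ble s.2.2.2 s.2.2.1 := by
  have hR : ∀ j, (R.flatMap fun p => [p.1, p.2]).getD (2 * j) .I = (R.getD j (.I, .I)).1 ∧
      (R.flatMap fun p => [p.1, p.2]).getD (2 * j + 1) .I = (R.getD j (.I, .I)).2 := by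
    intro j
    rcases lt_or_ge j R.length with h | h
    · have h1 := getD_flatMap (d := PauliLetter.I) (L := 2) (i := 0) two_pos
        (f := fun p : PauliLetter × PauliLetter => [p.1, p.2]) (l := R) (fun _ _ => rfl) h
      have h2 := getD_flatMap (d := PauliLetter.I) (L := 2) (i := 1) one_lt_two
        (f := fun p : PauliLetter × PauliLetter => [p.1, p.2]) (l := R) (fun _ _ => rfl) h
      rw [mul_comm] at h1 h2
      rw [← add_zero (2 * j), h1, add_zero, h2, List.getD_eq_getElem _ _ h]
      exact ⟨rfl, rfl⟩
    · have hl : (R.flatMap fun p => [p.1, p.2]).length = R.length * 2 :=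
        length_flatMap_of_forall fun _ _ => rfl
      rw [List.getD_eq_default R _ h, List.getD_eq_default _ _ (by omega),
        List.getD_eq_default _ _ (by omega)]
      exact ⟨rfl, rfl⟩
  rw [decideWord, pairUp_pauliWord, bitWord, zipPad_ofFn, pairUp_eq_map ((false, false), false),
    List.length_ofFn, List.foldl_map]
  have key : ∀ i < N, (List.ofFn fun i => ((w i).pair, a i)).getD i ((false, false), false) =
      (((R.flatMap fun p : PauliLetter × PauliLetter => [p.1, p.2]).getD i .I).pair,
        (List.ofFn a).getD i false) := by
    intro i hi
    rw [List.getD_eq_getElem (List.ofFn fun i => ((w i).pair, a i)) _ (by simpa using hi),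
      List.getElem_ofFn, hw ⟨i, hi⟩, List.getD_eq_getElem (List.ofFn a) _ (by simpa using hi),
      List.getElem_ofFn]
  have hf : ∀ s : DecState, (List.range (N / 2)).foldl (fun s j => decideStep s
      ((List.ofFn fun i => ((w i).pair, a i)).getD (2 * j) ((false, false), false),
        (List.ofFn fun i => ((w i).pair, a i)).getD (2 * j + 1) ((false, false), false))) s =
      (List.range (N / 2)).foldl (fun s j => decideStep s
        (((R.getD j (.I, .I)).1.pair, (List.ofFn a).getD (2 * j) false),
          ((R.getD j (.I, .I)).2.pair, (List.ofFn a).getD (2 * j + 1) false))) s := by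
    intro s
    refine List.foldl_ext _ _ _ fun s j hj => ?_
    have hj := List.mem_range.1 hj
    rw [key _ (by omega), key _ (by omega), (hR j).1, (hR j).2]
  rw [hf]

/-- The contribution of a table entry to the score of its block. -/
def entryScore {n : ℕ} (e : Option (Bool × PauliString n)) (o : BitString n) : ℤ :=
  e.elim 0 fun e => (-1) ^ e.1.toNat * scoreSign e.2 o

/-! ### The run of the decision procedure on a sampled string -/

section Run
variable (rc : ℕ → PauliLetter × PauliLetter) (a : ℕ → Bool)

/-- Processing of a record. -/
def runStep (s : DecState) (j : ℕ) : DecState :=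
  decideStep s (((rc j).1.pair, a (2 * j)), ((rc j).2.pair, a (2 * j + 1)))

theorem runStep_data {j : ℕ} (h : (rc j).1 = .I) (s : DecState) :
    runStep rc a s j = (Bool.xor s.1 (a (2 * j + 1) && decide ((rc j).2 ≠ .I)), s.2) := by
  rw [runStep, decideStep, h]
  cases (rc j).2 <;> simp [PauliLetter.pair]

/-- The procedure keeps the parity of the outcomes at nontrivial letters; the product of the
outcomes is `-1` to this parity. -/
theorem foldl_runStep_data {n : ℕ} (u : PauliString n) (b : ℕ)
    (h : ∀ l : Fin n, rc (b + l) = (.I, u l)) (x : (ℕ × ℕ) × (ℕ × ℕ)) :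
    ∃ c : Bool, (List.range n).foldl (fun s l => runStep rc a s (b + l)) (false, x) = (c, x) ∧
      (-1 : ℤ) ^ c.toNat = scoreSign u fun l => a (2 * (b + l) + 1) := by
  induction n with
  | zero => exact ⟨false, rfl, rfl⟩
  | succ n ih =>
    obtain ⟨c, h1, h2⟩ := ih (fun l => u l.castSucc) (fun l => h l.castSucc)
    have hn := h (Fin.last n)
    rw [Fin.val_last] at hn
    refine ⟨Bool.xor c (a (2 * (b + n) + 1) && decide (u (Fin.last n) ≠ .I)), ?_, ?_⟩
    · rw [List.range_succ, List.foldl_append, h1, List.foldl_cons, List.foldl_nil,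
        runStep_data rc a (by rw [hn]), hn]
    · rw [scoreSign, Fin.prod_univ_castSucc]
      have h2' : (-1 : ℤ) ^ c.toNat = ∏ i : Fin n, if u i.castSucc = .I then 1 else
        (-1) ^ (a (2 * (b + i.castSucc) + 1)).toNat := h2
      rw [← h2', Fin.val_last]
      by_cases hu : u (Fin.last n) = .I
      · simp [hu]
      · cases c <;> cases a (2 * (b + n) + 1) <;> simp [hu]

/-- The closing record increases the counter of positive or of negative scores, according to parity
and sign of the entry. Only the difference of the two counters matters. A missing entry has no
closing record and leaves both unchanged. -/
theorem foldl_runStep_entry {n : ℕ} (e : Option (Bool × PauliString n)) (b : ℕ)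
    (h : ∀ l < n + 1, rc (b + l) = (entryRecs e).getD l (.I, .I)) (x : ℕ × ℕ) (y : ℕ × ℕ) :
    ∃ z : ℕ × ℕ, (List.range (n + 1)).foldl (fun s l => runStep rc a s (b + l)) (false, x, y) =
      (false, z, y) ∧
      (z.1 : ℤ) - z.2 = x.1 - x.2 + entryScore e fun l => a (2 * (b + l) + 1) := by
  cases e with
  | none =>
    refine ⟨x, ?_, by simp [entryScore]⟩
    have h' : ∀ l < n + 1, rc (b + l) = (.I, .I) := fun l hl => by
      rw [h l hl, entryRecs, List.getD_replicate _ hl]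
    have : ∀ m ≤ n + 1, (List.range m).foldl (fun s l => runStep rc a s (b + l)) (false, x, y) =
        (false, x, y) := by
      intro m
      induction m with
      | zero => intro _; rfl
      | succ m ih =>
        intro hm
        rw [List.range_succ, List.foldl_append, ih (by omega), List.foldl_cons, List.foldl_nil,
          runStep_data rc a (by rw [h' m hm]), h' m hm]
        simp
    exact this _ le_rfl
  | some e =>
    obtain ⟨c, h1, h2⟩ := foldl_runStep_data rc a e.2 b (fun l => by
      rw [h l (l.2.trans (Nat.lt_succ_self n)), entryRecs, List.getD_append _ _ _ _ (by simp),
        List.getD_eq_getElem _ _ (by simp), List.getElem_ofFn]) (x, y)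
    have h3 : rc (b + n) = (.X, if e.1 then .X else .I) := by
      rw [h n (Nat.lt_succ_self n), entryRecs, List.getD_append_right _ _ _ _ (by simp)]
      simp
    rw [List.range_succ, List.foldl_append, h1, List.foldl_cons, List.foldl_nil, runStep, h3,
      entryScore, Option.elim_some, ← h2]
    cases c <;> cases e.1 <;>
      simp only [decideStep, PauliLetter.pair, cond_true, cond_false, Bool.xor_true, Bool.xor_false,
        Bool.not_true, Bool.not_false, if_true, if_false, Bool.false_eq_true, Bool.toNat_true,
        Bool.toNat_false, pow_zero, pow_one] <;>
      exact ⟨_, rfl, by push_cast; ring⟩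

theorem foldl_runStep_entries {n m : ℕ} (e : Fin m → Option (Bool × PauliString n)) (b : ℕ)
    (h : ∀ p : Fin m, ∀ l < n + 1, rc (b + (p * (n + 1) + l)) = (entryRecs (e p)).getD l (.I, .I))
    (y : ℕ × ℕ) :
    ∃ z : ℕ × ℕ, (List.range (m * (n + 1))).foldl (fun s l => runStep rc a s (b + l))
        (false, (0, 0), y) = (false, z, y) ∧
      (z.1 : ℤ) - z.2 =
        ∑ p, entryScore (e p) fun l => a (2 * (b + ((p : ℕ) * (n + 1) + l)) + 1) := by
  rw [foldl_range_mul]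
  induction m with
  | zero => exact ⟨(0, 0), rfl, by simp⟩
  | succ m ih =>
    obtain ⟨z, h1, h2⟩ := ih (fun p => e p.castSucc) (fun p => h p.castSucc)
    obtain ⟨z', h3, h4⟩ := foldl_runStep_entry rc a (e (Fin.last m)) (b + m * (n + 1))
      (fun l hl => by rw [add_assoc]; exact h (Fin.last m) l hl) z y
    refine ⟨z', ?_, ?_⟩
    · rw [List.range_succ (n := m), List.foldl_append, h1, List.foldl_cons, List.foldl_nil]
      simpa only [add_assoc] using h3
    · rw [h4, h2, Fin.sum_univ_castSucc]
      simp only [Fin.val_last, add_assoc, Fin.val_castSucc]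

theorem foldl_runStep_blocks {n m K : ℕ} (e : Fin K → Fin m → Option (Bool × PauliString n))
    (h : ∀ (k : Fin K) (p : Fin m), ∀ l < n + 1,
      rc (k * (m * (n + 1) + 1) + (p * (n + 1) + l)) = (entryRecs (e k p)).getD l (.I, .I))
    (hend : ∀ k : Fin K, rc (k * (m * (n + 1) + 1) + m * (n + 1)) = (.Z, .I)) :
    ∃ z : ℕ × ℕ, (List.range (K * (m * (n + 1) + 1))).foldl (runStep rc a)
        (false, (0, 0), (0, 0)) = (false, (0, 0), z) ∧
      z.1 = (Finset.univ.filter fun k => ∑ p, entryScore (e k p)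
        (fun l => a (2 * ((k : ℕ) * (m * (n + 1) + 1) + ((p : ℕ) * (n + 1) + l)) + 1)) ≤ 0).card ∧
      z.1 + z.2 = K := by
  rw [foldl_range_mul]
  induction K with
  | zero => exact ⟨(0, 0), rfl, by simp, rfl⟩
  | succ K ih =>
    obtain ⟨z, h1, h2, h3⟩ := ih (fun k => e k.castSucc) (fun k => h k.castSucc)
      (fun k => hend k.castSucc)
    obtain ⟨z', h4, h5⟩ := foldl_runStep_entries rc a (e (Fin.last K)) (K * (m * (n + 1) + 1))
      (h (Fin.last K)) z
    have he := hend (Fin.last K)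
    rw [Fin.val_last] at he
    rw [List.range_succ (n := K), List.foldl_append, h1, List.foldl_cons, List.foldl_nil,
      List.range_succ (n := m * (n + 1)), List.foldl_append, h4, List.foldl_cons, List.foldl_nil, runStep, he, Finset.card_filter,
      Fin.sum_univ_castSucc, Fin.val_last, ← h5]
    rw [Finset.card_filter] at h2
    simp only [Fin.val_castSucc]
    rw [← h2]
    by_cases hz : z'.1 ≤ z'.2
    · have hb : Nat.ble z'.1 z'.2 = true := by rwa [Nat.ble_eq]
      refine ⟨(z.1 + 1, z.2), by simp [decideStep, PauliLetter.pair, hb], ?_, ?_⟩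
      · rw [if_pos (by omega)]
      · omega
    · have hb : Nat.ble z'.1 z'.2 = false := by
        rw [← Bool.not_eq_true, Nat.ble_eq]; exact hz
      refine ⟨(z.1, z.2 + 1), by simp [decideStep, PauliLetter.pair, hb], ?_, ?_⟩
      · rw [if_neg (by omega), add_zero]
      · simp only
        omega

end Run

section Positions
variable {K T n N : ℕ}

/-- The position of the letter number `l` of the entry number `p` of the block number `k`. -/
def entryPos (h : 2 * (K * (T * (n + 1) + 1)) ≤ N) (κ : Fin K × Fin T) (l : Fin n) : Fin N :=
  ⟨2 * (κ.1 * (T * (n + 1) + 1) + (κ.2 * (n + 1) + l)) + 1, by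
    have h1 := Nat.mul_le_mul_right (T * (n + 1) + 1) κ.1.2
    have h2 := Nat.mul_le_mul_right (n + 1) κ.2.2
    rw [Nat.succ_mul] at h1 h2
    have := l.2
    omega⟩

/-- Division with remainder recovers block, register and qubit. Disjointness of the registers gives
commuting observables for different blocks and allows product states. -/
theorem entryPos_injective (h : 2 * (K * (T * (n + 1) + 1)) ≤ N) :
    Function.Injective fun x : (Fin K × Fin T) × Fin n => entryPos h x.1 x.2 := by
  have aux : ∀ {B k k' x x' : ℕ}, x < B → x' < B → k * B + x = k' * B + x' → k = k' ∧ x = x' := by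
    intro B k k' x x' hx hx' he
    have hB : 0 < B := by omega
    have h1 := congrArg (· / B) he
    have h2 := congrArg (· % B) he
    simp only [mul_comm _ B, Nat.mul_add_div hB, Nat.div_eq_of_lt hx, Nat.div_eq_of_lt hx',
      Nat.mul_add_mod, Nat.mod_eq_of_lt hx, Nat.mod_eq_of_lt hx', add_zero] at h1 h2
    exact ⟨h1, h2⟩
  rintro ⟨⟨k, p⟩, l⟩ ⟨⟨k', p'⟩, l'⟩ he
  have he := congrArg Fin.val he
  simp only [entryPos] at he
  have h2 := Nat.mul_le_mul_right (n + 1) p.2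
  have h2' := Nat.mul_le_mul_right (n + 1) p'.2
  rw [Nat.succ_mul] at h2 h2'
  have hl := l.2
  have hl' := l'.2
  obtain ⟨e1, e2⟩ := aux (B := T * (n + 1) + 1) (by omega) (by omega)
    (show (k : ℕ) * (T * (n + 1) + 1) + (p * (n + 1) + l) =
      k' * (T * (n + 1) + 1) + (p' * (n + 1) + l') by omega)
  obtain ⟨e3, e4⟩ := aux (B := n + 1) (by omega) (by omega) e2
  rw [Fin.ext e1, Fin.ext e3, Fin.ext e4]

end Positions

/-- The decision procedure is the majority vote that the operator estimates are about. Outcomes at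
even positions, where the marks are, play no role. -/
theorem decideWord_iff {K τ q n N : ℕ} (h : 2 * (K * (2 ^ τ * (n + 1) + 1)) ≤ N)
    (es : List (Bool × PauliString n)) (ρ : Fin K → Fin (τ + 1) → Fin q → Bool)
    (w : PauliString N)
    (hw : ∀ i : Fin N, w i = ((sampleRecs es ρ).flatMap fun p => [p.1, p.2]).getD i .I)
    (a : BitString N) :
    decideWord (pauliWord w) (bitWord a) = true ↔
      K ≤ 2 * (Finset.univ.filter fun k => ∑ p,
        entryScore es[wordVal (List.ofFn (seedIndex (ρ k) p))]? (a ∘ entryPos h (k, p)) ≤ 0).card := by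
  rw [decideWord_eq w a _ hw]
  set rc : ℕ → PauliLetter × PauliLetter := fun j => (sampleRecs es ρ).getD j (.I, .I) with hrc
  set a' : ℕ → Bool := fun i => (List.ofFn a).getD i false with ha'
  change Nat.ble ((List.range (N / 2)).foldl (runStep rc a') (false, (0, 0), (0, 0))).2.2.2
    ((List.range (N / 2)).foldl (runStep rc a') (false, (0, 0), (0, 0))).2.2.1 = true ↔ _
  obtain ⟨z, h1, h2, h3⟩ := foldl_runStep_blocks rc a'
    (fun k p => es[wordVal (List.ofFn (seedIndex (ρ k) p))]?)
    (fun k p l hl => getD_sampleRecs_entry es ρ k p hl _) (fun k => getD_sampleRecs_end es ρ k _)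
  -- The letters after the last block form trivial records, which do not touch the votes; the final
  -- parity is irrelevant.
  have hpad : ∀ m, ∃ c, (List.range (K * (2 ^ τ * (n + 1) + 1) + m)).foldl (runStep rc a')
      (false, (0, 0), (0, 0)) = (c, (0, 0), z) := by
    intro m
    induction m with
    | zero => exact ⟨false, h1⟩
    | succ m ih =>
      obtain ⟨c, hc⟩ := ih
      have hr : rc (K * (2 ^ τ * (n + 1) + 1) + m) = (.I, .I) :=
        List.getD_eq_default _ _ (by rw [length_sampleRecs]; omega)
      rw [← add_assoc, List.range_succ, List.foldl_append, hc, List.foldl_cons, List.foldl_nil,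
        runStep_data rc a' (by rw [hr])]
      exact ⟨_, rfl⟩
  obtain ⟨c, hc⟩ := hpad (N / 2 - K * (2 ^ τ * (n + 1) + 1))
  rw [Nat.add_sub_cancel' (by omega)] at hc
  have hpos : ∀ (k : Fin K) (p : Fin (2 ^ τ)), (fun l : Fin n =>
      a' (2 * ((k : ℕ) * (2 ^ τ * (n + 1) + 1) + ((p : ℕ) * (n + 1) + l)) + 1)) =
      a ∘ entryPos h (k, p) := by
    intro k p
    funext l
    have hi := (entryPos h (k, p) l).2
    simp only [entryPos] at hi
    simp only [ha']
    rw [List.getD_eq_getElem _ _ (by simpa using hi), List.getElem_ofFn]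
    rfl
  simp only [hpos] at h2
  rw [hc, Nat.ble_eq, ← h2]
  simp only
  omega

theorem sampleRecs_letter {K τ q n N : ℕ} (h : 2 * (K * (2 ^ τ * (n + 1) + 1)) ≤ N)
    (es : List (Bool × PauliString n)) (ρ : Fin K → Fin (τ + 1) → Fin q → Bool)
    (k : Fin K) (p : Fin (2 ^ τ)) (l : Fin n) {e : Bool × PauliString n}
    (he : es[wordVal (List.ofFn (seedIndex (ρ k) p))]? = some e) :
    ((sampleRecs es ρ).flatMap fun p => [p.1, p.2]).getD (entryPos h (k, p) l) .I = e.2 l := by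
  have hlt : (k : ℕ) * (2 ^ τ * (n + 1) + 1) + (p * (n + 1) + l) < (sampleRecs es ρ).length := by
    rw [length_sampleRecs]
    have h1 := Nat.mul_le_mul_right (2 ^ τ * (n + 1) + 1) k.2
    have h2 := Nat.mul_le_mul_right (n + 1) p.2
    rw [Nat.succ_mul] at h1 h2
    have := l.2
    omega
  have h1 := getD_flatMap (d := PauliLetter.I) (L := 2) (i := 1) one_lt_two
    (f := fun p : PauliLetter × PauliLetter => [p.1, p.2]) (l := sampleRecs es ρ)
    (fun _ _ => rfl) hlt
  have h2 := getD_sampleRecs_entry es ρ k p (l.2.trans (Nat.lt_succ_self n)) (.I, .I)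
  rw [List.getD_eq_getElem _ _ hlt, he, entryRecs, List.getD_append _ _ _ _ (by simp),
    List.getD_eq_getElem _ _ (by simp), List.getElem_ofFn] at h2
  rw [h2, mul_comm] at h1
  exact h1


/-! ### The sampled operators -/

section SampledOp
open Matrix

theorem sum_range_two_mul {M : Type*} [AddCommMonoid M] (f : ℕ → M) (m : ℕ) :
    ∑ t ∈ Finset.range (2 * m), f t = ∑ t ∈ Finset.range m, (f (2 * t) + f (2 * t + 1)) := by
  induction m with
  | zero => simp
  | succ m ih =>
    rw [Nat.mul_succ, Finset.sum_range_succ, Finset.sum_range_succ, Finset.sum_range_succ, ih,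
      add_assoc]

theorem sum_wordVal {M : Type*} [AddCommMonoid M] : ∀ (q : ℕ) (f : ℕ → M),
    ∑ e : Fin q → Bool, f (wordVal (List.ofFn e)) = ∑ t ∈ Finset.range (2 ^ q), f t
  | 0, f => by simp [wordVal]
  | q + 1, f => by
    rw [← (Fin.consEquiv fun _ => Bool).sum_comp, Fintype.sum_prod_type_right, pow_succ',
      sum_range_two_mul, ← sum_wordVal q]
    refine Finset.sum_congr rfl fun e _ => ?_
    simp only [Fin.consEquiv, Equiv.coe_fn_mk, List.ofFn_succ, Fin.cons_zero, Fin.cons_succ,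
      wordVal, Fintype.sum_bool, Bool.toNat_true, Bool.toNat_false]
    rw [add_comm, zero_add, add_comm 1]

theorem sum_range_getElem? {M α : Type*} [AddCommMonoid M] (g : α → M) :
    ∀ (l : List α) {m : ℕ}, l.length ≤ m →
      ∑ t ∈ Finset.range m, l[t]?.elim 0 g = (l.map g).sum
  | [], m, _ => by simp
  | a :: l, 0, h => absurd h (Nat.not_succ_le_zero _)
  | a :: l, m + 1, h => by
    rw [Finset.sum_range_succ', List.map_cons, List.sum_cons,
      ← sum_range_getElem? g l (Nat.le_of_succ_le_succ h), add_comm]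
    rfl

/-- The observable of a table entry. -/
noncomputable def entryOp {n : ℕ} (e : Bool × PauliString n) : QubitOp n :=
  ((-1 : ℝ) ^ e.1.toNat : ℝ) • pauliOp e.2

/-- The sum of the observables of a table. -/
noncomputable def tableOp {n : ℕ} (es : List (Bool × PauliString n)) : QubitOp n :=
  (es.map entryOp).sum

theorem entryOp_isHermitian {n : ℕ} (e : Bool × PauliString n) : (entryOp e).IsHermitian := by
  rw [Matrix.IsHermitian, entryOp, conjTranspose_smul, (pauliOp_isHermitian _).eq, star_trivial]

theorem tableOp_isHermitian {n : ℕ} (es : List (Bool × PauliString n)) :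
    (tableOp es).IsHermitian := by
  induction es with
  | nil => exact isHermitian_zero
  | cons e es ih =>
    rw [tableOp, List.map_cons, List.sum_cons]
    exact (entryOp_isHermitian e).add ih

theorem entryOp_mul_self {n : ℕ} (e : Bool × PauliString n) : entryOp e * entryOp e = 1 := by
  rw [entryOp, smul_mul_smul_comm, pauliOp_mul_self, ← mul_pow]
  simp

theorem scoreSign_comp {n N : ℕ} {ι : Fin n → Fin N} (hι : Function.Injective ι)
    (u : PauliString n) (a : BitString N) :
    scoreSign u (a ∘ ι) = scoreSign (Function.extend ι u fun _ => .I) a := by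
  classical
  rw [scoreSign, scoreSign, ← Finset.prod_mul_prod_compl (Finset.univ.image ι),
    Finset.prod_image hι.injOn]
  simp only [hι.extend_apply, Function.comp_apply]
  refine ((mul_one _).symm.trans (congrArg _ (Finset.prod_eq_one fun i hi => ?_).symm))
  have hi : i ∉ Set.range ι := by simpa using hi
  rw [if_pos (Function.extend_apply' _ _ _ (by simpa using hi))]

theorem liftOp_entryOp {n N : ℕ} {ι : Fin n → Fin N} (hι : Function.Injective ι)
    (e : Bool × PauliString n) : liftOp ι (entryOp e) =
      ((-1 : ℂ) ^ e.1.toNat) • pauliOp (Function.extend ι e.2 fun _ => .I) := by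
  have h3 : entryOp e = ((-1 : ℂ) ^ e.1.toNat) • pauliOp e.2 := by
    rw [entryOp]
    cases e.1 <;> simp
  rw [h3, liftOp_smul, liftOp_pauliOp hι]

theorem liftOp_zero {n N : ℕ} (ι : Fin n → Fin N) : liftOp ι (0 : QubitOp n) = 0 := by
  have := liftOp_smul ι 0 (0 : QubitOp n)
  simpa using this

/-- As an observable of the sampled string, the score of an entry is the operator of this entry on
its register. The factor `c`, later `1` or `-1`, lets soundness and completeness share one estimate.
-/
theorem measOp_entryScore {n N : ℕ} {ι : Fin n → Fin N} (hι : Function.Injective ι)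
    {w : PauliString N} (e : Option (Bool × PauliString n))
    (h : ∀ e', e = some e' → ∀ l, w (ι l) = e'.2 l) (c : ℤ) :
    measOp w (fun a => ((c * entryScore e (a ∘ ι) : ℤ) : ℂ)) =
      (c : ℂ) • liftOp ι (e.elim 0 entryOp) := by
  cases e with
  | none =>
    simp only [entryScore, Option.elim_none, mul_zero, Int.cast_zero]
    rw [liftOp_zero, smul_zero]
    exact map_zero (measOp w)
  | some e =>
    have h1 := measOp_scoreSign (w := w) (u := Function.extend ι e.2 fun _ => .I) (by
      intro i hi
      by_cases hr : ∃ l, ι l = i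
      · obtain ⟨l, rfl⟩ := hr
        rw [hι.extend_apply, h e rfl l]
      · exact absurd (Function.extend_apply' _ _ _ hr) hi)
    have h2 : (fun a => ((c * entryScore (some e) (a ∘ ι) : ℤ) : ℂ)) =
        ((c : ℂ) * (-1) ^ e.1.toNat) • fun a =>
          (scoreSign (Function.extend ι e.2 fun _ => .I) a : ℂ) := by
      funext a
      rw [Pi.smul_apply, entryScore, Option.elim_some, scoreSign_comp hι, smul_eq_mul]
      push_cast
      ring
    rw [h2, map_smul, h1, Option.elim_some, liftOp_entryOp hι, smul_smul]

theorem liftOp_isHermitian {n N : ℕ} (ι : Fin n → Fin N) {A : QubitOp n} (h : A.IsHermitian) :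
    (liftOp ι A).IsHermitian := by
  rw [Matrix.IsHermitian, ← liftOp_conjTranspose, h.eq]

theorem toReal_seededDistribution {N s : ℕ} (f : BitString s → PauliString N) (w : PauliString N) :
    (seededDistribution f w).toReal = (1 / 2 ^ s) * ∑ r, if f r = w then 1 else 0 := by
  classical
  rw [seededDistribution, PMF.map_apply, tsum_fintype, ENNReal.toReal_sum (fun r _ => by
    split_ifs
    · exact PMF.apply_ne_top _ _
    · simp), Finset.mul_sum]
  refine Finset.sum_congr rfl fun r _ => ?_
  simp only [eq_comm (a := w)]
  split_ifs <;> simp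

theorem quadForm_sampledOp {N s : ℕ} (f : BitString s → PauliString N)
    (T : PauliString N → Finset (BitString N)) (v : BitString N → ℂ) :
    quadForm v (sampledOp (seededDistribution f) T) = quadForm v 1 - (1 / 2 ^ s) *
      ∑ r, quadForm v (measOp (f r) fun a => (((if a ∈ T (f r) then 1 else 0) : ℝ) : ℂ)) := by
  classical
  have h : ∀ w, measOp w (fun a => (((if a ∈ T w then 1 else 0) : ℝ) : ℂ)) =
      ∑ a ∈ T w, pauliProj w a := by
    intro w
    rw [measOp_apply, ← Finset.sum_filter_add_sum_filter_not Finset.univ (· ∈ T w),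
      Finset.sum_congr rfl (g := fun a => pauliProj w a) (fun a ha => by
        rw [if_pos (Finset.mem_filter.1 ha).2]; simp),
      Finset.sum_eq_zero (s := Finset.univ.filter fun a => ¬ a ∈ T w) (fun a ha => by
        rw [if_neg (Finset.mem_filter.1 ha).2]; simp), add_zero]
    congr 1
    ext a
    simp
  simp only [h]
  rw [sampledOp, map_sub, map_sum]
  simp only [quadForm_ofReal_smul, toReal_seededDistribution, mul_assoc, ← Finset.mul_sum]
  congr 2
  simp only [Finset.sum_mul]
  rw [Finset.sum_comm]
  refine Finset.sum_congr rfl fun r _ => ?_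
  simp

/-- The projections of a measurement add up to the identity, so the new energy is also the
probability of rejection; completeness bounds it in this form. -/
theorem quadForm_sampledOp' {N s : ℕ} (f : BitString s → PauliString N)
    (T : PauliString N → Finset (BitString N)) (v : BitString N → ℂ) :
    quadForm v (sampledOp (seededDistribution f) T) = (1 / 2 ^ s) *
      ∑ r, quadForm v (measOp (f r) fun a => (((if a ∉ T (f r) then 1 else 0) : ℝ) : ℂ)) := by
  have h : ∀ r, quadForm v (measOp (f r) fun a => (((if a ∉ T (f r) then 1 else 0) : ℝ) : ℂ)) =
      quadForm v 1 - quadForm v (measOp (f r) fun a => (((if a ∈ T (f r) then 1 else 0) : ℝ) : ℂ)) := by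
    intro r
    rw [← map_one (measOp (f r)), ← map_sub, ← map_sub]
    congr 2
    funext a
    simp only [Pi.sub_apply, Pi.one_apply]
    split_ifs <;> simp
  rw [quadForm_sampledOp]
  simp only [h, Finset.sum_sub_distrib, Finset.sum_const, Finset.card_univ, nsmul_eq_mul, mul_sub]
  congr 1
  simp

end SampledOp

/-! ### The vote applied to the table: completeness and soundness with negligible error -/

section Amplification
open Matrix
variable {ℓ τ q n N : ℕ}

/-- The sampled observables. -/
noncomputable def sampleObs {K T : ℕ} (h : 2 * (K * (T * (n + 1) + 1)) ≤ N)
    (es : List (Bool × PauliString n)) (c : ℤ) (k : Fin K) (p : Fin T) (e : Fin q → Bool) :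
    QubitOp N :=
  (c : ℂ) • liftOp (entryPos h (k, p)) (es[wordVal (List.ofFn e)]?.elim 0 entryOp)

theorem entryPos_injective_right {K T : ℕ} (h : 2 * (K * (T * (n + 1) + 1)) ≤ N)
    (κ : Fin K × Fin T) : Function.Injective (entryPos h κ) := fun l l' hl =>
  (Prod.mk.inj (entryPos_injective h (a₁ := (κ, l)) (a₂ := (κ, l')) hl)).2

theorem sampleObs_isHermitian {K T : ℕ} (h : 2 * (K * (T * (n + 1) + 1)) ≤ N)
    (es : List (Bool × PauliString n)) (c : ℤ) (k : Fin K) (p : Fin T) (e : Fin q → Bool) :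
    (sampleObs h es c k p e).IsHermitian := by
  have h1 : (liftOp (entryPos h (k, p)) (es[wordVal (List.ofFn e)]?.elim 0 entryOp)).IsHermitian :=
    liftOp_isHermitian _ (by
      cases es[wordVal (List.ofFn e)]? with
      | none => exact isHermitian_zero
      | some e => exact entryOp_isHermitian e)
  rw [sampleObs, Matrix.IsHermitian, conjTranspose_smul, h1.eq]
  simp

theorem quadForm_sampleObs_mul_self_le {K T : ℕ} (h : 2 * (K * (T * (n + 1) + 1)) ≤ N)
    (es : List (Bool × PauliString n)) {c : ℤ} (hc : c * c = 1) (k : Fin K) (p : Fin T)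
    (e : Fin q → Bool) (u : BitString N → ℂ) :
    quadForm u (sampleObs h es c k p e * sampleObs h es c k p e) ≤ quadForm u 1 := by
  have hι := entryPos_injective_right h (k, p)
  have hc' : (c : ℂ) * c = 1 := by exact_mod_cast hc
  rw [sampleObs, smul_mul_smul_comm, hc', one_smul, ← liftOp_mul hι]
  cases es[wordVal (List.ofFn e)]? with
  | none =>
    rw [Option.elim_none, mul_zero, liftOp_zero, map_zero]
    exact quadForm_one_nonneg u
  | some e => rw [Option.elim_some, entryOp_mul_self, liftOp_one hι]

theorem sampleObs_commute {K T : ℕ} (h : 2 * (K * (T * (n + 1) + 1)) ≤ N)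
    (es : List (Bool × PauliString n)) (c : ℤ) {k k' : Fin K} (p p' : Fin T) (e e' : Fin q → Bool)
    (hk : k ≠ k') : Commute (sampleObs h es c k p e) (sampleObs h es c k' p' e') := by
  refine Commute.smul_left (Commute.smul_right ?_ _) _
  cases es[wordVal (List.ofFn e)]? with
  | none => rw [Option.elim_none, liftOp_zero]; exact Commute.zero_left _
  | some e =>
    cases es[wordVal (List.ofFn e')]? with
    | none => rw [Option.elim_none, liftOp_zero]; exact Commute.zero_right _
    | some e' =>
      rw [Option.elim_some, Option.elim_some, liftOp_entryOp (entryPos_injective_right h _),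
        liftOp_entryOp (entryPos_injective_right h _)]
      refine Commute.smul_left (Commute.smul_right (pauliOp_commute fun i => ?_) _) _
      by_cases hi : ∃ l, entryPos h (k, p) l = i
      · right
        refine Function.extend_apply' _ _ _ ?_
        rintro ⟨l', rfl⟩
        obtain ⟨l, hl⟩ := hi
        exact hk (Prod.mk.inj (Prod.mk.inj (entryPos_injective h (a₁ := ((k, p), l))
          (a₂ := ((k', p'), l')) hl)).1).1
      · exact Or.inl (Function.extend_apply' _ _ _ hi)

/-- A table of length at most `2 ^ q` is hit exactly once at each of its positions as the index runs
over all `q`-bit words; the other indices contribute zero. -/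
theorem meanOp_sampleObs {K T : ℕ} (h : 2 * (K * (T * (n + 1) + 1)) ≤ N)
    {es : List (Bool × PauliString n)} (hes : es.length ≤ 2 ^ q) (c : ℤ) (k : Fin K) (p : Fin T) :
    meanOp (sampleObs (q := q) h es c k p) =
      ((c / 2 ^ q : ℝ) : ℂ) • liftOp (entryPos h (k, p)) (tableOp es) := by
  have h1 : ∑ e : Fin q → Bool, (es[wordVal (List.ofFn e)]?.elim 0 entryOp : QubitOp n) =
      tableOp es := by
    rw [sum_wordVal q (fun t => (es[t]?.elim 0 entryOp : QubitOp n)), sum_range_getElem? _ _ hes,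
      tableOp]
  rw [meanOp]
  simp only [sampleObs]
  rw [← Finset.smul_sum, ← liftOp_sum, h1, smul_smul]
  congr 1
  simp
  ring

theorem sum_meanOp_sampleObs_quadForm {K T : ℕ} (h : 2 * (K * (T * (n + 1) + 1)) ≤ N)
    {es : List (Bool × PauliString n)} (hes : es.length ≤ 2 ^ q)
    (hH : ∀ u, 1 * quadForm u 1 ≤ quadForm u (tableOp es)) (k : Fin K) (u : BitString N → ℂ) :
    T / 2 ^ q * quadForm u 1 ≤ quadForm u (∑ p, meanOp (sampleObs (q := q) h es 1 k p)) := by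
  rw [map_sum]
  have : ∀ p : Fin T, 1 / 2 ^ q * quadForm u 1 ≤
      quadForm u (meanOp (sampleObs (q := q) h es 1 k p)) := by
    intro p
    rw [meanOp_sampleObs h hes, quadForm_ofReal_smul, Int.cast_one]
    have := liftOp_quadForm (entryPos_injective_right h (k, p)) (tableOp_isHermitian es) hH u
    rw [one_mul] at this
    exact mul_le_mul_of_nonneg_left this (by positivity)
  refine le_trans (le_of_eq ?_) (Finset.sum_le_sum fun p _ => this p)
  simp
  ring

theorem sum_meanOp_sampleObs_mulVec {K T : ℕ} (h : 2 * (K * (T * (n + 1) + 1)) ≤ N)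
    {es : List (Bool × PauliString n)} (hes : es.length ≤ 2 ^ q) {ψ : BitString n → ℂ} {a : ℝ}
    (hψ : tableOp es *ᵥ ψ = (a : ℂ) • ψ) (k : Fin K) :
    (∑ p, meanOp (sampleObs (q := q) h es (-1) k p)) *ᵥ productState (entryPos h) ψ =
      ((T / 2 ^ q * (-a) : ℝ) : ℂ) • productState (entryPos h) ψ := by
  rw [Matrix.sum_mulVec]
  have : ∀ p : Fin T, meanOp (sampleObs (q := q) h es (-1) k p) *ᵥ productState (entryPos h) ψ =
      ((1 / 2 ^ q * (-a) : ℝ) : ℂ) • productState (entryPos h) ψ := by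
    intro p
    rw [meanOp_sampleObs h hes, smul_mulVec,
      liftOp_productState (entryPos_injective h) hψ (k, p), smul_smul]
    congr 1
    push_cast
    ring
  simp only [this, Finset.sum_const, Finset.card_univ, Fintype.card_fin]
  rw [← Nat.cast_smul_eq_nsmul ℂ, smul_smul]
  congr 1
  push_cast
  ring

theorem sum_quadForm_sampled_le (h : 2 * (2 * ℓ * (2 ^ τ * (n + 1) + 1)) ≤ N)
    (es : List (Bool × PauliString n)) (hτ : 2 * ℓ + 2 * q ≤ τ) {c : ℤ} (hc : c * c = 1)
    {w : BitString (2 * ℓ * ((τ + 1) * q)) → PauliString N}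
    (hw : ∀ r i, w r i = ((sampleRecs es (seedBlocks r)).flatMap fun p => [p.1, p.2]).getD i .I)
    {A : ℤ → Prop} [DecidablePred A] (hA : ∀ z, A z → z ≤ 0) {v : BitString N → ℂ}
    (hv : (∀ k u, (2 ^ τ : ℕ) / 2 ^ q * quadForm u 1 ≤
        quadForm u (∑ p, meanOp (sampleObs (q := q) h es c k p))) ∨
      ∀ k, ∃ m : ℝ, (2 ^ τ : ℕ) / 2 ^ q ≤ m ∧
        (∑ p, meanOp (sampleObs (q := q) h es c k p)) *ᵥ v = (m : ℂ) • v) :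
    (1 / 2 ^ (2 * ℓ * ((τ + 1) * q))) * ∑ r, quadForm v (measOp (w r) fun a =>
        (((if 2 * ℓ ≤ 2 * (Finset.univ.filter fun k => A (c * ∑ p,
          entryScore es[wordVal (List.ofFn (seedIndex (seedBlocks r k) p))]?
            (a ∘ entryPos h (k, p)))).card then 1 else 0) : ℝ) : ℂ)) ≤
      (2 / 2 ^ ℓ) ^ (2 * ℓ) * quadForm v 1 := by
  let e := Equiv.ofBijective _ (seedBlocks_bijective (2 * ℓ) τ q)
  have key := sum_quadForm_majority_le (fun ρ => w (e.symm ρ))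
    (O := sampleObs (q := q) h es c) (sampleObs_isHermitian h es c)
    (quadForm_sampleObs_mul_self_le h es hc)
    (fun k k' p p' e e' hk => sampleObs_commute h es c p p' e e' hk)
    (sc := fun k p ρ a => c * entryScore es[wordVal (List.ofFn (seedIndex (ρ k) p))]?
      (a ∘ entryPos h (k, p)))
    (fun k p ρ => by
      refine measOp_entryScore (entryPos_injective_right h (k, p)) _ (fun e' he' l => ?_) c
      rw [hw]
      have hρ : seedBlocks (e.symm ρ) = ρ := e.apply_symm_apply ρ
      rw [hρ]
      exact sampleRecs_letter h es ρ k p l he')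
    -- The mean of a block is at least `2 ^ τ / 2 ^ q` in absolute value and its variance at most `2
    -- ^ τ`. With the weight `2 ^ ℓ` for a failing block, the required inequality is `2 * ℓ + 2 * q
    -- ≤ τ` in the exponents.
    hA (g := (2 ^ τ : ℕ) / 2 ^ q) (y := 2 ^ ℓ) (by positivity) (one_le_pow₀ one_le_two)
    (by
      rw [div_pow, le_div_iff₀ (by positivity)]
      push_cast
      rw [← pow_mul, ← pow_mul, ← pow_mul, ← pow_add, ← pow_add]
      exact pow_le_pow_right₀ one_le_two (by omega)) hv
  have hsum : ∀ F : (Fin (2 * ℓ) → Fin (τ + 1) → Fin q → Bool) → PauliString N → ℝ,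
      ∑ ρ, F ρ (w (e.symm ρ)) = ∑ r, F (seedBlocks r) (w r) := by
    intro F
    rw [← e.sum_comp]
    refine Finset.sum_congr rfl fun r _ => ?_
    rw [e.symm_apply_apply]
    rfl
  rw [hsum fun ρ x => quadForm v (measOp x fun a => (((if 2 * ℓ ≤ 2 * (Finset.univ.filter fun k =>
    A (∑ p, c * entryScore es[wordVal (List.ofFn (seedIndex (ρ k) p))]?
      (a ∘ entryPos h (k, p)))).card then 1 else 0) : ℝ) : ℂ))] at key
  rw [one_div, ← div_eq_inv_mul, div_le_iff₀ (by positivity)]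
  simp only [Finset.mul_sum]
  refine key.trans_eq ?_
  have hcard : (Fintype.card (Fin (τ + 1) → Fin q → Bool) : ℝ) ^ (2 * ℓ) =
      2 ^ (2 * ℓ * ((τ + 1) * q)) := by
    simp only [Fintype.card_fun, Fintype.card_fin, Fintype.card_bool]
    push_cast
    rw [← pow_mul, ← pow_mul]
    congr 1
    ring
  rw [hcard]
  ring

variable (h : 2 * (2 * ℓ * (2 ^ τ * (n + 1) + 1)) ≤ N) {es : List (Bool × PauliString n)}
    (hes : es.length ≤ 2 ^ q) (hτ : 2 * ℓ + 2 * q ≤ τ)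
    {w : BitString (2 * ℓ * ((τ + 1) * q)) → PauliString N}
    (hw : ∀ r i, w r i = ((sampleRecs es (seedBlocks r)).flatMap fun p => [p.1, p.2]).getD i .I)

include h hes hτ hw

/-- Acceptance needs half of the block sums to be nonpositive although their means are at least `2 ^
τ / 2 ^ q` on the whole space. -/
theorem le_quadForm_sampledOp (hH : ∀ u, 1 * quadForm u 1 ≤ quadForm u (tableOp es))
    (v : BitString N → ℂ) : (1 - (2 / 2 ^ ℓ) ^ (2 * ℓ)) * quadForm v 1 ≤
      quadForm v (sampledOp (seededDistribution w) accepting) := by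
  have key := sum_quadForm_sampled_le h es hτ (c := 1) rfl hw (A := (· ≤ 0)) (fun _ => id) (v := v)
    (Or.inl (sum_meanOp_sampleObs_quadForm h hes hH))
  rw [quadForm_sampledOp]
  have : ∀ r a, a ∈ accepting (w r) ↔ 2 * ℓ ≤ 2 * (Finset.univ.filter fun k => 1 * ∑ p,
      entryScore es[wordVal (List.ofFn (seedIndex (seedBlocks r k) p))]?
        (a ∘ entryPos h (k, p)) ≤ 0).card := by
    intro r a
    rw [accepting, Finset.mem_filter, decideWord_iff h es (seedBlocks r) (w r) (hw r)]
    simp only [Finset.mem_univ, true_and, one_mul]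
  simp only [this]
  linarith

/-- The witness consists of one copy of `ψ` on every register. With all signs reversed, the means
are at least `2 ^ τ / 2 ^ q` at this eigenvector, and rejection becomes the unlikely event. -/
theorem exists_quadForm_sampledOp_le {ψ : BitString n → ℂ} (hψ : ψ ≠ 0) {a : ℝ}
    (hH : tableOp es *ᵥ ψ = (a : ℂ) • ψ) (ha : a ≤ -1) :
    ∃ v : BitString N → ℂ, v ≠ 0 ∧
      quadForm v (sampledOp (seededDistribution w) accepting) ≤
        (2 / 2 ^ ℓ) ^ (2 * ℓ) * quadForm v 1 := by
  refine ⟨productState (entryPos h) ψ, productState_ne_zero (entryPos_injective h) hψ, ?_⟩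
  refine le_trans ?_ (sum_quadForm_sampled_le h es hτ (c := -1) rfl hw (A := (· < 0))
    (fun _ => le_of_lt) (Or.inr fun k => ⟨_, ?_, sum_meanOp_sampleObs_mulVec h hes hH k⟩))
  · rw [quadForm_sampledOp']
    refine mul_le_mul_of_nonneg_left (Finset.sum_le_sum fun r _ =>
      quadForm_measOp_mono (w r) (fun x => ?_) _) (by positivity)
    -- A rejected outcome has fewer than `ℓ` accepting blocks among `2 * ℓ`, hence at least `ℓ` with
    -- positive sum. This is why the predicate is strict here.
    have h1 : x ∉ accepting (w r) → 2 * ℓ ≤ 2 * (Finset.univ.filter fun k => -1 * ∑ p,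
        entryScore es[wordVal (List.ofFn (seedIndex (seedBlocks r k) p))]?
          (x ∘ entryPos h (k, p)) < 0).card := by
      intro hx
      rw [accepting, Finset.mem_filter, decideWord_iff h es (seedBlocks r) (w r) (hw r)] at hx
      simp only [Finset.mem_univ, true_and] at hx
      have h2 := Finset.card_filter_add_card_filter_not (s := (Finset.univ : Finset (Fin (2 * ℓ))))
        (fun k => ∑ p, entryScore es[wordVal (List.ofFn (seedIndex (seedBlocks r k) p))]?
          (x ∘ entryPos h (k, p)) ≤ 0)
      rw [Finset.card_univ, Fintype.card_fin] at h2
      simp only [neg_one_mul, neg_lt_zero]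
      simp only [not_le] at h2
      omega
    by_cases hx : x ∈ accepting (w r)
    · rw [if_neg (not_not.2 hx)]
      split_ifs <;> norm_num
    · rw [if_pos hx, if_pos (h1 hx)]
  · have : (0 : ℝ) < (2 ^ τ : ℕ) / 2 ^ q := by positivity
    nlinarith

end Amplification


/-! ### The table of a problem -/

theorem wordVal_lt : ∀ l : List Bool, wordVal l < 2 ^ l.length
  | [] => Nat.one_pos
  | b :: l => by
    have := wordVal_lt l
    have := b.toNat_le
    rw [wordVal, List.length_cons, pow_succ]
    omega

theorem wordVal_replicate_append (m : ℕ) (l : List Bool) :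
    wordVal (List.replicate m false ++ l) = 2 ^ m * wordVal l := by
  induction m with
  | zero => simp
  | succ m ih =>
    rw [List.replicate_succ, List.cons_append, wordVal, ih, pow_succ']
    simp [mul_assoc]

theorem wordVal_append_map_false (l l' : List Bool) :
    wordVal (l ++ l'.map fun _ => false) = wordVal l := by
  induction l with
  | nil =>
    induction l' with
    | nil => rfl
    | cons a l' ih => simpa [wordVal] using ih
  | cons a l ih => rw [List.cons_append, wordVal, ih, wordVal]

theorem map_fst_zipPad {α β : Type} (d : β) : ∀ (l : List α) (l' : List β),
    (zipPad d l l').map Prod.fst = l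
  | [], _ => rfl
  | a :: l, l' => by rw [zipPad, List.map_cons, map_fst_zipPad d l]

theorem wordVal_map_snd_zipPad : ∀ (u v : List Bool), v.length ≤ u.length →
    wordVal ((zipPad false u v).map Prod.snd) = wordVal v
  | [], v, h => by
    obtain rfl := List.length_eq_zero_iff.1 (Nat.le_zero.1 h)
    rfl
  | a :: u, [], _ => by
    have := wordVal_map_snd_zipPad u [] (Nat.zero_le _)
    simpa [zipPad, wordVal] using this
  | a :: u, b :: v, h => by
    rw [zipPad, List.map_cons, wordVal, List.tail_cons,
      wordVal_map_snd_zipPad u v (Nat.le_of_succ_le_succ h)]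
    rfl

/-- Subtraction digit by digit: the incoming borrow counts as one more unit to be subtracted, the
outgoing one as a unit at the place after the last digit. -/
theorem foldl_subWord (l : List (Bool × Bool)) : ∀ (b : Bool) (e : List Bool),
    ∃ (b' : Bool) (d : List Bool), l.foldl (fun s p => ((!p.1 && (p.2 || s.1)) || (p.2 && s.1),
      s.2 ++ [Bool.xor p.1 (Bool.xor p.2 s.1)])) (b, e) = (b', e ++ d) ∧ d.length = l.length ∧
      wordVal d + wordVal (l.map Prod.snd) + b.toNat =
        wordVal (l.map Prod.fst) + 2 ^ l.length * b'.toNat := by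
  induction l with
  | nil => intro b e; exact ⟨b, [], by simp, rfl, by simp [wordVal]⟩
  | cons p l ih =>
    intro b e
    obtain ⟨b', d, h1, h2, h3⟩ := ih ((!p.1 && (p.2 || b)) || (p.2 && b))
      (e ++ [Bool.xor p.1 (Bool.xor p.2 b)])
    refine ⟨b', Bool.xor p.1 (Bool.xor p.2 b) :: d, ?_, by simp [h2], ?_⟩
    · rw [List.foldl_cons, h1]
      simp
    · simp only [List.map_cons, wordVal, List.length_cons, pow_succ]
      have h4 : 2 ^ l.length * 2 * b'.toNat = 2 * (2 ^ l.length * b'.toNat) := by ring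
      rw [h4]
      rcases p with ⟨_ | _, _ | _⟩ <;> cases b <;> simp at h3 ⊢ <;> omega

theorem subWord_spec {u v : List Bool} (h : v.length ≤ u.length) :
    (subWord u v).1 = decide (wordVal u < wordVal v) ∧
      (wordVal v ≤ wordVal u → wordVal (subWord u v).2 = wordVal u - wordVal v) := by
  obtain ⟨b, d, h1, h2, h3⟩ := foldl_subWord (zipPad false u v) false []
  rw [map_fst_zipPad, wordVal_map_snd_zipPad u v h, Bool.toNat_false, add_zero] at h3
  have h4 := wordVal_lt d
  rw [h2] at h4
  rw [subWord, h1, List.nil_append]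
  have h5 := wordVal_lt u
  cases b
  · simp only [Bool.toNat_false, mul_zero, add_zero] at h3
    exact ⟨(decide_eq_false (by omega)).symm, fun _ => by simp only; omega⟩
  · simp only [Bool.toNat_true, mul_one] at h3
    exact ⟨(decide_eq_true (by omega)).symm, fun hle => by omega⟩

theorem divWord_eq {cap : ℕ} {u v : List Bool} (hv : 0 < wordVal v) :
    divWord cap u v = min cap (wordVal u / wordVal v) := by
  have key : ∀ (k c : ℕ) (x : List Bool), v.length ≤ x.length →
      ((fun s : List Bool × ℕ => bif (subWord s.1 v).1 then s
        else ((subWord s.1 v).2, s.2 + 1))^[k] (x, c)).2 = c + min k (wordVal x / wordVal v) := by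
    intro k
    induction k with
    | zero => intro c x _; simp
    | succ k ih =>
      intro c x hx
      obtain ⟨h1, h2⟩ := subWord_spec hx
      rw [Function.iterate_succ_apply]
      simp only
      rw [h1]
      by_cases h : wordVal x < wordVal v
      · rw [decide_eq_true h, cond_true, ih c x hx, Nat.div_eq_of_lt h]
        simp
      · rw [decide_eq_false h, cond_false, ih _ _ (by rwa [length_subWord]),
          h2 (not_lt.1 h), Nat.div_eq_sub_div hv (not_lt.1 h)]
        omega
  rw [divWord, key _ _ _ (by simp), wordVal_append_map_false, zero_add]

/-- The number of table entries for a coefficient. -/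
def multiplicity (cap sh : ℕ) (x : ℚ) : ℕ := min cap (x.num.natAbs * 2 ^ sh / x.den)

theorem termEntries_eq {n : ℕ} (cap sh : ℕ) (neg : Bool) (x : ℚ) (w : PauliString n) :
    termEntries cap sh neg (Computability.encodeNat x.num.natAbs) (Computability.encodeNat x.den)
      (pauliWord w) = tableWords (List.replicate (multiplicity cap sh x) (neg, w)) := by
  rw [termEntries, divWord_eq (by rw [wordVal_encodeNat]; exact x.den_pos),
    wordVal_replicate_append, wordVal_encodeNat, wordVal_encodeNat, tableWords, List.map_replicate,
    multiplicity, mul_comm]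

theorem tableWords_append {n : ℕ} (l l' : List (Bool × PauliString n)) :
    tableWords (l ++ l') = tableWords l ++ tableWords l' := List.map_append

theorem pauliWord_one (n : ℕ) : pauliWord (fun _ : Fin n => PauliLetter.I) =
    List.replicate (2 * n) false := by
  rw [pauliWord, List.ofFn_const]
  induction n with
  | zero => rfl
  | succ n ih =>
    rw [List.replicate_succ, List.flatMap_cons, ih, Nat.mul_succ, add_comm, List.replicate_add]
    rfl

/-- The entries of the table of a problem. -/
def problemTable (c : ℕ) {n : ℕ} (P : XZProblem n) : List (Bool × PauliString n) :=
  List.replicate (multiplicity (n ^ (8 * c)) (2 * c * lg n) P.α)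
      (!decide (P.α.num < 0), fun _ => .I) ++
    (List.replicate (multiplicity (n ^ (8 * c)) (2 * c * lg n) P.β)
      (!decide (P.β.num < 0), fun _ => .I) ++
    P.terms.flatMap fun τ => List.replicate (multiplicity (n ^ (8 * c)) (2 * c * lg n + 1) τ.1)
      (decide (τ.1.num < 0), τ.2))

theorem pairUp_pairUp_flatMap {α β : Type} (f : β → α × α × α × α) (l : List β) :
    pairUp (pairUp (l.flatMap fun x => [(f x).1, (f x).2.1, (f x).2.2.1, (f x).2.2.2])) =
      l.map fun x => (((f x).1, (f x).2.1), ((f x).2.2.1, (f x).2.2.2)) := by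
  induction l with
  | nil => rfl
  | cons a l ih =>
    rw [List.flatMap_cons, List.map_cons, ← ih]
    simp only [List.cons_append, List.nil_append, pairUp_cons₂]

theorem entryTable_describe (c : ℕ) {n : ℕ} (P : XZProblem n) :
    entryTable c n P.describe = tableWords (problemTable c P) := by
  have h : P.describe = unaryWord n :: [decide (P.α.num < 0)] ::
      Computability.encodeNat P.α.num.natAbs :: Computability.encodeNat P.α.den ::
      [decide (P.β.num < 0)] :: Computability.encodeNat P.β.num.natAbs ::
      Computability.encodeNat P.β.den :: P.terms.flatMap fun τ => [[decide (τ.1.num < 0)],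
        Computability.encodeNat τ.1.num.natAbs, Computability.encodeNat τ.1.den, pauliWord τ.2] :=
    rfl
  rw [h, entryTable, problemTable, tableWords_append, tableWords_append, ← termEntries_eq,
    ← termEntries_eq, pauliWord_one]
  simp only [List.drop_succ_cons, List.drop_zero, List.headD_cons]
  rw [pairUp_pairUp_flatMap (fun τ : ℚ × PauliString n => ([decide (τ.1.num < 0)],
    Computability.encodeNat τ.1.num.natAbs, Computability.encodeNat τ.1.den, pauliWord τ.2)),
    List.flatMap_map]
  simp only [List.headD_cons, termEntries_eq]
  congr 2
  rw [tableWords, List.map_flatMap]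
  rfl

theorem length_problemTable_le (c : ℕ) {n : ℕ} (P : XZProblem n) :
    (problemTable c P).length ≤ (P.terms.length + 2) * n ^ (8 * c) := by
  have h1 : ∀ sh x, multiplicity (n ^ (8 * c)) sh x ≤ n ^ (8 * c) := fun sh x => min_le_left _ _
  have h2 : ∀ l : List (ℚ × PauliString n), (l.flatMap fun τ =>
      List.replicate (multiplicity (n ^ (8 * c)) (2 * c * lg n + 1) τ.1)
        (decide (τ.1.num < 0), τ.2)).length ≤ l.length * n ^ (8 * c) := by
    intro l
    induction l with
    | nil => simp
    | cons τ l ih =>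
      rw [List.flatMap_cons, List.length_append, List.length_replicate, List.length_cons,
        Nat.succ_mul l.length, add_comm]
      exact Nat.add_le_add ih (h1 _ _)
  have := h2 P.terms
  have h3 := h1 (2 * c * lg n) P.α
  have h4 := h1 (2 * c * lg n) P.β
  rw [problemTable, List.length_append, List.length_append, List.length_replicate,
    List.length_replicate, add_mul]
  omega

/-! ### Rounding of the coefficients -/

/-- The rounded coefficient. -/
def rounded (cap sh : ℕ) (x : ℚ) : ℝ :=
  (-1) ^ (decide (x.num < 0)).toNat * (multiplicity cap sh x : ℝ)

/-- Rounding is towards zero and costs at most `1`. Truncation moves the value towards zero as well,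
so it can spoil the lower bound only above `cap` and the upper bound only below `-cap`. Such
one-sided bounds suffice for thresholds, whose size is not controlled by `M`. -/
theorem rounded_bounds (cap sh : ℕ) (x : ℚ) :
    min (2 ^ sh * (x : ℝ)) cap - 1 ≤ rounded cap sh x ∧
      rounded cap sh x ≤ max (2 ^ sh * (x : ℝ)) (-cap) + 1 := by
  have hd : (0 : ℝ) < x.den := Nat.cast_pos.2 x.den_pos
  set a : ℝ := x.num.natAbs * 2 ^ sh / x.den with ha
  have h1 : ((x.num.natAbs * 2 ^ sh / x.den : ℕ) : ℝ) ≤ a := by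
    rw [ha]
    exact_mod_cast Nat.cast_div_le (α := ℝ) (m := x.num.natAbs * 2 ^ sh) (n := x.den)
  have h2 : a - 1 ≤ ((x.num.natAbs * 2 ^ sh / x.den : ℕ) : ℝ) := by
    have := (Nat.lt_div_mul_add (a := x.num.natAbs * 2 ^ sh) x.den_pos).le
    rw [ha, sub_le_iff_le_add, div_le_iff₀ hd]
    rw [add_mul, one_mul]
    exact_mod_cast this
  have hm1 : (multiplicity cap sh x : ℝ) ≤ cap := by exact_mod_cast min_le_left _ _
  have hm2 : (multiplicity cap sh x : ℝ) ≤ a := le_trans (by exact_mod_cast min_le_right _ _) h1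
  have hm3 : min a cap - 1 ≤ (multiplicity cap sh x : ℝ) := by
    rw [multiplicity, Nat.cast_min]
    rcases le_total (cap : ℝ) ((x.num.natAbs * 2 ^ sh / x.den : ℕ) : ℝ) with h | h
    · rw [min_eq_left h]
      linarith [min_le_right a (cap : ℝ)]
    · rw [min_eq_right h]
      linarith [min_le_left a (cap : ℝ)]
  have hm0 : (0 : ℝ) ≤ multiplicity cap sh x := Nat.cast_nonneg _
  have hx : (x : ℝ) = x.num / x.den := by exact_mod_cast (Rat.num_div_den x).symm
  rcases lt_or_ge x.num 0 with hn | hn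
  · have hxa : 2 ^ sh * (x : ℝ) = -a := by
      have : (x.num : ℝ) = -(x.num.natAbs : ℝ) := by
        rw [Nat.cast_natAbs, abs_of_neg hn]; push_cast; ring
      rw [hx, ha, this]
      ring
    rw [rounded, decide_eq_true hn, Bool.toNat_true, pow_one, neg_one_mul, hxa, max_neg_neg]
    constructor
    · linarith [min_le_left (-a) (cap : ℝ)]
    · linarith
  · have hxa : 2 ^ sh * (x : ℝ) = a := by
      have : (x.num : ℝ) = (x.num.natAbs : ℝ) := by
        rw [Nat.cast_natAbs, abs_of_nonneg hn]
      rw [hx, ha, this]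
      ring
    rw [rounded, decide_eq_false (not_lt.2 hn), Bool.toNat_false, pow_zero, one_mul, hxa]
    constructor
    · linarith
    · linarith [le_max_left a (-(cap : ℝ))]

section Rounding
open Matrix
variable {n : ℕ}

/-- A Pauli operator squares to the identity, so `1 ± pauliOp w` is half of its own square. -/
theorem abs_quadForm_pauliOp_le (w : PauliString n) (v : BitString n → ℂ) :
    |quadForm v (pauliOp w)| ≤ quadForm v 1 := by
  have hw := pauliOp_isHermitian w
  have h1 := quadForm_mul_self_nonneg v (isHermitian_one.add hw)
  have h2 := quadForm_mul_self_nonneg v (isHermitian_one.sub hw)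
  have e1 : (1 + pauliOp w) * (1 + pauliOp w) = 1 + 1 + (pauliOp w + pauliOp w) := by
    simp only [add_mul, mul_add, one_mul, mul_one, pauliOp_mul_self]
    abel
  have e2 : (1 - pauliOp w) * (1 - pauliOp w) = 1 + 1 - (pauliOp w + pauliOp w) := by
    simp only [sub_mul, mul_sub, one_mul, mul_one, pauliOp_mul_self]
    abel
  rw [e1, map_add, map_add, map_add] at h1
  rw [e2, map_sub, map_add, map_add] at h2
  rw [abs_le]
  constructor <;> linarith

theorem quadForm_tableOp_append (v : BitString n → ℂ) (l l' : List (Bool × PauliString n)) :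
    quadForm v (tableOp (l ++ l')) = quadForm v (tableOp l) + quadForm v (tableOp l') := by
  rw [tableOp, List.map_append, List.sum_append, map_add]
  rfl

theorem quadForm_tableOp_replicate (v : BitString n → ℂ) (m : ℕ) (b : Bool) (w : PauliString n) :
    quadForm v (tableOp (List.replicate m (b, w))) =
      (-1) ^ b.toNat * m * quadForm v (pauliOp w) := by
  rw [tableOp, List.map_replicate, List.sum_replicate, map_nsmul, entryOp, map_smul, nsmul_eq_mul,
    smul_eq_mul]
  ring

theorem quadForm_tableOp_terms (v : BitString n → ℂ) (cap sh : ℕ) (l : List (ℚ × PauliString n)) :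
    quadForm v (tableOp (l.flatMap fun τ => List.replicate (multiplicity cap sh τ.1)
      (decide (τ.1.num < 0), τ.2))) =
    (l.map fun τ => rounded cap sh τ.1 * quadForm v (pauliOp τ.2)).sum := by
  induction l with
  | nil => simp [tableOp]
  | cons τ l ih =>
    rw [List.flatMap_cons, quadForm_tableOp_append, ih, quadForm_tableOp_replicate, List.map_cons,
      List.sum_cons, rounded]

theorem quadForm_problemTable (c : ℕ) (P : XZProblem n) (v : BitString n → ℂ) :
    quadForm v (tableOp (problemTable c P)) =
      -(rounded (n ^ (8 * c)) (2 * c * lg n) P.α + rounded (n ^ (8 * c)) (2 * c * lg n) P.β) *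
        quadForm v 1 +
      (P.terms.map fun τ => rounded (n ^ (8 * c)) (2 * c * lg n + 1) τ.1 *
        quadForm v (pauliOp τ.2)).sum := by
  have h1 : pauliOp (fun _ : Fin n => PauliLetter.I) = 1 := tensor_one
  have h2 : ∀ b : Bool, (-1 : ℝ) ^ (!b).toNat = -(-1) ^ b.toNat := by
    intro b; cases b <;> simp
  rw [problemTable, quadForm_tableOp_append, quadForm_tableOp_append, quadForm_tableOp_terms,
    quadForm_tableOp_replicate, quadForm_tableOp_replicate, h1, h2, h2, rounded, rounded]
  ring

theorem quadForm_toProblem (P : XZProblem n) (v : BitString n → ℂ) :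
    quadForm v P.toProblem.op =
      (P.terms.map fun τ => (τ.1 : ℝ) * quadForm v (pauliOp τ.2)).sum := by
  rw [XZProblem.toProblem]
  simp only
  induction P.terms with
  | nil => simp
  | cons τ l ih =>
    rw [List.map_cons, List.sum_cons, map_add, ih, List.map_cons, List.sum_cons]
    congr 1
    have := quadForm_ofReal_smul v (τ.1 : ℝ) (pauliOp τ.2)
    simpa using this

/-- Rounding changes a sum of scaled terms by at most the number of terms. -/
theorem abs_sum_rounded_sub_le {cap sh M : ℕ} (hcap : 2 ^ sh * M ≤ cap)
    {l : List (ℚ × PauliString n)} (hl : ∀ τ ∈ l, |τ.1| ≤ (M : ℚ)) (v : BitString n → ℂ) :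
    |(l.map fun τ => rounded cap sh τ.1 * quadForm v (pauliOp τ.2)).sum -
      2 ^ sh * (l.map fun τ => (τ.1 : ℝ) * quadForm v (pauliOp τ.2)).sum| ≤
        l.length * quadForm v 1 := by
  induction l with
  | nil => simp
  | cons τ l ih =>
    have ih := ih fun τ hτ => hl τ (List.mem_cons_of_mem _ hτ)
    have hτ := hl τ List.mem_cons_self
    have hτ' : |(τ.1 : ℝ)| ≤ M := by exact_mod_cast hτ
    have hcap' : (2 : ℝ) ^ sh * M ≤ cap := by exact_mod_cast hcap
    obtain ⟨h1, h2⟩ := rounded_bounds cap sh τ.1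
    obtain ⟨h3, h4⟩ := abs_le.1 hτ'
    have hp : (0 : ℝ) < 2 ^ sh := by positivity
    have h5 : 2 ^ sh * (τ.1 : ℝ) ≤ cap := (mul_le_mul_of_nonneg_left h4 hp.le).trans hcap'
    have h6 : -(cap : ℝ) ≤ 2 ^ sh * (τ.1 : ℝ) := by nlinarith
    rw [min_eq_left h5] at h1
    rw [max_eq_left h6] at h2
    have h7 : |rounded cap sh τ.1 - 2 ^ sh * (τ.1 : ℝ)| ≤ 1 := abs_le.2 ⟨by linarith, by linarith⟩
    have h8 : |(rounded cap sh τ.1 - 2 ^ sh * (τ.1 : ℝ)) * quadForm v (pauliOp τ.2)| ≤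
        quadForm v 1 := by
      rw [abs_mul]
      calc _ ≤ 1 * quadForm v 1 := mul_le_mul h7 (abs_quadForm_pauliOp_le _ _) (abs_nonneg _)
            zero_le_one
        _ = _ := one_mul _
    rw [List.map_cons, List.map_cons, List.sum_cons, List.sum_cons, List.length_cons]
    have e : ∀ a b s t : ℝ, a + s - 2 ^ sh * (b + t) = (a - 2 ^ sh * b) + (s - 2 ^ sh * t) := by
      intros; ring
    rw [e, ← mul_assoc, ← sub_mul]
    refine (abs_add_le _ _).trans ((add_le_add h8 ih).trans_eq ?_)
    push_cast
    ring

theorem abs_quadForm_toProblem_le {M : ℕ} {P : XZProblem n} (hM : P.terms.length ≤ M)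
    (hl : ∀ τ ∈ P.terms, |τ.1| ≤ (M : ℚ)) (v : BitString n → ℂ) :
    |quadForm v P.toProblem.op| ≤ M * M * quadForm v 1 := by
  have key : ∀ l : List (ℚ × PauliString n), (∀ τ ∈ l, |τ.1| ≤ (M : ℚ)) →
      |(l.map fun τ => (τ.1 : ℝ) * quadForm v (pauliOp τ.2)).sum| ≤
        l.length * M * quadForm v 1 := by
    intro l hl
    induction l with
    | nil => simp
    | cons τ l ih =>
      have ih := ih fun τ hτ => hl τ (List.mem_cons_of_mem _ hτ)
      have hτ := hl τ List.mem_cons_self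
      have hτ' : |(τ.1 : ℝ)| ≤ M := by exact_mod_cast hτ
      rw [List.map_cons, List.sum_cons, List.length_cons]
      have h8 : |(τ.1 : ℝ) * quadForm v (pauliOp τ.2)| ≤ M * quadForm v 1 := by
        rw [abs_mul]
        exact mul_le_mul hτ' (abs_quadForm_pauliOp_le _ _) (abs_nonneg _) (Nat.cast_nonneg _)
      refine (abs_add_le _ _).trans ((add_le_add h8 ih).trans_eq ?_)
      push_cast
      ring
  rw [quadForm_toProblem]
  refine (key P.terms hl).trans ?_
  have h1 : (P.terms.length : ℝ) ≤ M := by exact_mod_cast hM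
  exact mul_le_mul_of_nonneg_right (mul_le_mul_of_nonneg_right h1 (Nat.cast_nonneg _))
    (quadForm_one_nonneg v)

end Rounding


/-! ### The promise gap of the table -/

section Gap
open Matrix

/-- Here `y` is a threshold, `r` its rounded multiple, `x` a squared norm and `z` an energy. If `y`
was truncated, the bound still holds because the cap exceeds all energies that occur. -/
theorem mul_sub_le_rounded_mul {B cap y r x z : ℝ} (hx : 0 ≤ x) (hB : 0 ≤ B)
    (hr : min (B * y) cap - 1 ≤ r) (hz : z ≤ y * x) (hcap : B * z ≤ cap * x) :
    B * z - x ≤ r * x := by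
  have h := mul_le_mul_of_nonneg_right hr hx
  rcases min_choice (B * y) cap with h' | h' <;> rw [h'] at h
  · have := mul_le_mul_of_nonneg_left hz hB
    linarith
  · linarith

theorem rounded_mul_le {B cap y r x z : ℝ} (hx : 0 ≤ x) (hB : 0 ≤ B)
    (hr : r ≤ max (B * y) (-cap) + 1) (hz : y * x ≤ z) (hcap : -(B * z) ≤ cap * x) :
    r * x ≤ B * z + x := by
  have h := mul_le_mul_of_nonneg_right hr hx
  rcases max_choice (B * y) (-cap) with h' | h' <;> rw [h'] at h
  · have := mul_le_mul_of_nonneg_left hz hB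
    linarith
  · linarith

variable {n c M p : ℕ} {P : XZProblem n}

theorem two_pow_lg_le_sq (hn : 2 ≤ n) : 2 ^ lg n ≤ n ^ 2 := by
  rw [lg_eq, pow_succ, sq]
  exact Nat.mul_le_mul (Nat.pow_log_le_self 2 (by omega)) hn

theorem lt_two_pow_lg (n : ℕ) : n < 2 ^ lg n := by
  rw [lg_eq]
  exact Nat.lt_pow_succ_log_self one_lt_two n

variable (hn : 2 ≤ n) (hM : M + 3 ≤ (2 ^ lg n) ^ c) (hp : p ≤ (2 ^ lg n) ^ c) (hp0 : 0 < p)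
  (hgap : 1 / (p : ℚ) ≤ P.β - P.α) (hlen : P.terms.length ≤ M)
  (hcoef : ∀ τ ∈ P.terms, |τ.1| ≤ (M : ℚ))

-- The three factors `B`, `M + 3`, `M + 3` are at most `n ^ (4 * c)`, `n ^ (2 * c)`, `n ^ (2 * c)`.
-- The summand `1` leaves room for energies shifted by the gap.
include hn hM in
theorem table_cap : 2 ^ (2 * c * lg n) * (M * M + 1) ≤ n ^ (8 * c) := by
  have h1 : 2 ^ (2 * c * lg n) ≤ n ^ (4 * c) := by
    calc 2 ^ (2 * c * lg n) = (2 ^ lg n) ^ (2 * c) := by rw [← pow_mul]; ring_nf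
      _ ≤ (n ^ 2) ^ (2 * c) := Nat.pow_le_pow_left (two_pow_lg_le_sq hn) _
      _ = _ := by rw [← pow_mul]; ring_nf
  have h2 : M + 3 ≤ n ^ (2 * c) := hM.trans (by
    rw [pow_mul]
    exact Nat.pow_le_pow_left (two_pow_lg_le_sq hn) _)
  calc 2 ^ (2 * c * lg n) * (M * M + 1) ≤ n ^ (4 * c) * (n ^ (2 * c) * n ^ (2 * c)) :=
        Nat.mul_le_mul h1 (le_trans (by nlinarith) (Nat.mul_le_mul h2 h2))
    _ = _ := by rw [← pow_add, ← pow_add]; ring_nf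

-- The scaled gap has to pay for the rounding of at most `M` terms and of two thresholds, and for
-- the final distance `1` from zero.
include hM hp hp0 in
theorem le_pow_mul_inv : (M + 3 : ℝ) ≤ 2 ^ (2 * c * lg n) * (1 / p) := by
  have h1 : (M + 3) * p ≤ 2 ^ (2 * c * lg n) :=
    (Nat.mul_le_mul hM hp).trans_eq (by rw [← pow_mul, ← pow_add]; ring_nf)
  rw [mul_one_div, le_div_iff₀ (Nat.cast_pos.2 hp0)]
  exact_mod_cast h1

include hn hM hp hp0 hgap hlen hcoef

/-- For a unit vector of energy `h ≤ α`, also `h + 1 / p ≤ β`, and the rounded thresholds are at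
least `B * h - 1` and `B * (h + 1 / p) - 1`. Subtracting them from the terms, which are at most `2 *
B * h + M`, leaves `M + 2 - B / p ≤ -1`. -/
theorem quadForm_problemTable_le {v : BitString n → ℂ}
    (hv : quadForm v P.toProblem.op ≤ P.α * quadForm v 1) :
    quadForm v (tableOp (problemTable c P)) ≤ (-1) * quadForm v 1 := by
  have hx := quadForm_one_nonneg v
  have hcap := table_cap hn hM
  have hcapR : (2 : ℝ) ^ (2 * c * lg n) * (M * M + 1) ≤ (n ^ (8 * c) : ℕ) := by exact_mod_cast hcap
  have hBD := le_pow_mul_inv (n := n) (c := c) hM hp hp0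
  have hD : (1 : ℝ) / p ≤ 1 := by
    rw [div_le_one (Nat.cast_pos.2 hp0)]
    exact_mod_cast hp0
  have hgapR : (1 : ℝ) / p ≤ P.β - P.α := by
    simpa using (Rat.cast_le (K := ℝ)).2 hgap
  have hT := abs_sum_rounded_sub_le (cap := n ^ (8 * c)) (sh := 2 * c * lg n + 1) (M := M) (by
    refine le_trans ?_ hcap
    rw [pow_succ, mul_assoc]
    exact Nat.mul_le_mul_left _ (by nlinarith [sq_nonneg ((M : ℤ) - 1)])) hcoef v
  have hh := abs_quadForm_toProblem_le hlen hcoef v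
  rw [← quadForm_toProblem, pow_succ] at hT
  rw [quadForm_problemTable]
  set B : ℝ := 2 ^ (2 * c * lg n) with hB
  have hB0 : 0 < B := by positivity
  set x := quadForm v 1
  set h := quadForm v P.toProblem.op
  obtain ⟨hh1, hh2⟩ := abs_le.1 hh
  obtain ⟨hT1, hT2⟩ := abs_le.1 hT
  have hlenR : (P.terms.length : ℝ) ≤ M := by exact_mod_cast hlen
  have hlx := mul_le_mul_of_nonneg_right hlenR hx
  have hcx := mul_le_mul_of_nonneg_right hcapR hx
  have hDx := mul_le_mul_of_nonneg_right hD hx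
  have hgx := mul_le_mul_of_nonneg_right hgapR hx
  have hBx := mul_le_mul_of_nonneg_right hBD hx
  have hBh := mul_le_mul_of_nonneg_left hh2 hB0.le
  have hBDx := mul_le_mul_of_nonneg_left hDx hB0.le
  have hα := mul_sub_le_rounded_mul (z := h) hx hB0.le
    (rounded_bounds (n ^ (8 * c)) (2 * c * lg n) P.α).1 hv (by nlinarith)
  have hβ := mul_sub_le_rounded_mul (z := h + 1 / p * x) hx hB0.le
    (rounded_bounds (n ^ (8 * c)) (2 * c * lg n) P.β).1 (by linarith) (by linarith)
  linarith

/-- The mirror image: energy at least `β` lies above `α` by at least `1 / p`, and the upper bounds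
for the rounded thresholds are used. -/
theorem le_quadForm_problemTable {v : BitString n → ℂ}
    (hv : P.β * quadForm v 1 ≤ quadForm v P.toProblem.op) :
    1 * quadForm v 1 ≤ quadForm v (tableOp (problemTable c P)) := by
  have hx := quadForm_one_nonneg v
  have hcap := table_cap hn hM
  have hcapR : (2 : ℝ) ^ (2 * c * lg n) * (M * M + 1) ≤ (n ^ (8 * c) : ℕ) := by exact_mod_cast hcap
  have hBD := le_pow_mul_inv (n := n) (c := c) hM hp hp0
  have hD : (1 : ℝ) / p ≤ 1 := by
    rw [div_le_one (Nat.cast_pos.2 hp0)]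
    exact_mod_cast hp0
  have hgapR : (1 : ℝ) / p ≤ P.β - P.α := by
    simpa using (Rat.cast_le (K := ℝ)).2 hgap
  have hT := abs_sum_rounded_sub_le (cap := n ^ (8 * c)) (sh := 2 * c * lg n + 1) (M := M) (by
    refine le_trans ?_ hcap
    rw [pow_succ, mul_assoc]
    exact Nat.mul_le_mul_left _ (by nlinarith [sq_nonneg ((M : ℤ) - 1)])) hcoef v
  have hh := abs_quadForm_toProblem_le hlen hcoef v
  rw [← quadForm_toProblem, pow_succ] at hT
  rw [quadForm_problemTable]
  set B : ℝ := 2 ^ (2 * c * lg n) with hB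
  have hB0 : 0 < B := by positivity
  set x := quadForm v 1
  set h := quadForm v P.toProblem.op
  obtain ⟨hh1, hh2⟩ := abs_le.1 hh
  obtain ⟨hT1, hT2⟩ := abs_le.1 hT
  have hlenR : (P.terms.length : ℝ) ≤ M := by exact_mod_cast hlen
  have hlx := mul_le_mul_of_nonneg_right hlenR hx
  have hcx := mul_le_mul_of_nonneg_right hcapR hx
  have hDx := mul_le_mul_of_nonneg_right hD hx
  have hgx := mul_le_mul_of_nonneg_right hgapR hx
  have hBx := mul_le_mul_of_nonneg_right hBD hx
  have hBh := mul_le_mul_of_nonneg_left hh1 hB0.le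
  have hBDx := mul_le_mul_of_nonneg_left hDx hB0.le
  have hβ := rounded_mul_le (z := h) hx hB0.le
    (rounded_bounds (n ^ (8 * c)) (2 * c * lg n) P.β).2 hv (by nlinarith)
  have hα := rounded_mul_le (z := h - 1 / p * x) hx hB0.le
    (rounded_bounds (n ^ (8 * c)) (2 * c * lg n) P.α).2 (by linarith) (by linarith)
  linarith

end Gap

/-! ### Parameters -/

/-- The base `2 ^ lg n` is used instead of `n` because it is at least `2` for every `n`, and because
its powers are powers of two with exponents linear in `lg n`. -/
theorem exists_eval_le_two_pow_lg (f : Polynomial ℕ) :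
    ∃ c, ∀ n, f.eval n ≤ (2 ^ lg n) ^ c := by
  have h1 : ∀ n, 2 ≤ 2 ^ lg n := fun n => by
    rw [lg_eq]
    exact Nat.le_self_pow (Nat.succ_ne_zero _) 2
  induction f using Polynomial.induction_on' with
  | add f g hf hg =>
    obtain ⟨c, hc⟩ := hf
    obtain ⟨d, hd⟩ := hg
    refine ⟨c + d + 1, fun n => ?_⟩
    have hp : 0 < 2 ^ lg n := by positivity
    have h2 : (2 ^ lg n) ^ c ≤ (2 ^ lg n) ^ (c + d) := Nat.pow_le_pow_right hp (by omega)
    have h3 : (2 ^ lg n) ^ d ≤ (2 ^ lg n) ^ (c + d) := Nat.pow_le_pow_right hp (by omega)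
    rw [Polynomial.eval_add, pow_succ]
    have := Nat.mul_le_mul_left ((2 ^ lg n) ^ (c + d)) (h1 n)
    have := hc n
    have := hd n
    omega
  | monomial k a =>
    refine ⟨a + k, fun n => ?_⟩
    rw [Polynomial.eval_monomial, pow_add]
    refine Nat.mul_le_mul ?_ (Nat.pow_le_pow_left (lt_two_pow_lg n).le k)
    exact Nat.lt_two_pow_self.le.trans (Nat.pow_le_pow_left (h1 n) a)

/-- For `n ≥ 2` one has `2 ^ lg n ≤ n ^ 2` and `lg n ≤ n`, which makes the number of letters, two
per record, polynomial. -/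
theorem qubits_le {c n : ℕ} (hn : 2 ≤ n) :
    2 * (2 * lg n * (2 ^ ((18 * c + 3) * lg n) * (n + 1) + 1)) ≤
      (Polynomial.X ^ (36 * c + 16) : Polynomial ℕ).eval n * n := by
  rw [Polynomial.eval_pow, Polynomial.eval_X]
  have h1 : 2 ^ ((18 * c + 3) * lg n) ≤ n ^ (36 * c + 6) := by
    calc 2 ^ ((18 * c + 3) * lg n) = (2 ^ lg n) ^ (18 * c + 3) := by rw [← pow_mul]; ring_nf
      _ ≤ (n ^ 2) ^ (18 * c + 3) := Nat.pow_le_pow_left (two_pow_lg_le_sq hn) _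
      _ = _ := by rw [← pow_mul]; ring_nf
  have h2 : lg n ≤ n := by
    rw [lg_eq]
    exact Nat.log_lt_self 2 (by omega)
  have h3 : 1 ≤ n ^ (36 * c + 6) := Nat.one_le_pow _ _ (by omega)
  calc 2 * (2 * lg n * (2 ^ ((18 * c + 3) * lg n) * (n + 1) + 1))
      ≤ 2 * (2 * n * (n ^ (36 * c + 6) * (n + 1) + n ^ (36 * c + 6))) := by gcongr
    _ = n ^ (36 * c + 6) * (4 * (n * (n + 2))) := by ring
    _ ≤ n ^ (36 * c + 6) * n ^ 11 := by
      refine Nat.mul_le_mul_left _ ?_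
      calc 4 * (n * (n + 2)) ≤ (n * n) * (n * (n * n)) := by
            refine Nat.mul_le_mul ?_ (Nat.mul_le_mul_left _ ?_) <;> nlinarith
        _ = n ^ 5 := by ring
        _ ≤ n ^ 11 := Nat.pow_le_pow_right (by omega) (by norm_num)
    _ = n ^ (36 * c + 16) * n := by ring

/-- As `lg n` is one more than the logarithm, the base is `2 ^ (-Nat.log 2 n)`, while the exponent
is at least `Nat.log 2 n`. -/
theorem error_le (n : ℕ) : ((2 : ℝ) / 2 ^ lg n) ^ (2 * lg n) ≤ 1 / 2 ^ (Nat.log 2 n * Nat.log 2 n) := by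
  rw [lg_eq, pow_succ, mul_comm _ (2 : ℝ), div_mul_cancel_left₀ two_ne_zero, ← one_div,
    one_div_pow, ← pow_mul]
  refine one_div_le_one_div_of_le (by positivity) (pow_le_pow_right₀ one_le_two ?_)
  exact Nat.mul_le_mul_left _ (by omega)

/-- Once the logarithm is at least `k + 2`, its square exceeds `(log + 1) * (k + 1)`, so the
denominator is at least `n ^ (k + 1)`. -/
theorem negligible_two_div : Negligible fun n => 2 / 2 ^ (Nat.log 2 n * Nat.log 2 n) := by
  intro k
  refine squeeze_zero' (Filter.Eventually.of_forall fun n => by positivity) ?_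
    (tendsto_const_div_atTop_nhds_zero_nat 2)
  filter_upwards [Filter.eventually_ge_atTop (2 ^ (k + 2))] with n hn
  have hn0 : 0 < n := lt_of_lt_of_le (by positivity) hn
  have h1 : k + 2 ≤ Nat.log 2 n := Nat.le_log_of_pow_le one_lt_two hn
  have h2 : n ^ (k + 1) ≤ 2 ^ (Nat.log 2 n * Nat.log 2 n) := by
    calc n ^ (k + 1) ≤ (2 ^ (Nat.log 2 n + 1)) ^ (k + 1) :=
          Nat.pow_le_pow_left (Nat.lt_pow_succ_log_self one_lt_two n).le _
      _ = 2 ^ ((Nat.log 2 n + 1) * (k + 1)) := by rw [← pow_mul]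
      _ ≤ _ := Nat.pow_le_pow_right two_pos (by nlinarith)
  have h3 : (n : ℝ) ^ (k + 1) ≤ 2 ^ (Nat.log 2 n * Nat.log 2 n) := by exact_mod_cast h2
  have hn' : (0 : ℝ) < n := Nat.cast_pos.2 hn0
  rw [mul_div_assoc', div_le_div_iff₀ (by positivity) hn']
  rw [pow_succ] at h3
  linarith

/-- The operator averages projections, so it lies between `0` and `1`; this settles the degenerate
sizes `n < 2`. -/
theorem sampledOp_trivial_bounds {N s : ℕ} (f : BitString s → PauliString N)
    (T : PauliString N → Finset (BitString N)) (v : BitString N → ℂ) :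
    0 ≤ quadForm v (sampledOp (seededDistribution f) T) ∧
      quadForm v (sampledOp (seededDistribution f) T) ≤ quadForm v 1 := by
  constructor
  · rw [quadForm_sampledOp']
    refine mul_nonneg (by positivity) (Finset.sum_nonneg fun r _ =>
      quadForm_measOp_nonneg _ (fun a => ?_) v)
    split_ifs <;> norm_num
  · rw [quadForm_sampledOp]
    refine sub_le_self _ (mul_nonneg (by positivity) (Finset.sum_nonneg fun r _ =>
      quadForm_measOp_nonneg _ (fun a => ?_) v))
    split_ifs <;> norm_num

/-- Soundness and completeness of the reduction. -/
theorem sampler_correct {n c M p N s : ℕ} {P : XZProblem n} (hn : 2 ≤ n)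
    (hM : M + 3 ≤ (2 ^ lg n) ^ c) (hp : p ≤ (2 ^ lg n) ^ c) (hp0 : 0 < p)
    (hgap : 1 / (p : ℚ) ≤ P.β - P.α) (hlen : P.terms.length ≤ M)
    (hcoef : ∀ τ ∈ P.terms, |τ.1| ≤ (M : ℚ))
    (hN : 2 * (2 * lg n * (2 ^ ((18 * c + 3) * lg n) * (n + 1) + 1)) ≤ N)
    (hs : s = 2 * lg n * (((18 * c + 3) * lg n + 1) * (9 * c * lg n))) :
    (P.toProblem.IsYes → sInf (spectrum ℝ (sampledOp (seededDistribution
        (sampler c n N (entryTable c n P.describe) : BitString s → PauliString N)) accepting)) ≤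
      1 / 2 ^ (Nat.log 2 n * Nat.log 2 n)) ∧
    (P.toProblem.IsNo → 1 - 1 / 2 ^ (Nat.log 2 n * Nat.log 2 n) ≤
      sInf (spectrum ℝ (sampledOp (seededDistribution
        (sampler c n N (entryTable c n P.describe) : BitString s → PauliString N)) accepting))) := by
  subst hs
  -- The table has at most `M + 2` groups of at most `n ^ (8 * c)` entries; the exponents `c` and `8
  -- * c` make up the index length `q = 9 * c * lg n`.
  have hes : (problemTable c P).length ≤ 2 ^ (9 * c * lg n) := by
    calc (problemTable c P).length ≤ (P.terms.length + 2) * n ^ (8 * c) :=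
          length_problemTable_le c P
      _ ≤ (2 ^ lg n) ^ c * (2 ^ lg n) ^ (8 * c) := Nat.mul_le_mul (by omega)
          (Nat.pow_le_pow_left (lt_two_pow_lg n).le _)
      _ = 2 ^ (9 * c * lg n) := by rw [← pow_add, ← pow_mul]; ring_nf
  have hτ : 2 * lg n + 2 * (9 * c * lg n) ≤ (18 * c + 3) * lg n := by nlinarith
  have hw : ∀ (r : BitString (2 * lg n * (((18 * c + 3) * lg n + 1) * (9 * c * lg n)))) i,
      sampler c n N (entryTable c n P.describe) r i =
        ((sampleRecs (problemTable c P) (seedBlocks r)).flatMap fun p => [p.1, p.2]).getD i .I := by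
    intro r i
    rw [sampler, entryTable_describe, sampleLetters_tableWords _ r i.2]
  have hH := sampledOp_isHermitian (seededDistribution (sampler c n N (entryTable c n P.describe) :
    BitString (2 * lg n * (((18 * c + 3) * lg n + 1) * (9 * c * lg n))) → PauliString N)) accepting
  constructor
  · intro hyes
    obtain ⟨u, hu, hHu⟩ := exists_groundState P.toProblem.isHermitian
    have hle : quadForm u P.toProblem.op ≤ P.α * quadForm u 1 := by
      rw [quadForm_of_eigenvector hHu]
      exact mul_le_mul_of_nonneg_right hyes (quadForm_one_nonneg u)
    have hA := tableOp_isHermitian (problemTable c P)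
    have ha := sInf_spectrum_le hA hu
      (quadForm_problemTable_le hn hM hp hp0 hgap hlen hcoef hle)
    obtain ⟨ψ, hψ, hAψ⟩ := exists_groundState hA
    obtain ⟨v, hv, hvle⟩ := exists_quadForm_sampledOp_le hN hes hτ hw hψ hAψ ha
    exact (sInf_spectrum_le hH hv hvle).trans (error_le n)
  · intro hno
    -- In the NO case the bound is needed for all vectors, not only for a ground state, because it
    -- is lifted to registers in arbitrary joint states.
    have hle : ∀ u, 1 * quadForm u 1 ≤ quadForm u (tableOp (problemTable c P)) := fun u =>
      le_quadForm_problemTable hn hM hp hp0 hgap hlen hcoef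
        ((mul_le_mul_of_nonneg_right hno (quadForm_one_nonneg u)).trans
          (sInf_spectrum_mul_le_quadForm P.toProblem.isHermitian u))
    refine (sub_le_sub_left (error_le n) 1).trans (le_sInf_spectrum hH fun v => ?_)
    exact le_quadForm_sampledOp hN hes hτ hw hle v

end XZSubsampling

open XZSubsampling in
/-- For every 2-local X/Z Hamiltonian family with inverse-polynomial promise gap (in particular
for every such family that is QMA-complete) there is a polynomial-time Karp reduction `red` to
problems `(𝟙 - 𝔼_{w ∼ D} ∑_{a ∈ T w} π^w_a, α' n, β' n)` on `t(n) * n` qubits with promise gap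
`1 - negl(n)`. Here `red P` is the description from which `D` is sampled and membership in `T w`
is decided, both in polynomial time, and the sampler uses `s(log n)` uniformly random bits for a
polynomial `s`, i.e. a seed space of size `2 ^ polylog(n)`. -/
theorem mainTheorem8 (F : (n : ℕ) → Set (XZProblem n))
    (hF : IsTwoLocalXZFamily F) (hgap : HasInversePolyGap F) :
    ∃ (t s : Polynomial ℕ) (α' β' : ℕ → ℚ) (ν : ℕ → ℝ)
      (red : (n : ℕ) → XZProblem n → Description)
      (samp : (n : ℕ) → Description →
        BitString (s.eval (Nat.log 2 n)) → PauliString (t.eval n * n))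
      (T : (n : ℕ) → Description → PauliString (t.eval n * n) →
        Finset (BitString (t.eval n * n))),
      Negligible ν ∧
      (∀ n, 1 - ν n ≤ (β' n : ℝ) - (α' n : ℝ)) ∧
      -- the reduction `P ↦ (α' n, β' n, red P)`
      IsPolyTime
        (fun P : (n : ℕ) × XZProblem n => P.2.describe)
        (fun o : ℚ × ℚ × Description => ratWords o.1 ++ ratWords o.2.1 ++ o.2.2)
        (fun P => (α' P.1, β' P.1, red P.1 P.2)) ∧
      -- the sampler `(n, r, y) ↦ w`
      IsPolyTime
        (fun i : (n : ℕ) × (BitString (s.eval (Nat.log 2 n)) × Description) =>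
          unaryWord i.1 :: bitWord i.2.1 :: i.2.2)
        (fun w : (N : ℕ) × PauliString N => [pauliWord w.2])
        (fun i => ⟨t.eval i.1 * i.1, samp i.1 i.2.2 i.2.1⟩) ∧
      -- the decision procedure `(n, w, a, y) ↦ [a ∈ T w]`
      IsPolyTime
        (fun i : (n : ℕ) × (PauliString (t.eval n * n) × BitString (t.eval n * n) ×
            Description) =>
          unaryWord i.1 :: pauliWord i.2.1 :: bitWord i.2.2.1 :: i.2.2.2)
        (fun b : Bool => [[b]])
        (fun i => decide (i.2.2.1 ∈ T i.1 i.2.2.2 i.2.1)) ∧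
      -- correctness on every problem of the family
      ∀ n, ∀ P ∈ F n,
        (P.toProblem.IsYes →
          (sampledProblem (seededDistribution (samp n (red n P))) (T n (red n P))
            (α' n) (β' n)).IsYes) ∧
        (P.toProblem.IsNo →
          (sampledProblem (seededDistribution (samp n (red n P))) (T n (red n P))
            (α' n) (β' n)).IsNo) := by
  obtain ⟨m, hm⟩ := hF
  obtain ⟨α, β, hαβ, p, hp⟩ := hgap
  -- One exponent dominates both the size bounds of the family and the inverse promise gap.
  obtain ⟨c, hc⟩ := exists_eval_le_two_pow_lg (m + 3 + p)
  have hcm : ∀ n, m.eval n + 3 ≤ (2 ^ lg n) ^ c := fun n => by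
    have := hc n
    simp only [Polynomial.eval_add, Polynomial.eval_ofNat] at this
    omega
  have hcp : ∀ n, p.eval n ≤ (2 ^ lg n) ^ c := fun n => by
    have := hc n
    simp only [Polynomial.eval_add, Polynomial.eval_ofNat] at this
    omega
  -- The seed length is the number of blocks times `τ + 1` words of `q` bits, a cubic polynomial in
  -- the logarithm, where `lg n` is `Nat.log 2 n + 1`.
  let s : Polynomial ℕ := 2 * (Polynomial.X + 1) * ((((18 * c + 3 : ℕ) : Polynomial ℕ) *
    (Polynomial.X + 1) + 1) * (((9 * c : ℕ) : Polynomial ℕ) * (Polynomial.X + 1)))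
  have hs : ∀ n, s.eval (Nat.log 2 n) =
      2 * lg n * (((18 * c + 3) * lg n + 1) * (9 * c * lg n)) := fun n => by
    simp only [s, lg_eq, Polynomial.eval_mul, Polynomial.eval_add, Polynomial.eval_ofNat,
      Polynomial.eval_X, Polynomial.eval_one, Polynomial.eval_natCast, Nat.cast_id]
  refine ⟨Polynomial.X ^ (36 * c + 16), s, fun n => 1 / 2 ^ (Nat.log 2 n * Nat.log 2 n),
    fun n => 1 - 1 / 2 ^ (Nat.log 2 n * Nat.log 2 n), fun n => 2 / 2 ^ (Nat.log 2 n * Nat.log 2 n),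
    fun n P => entryTable c n P.describe, fun n y => sampler c n _ y, fun _ _ => accepting,
    negligible_two_div, fun n => ?_, isPolyTime_reduction c,
    isPolyTime_sampler c _ fun n => s.eval (Nat.log 2 n), isPolyTime_accepting _, fun n P hP => ?_⟩
  · push_cast
    have : (2 : ℝ) / 2 ^ (Nat.log 2 n * Nat.log 2 n) = 2 * (1 / 2 ^ (Nat.log 2 n * Nat.log 2 n)) := by
      ring
    linarith
  simp only [HamiltonianProblem.IsYes, HamiltonianProblem.IsNo, HamiltonianProblem.groundEnergy,
    sampledProblem]
  push_cast
  rcases lt_or_ge n 2 with hn | hn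
  -- For `n < 2` the thresholds are `α' = 1` and `β' = 0`, so every sampled problem satisfies both
  -- conclusions; the function `ν` equals `2` there.
  · have h0 : Nat.log 2 n = 0 := Nat.log_of_lt hn
    rw [h0, mul_zero, pow_zero, div_one, sub_self]
    refine ⟨fun _ => sInf_spectrum_le (sampledOp_isHermitian _ _) (v := fun _ => 1)
      (fun h => one_ne_zero (congr_fun h fun _ => false)) ?_,
      fun _ => le_sInf_spectrum (sampledOp_isHermitian _ _) fun v => ?_⟩
    · rw [one_mul]
      exact (sampledOp_trivial_bounds _ _ _).2
    · rw [zero_mul]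
      exact (sampledOp_trivial_bounds _ _ _).1
  · obtain ⟨h1, -, h2⟩ := hm n P hP
    obtain ⟨h3, h4⟩ := hαβ n P hP
    obtain ⟨h5, h6⟩ := hp n
    exact sampler_correct hn (hcm n) (hcp n) h5 (by rw [h3, h4]; exact h6) h1
      (fun τ hτ => (h2 τ hτ).1) (qubits_le hn) (hs n)
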